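/- **Permutability of Jonas transformations.** Let $m\ge 1$, $N\ge 0$ be integers and, for $r>0$, let $B_0(r)=\{\xi\in\mathbb R^m : 0\le \xi_i\le r\}$. A smooth map $x:B_0(r)\to\mathbb R^N$ is a *conjugate net* if $\partial_i\partial_jx\in\mathrm{span}(\partial_ix,\partial_jx)$ at every point for all $i\ne j$. A pair of conjugate nets $x,x^+:B_0(r)\to\mathbb R^N$ is a *Jonas pair* ($x^+$ is a *Jonas transformation* of $x$) if at every point and for every $i$ there are $c,c'\in\mathbb R$ with $\partial_ix^+-\partial_ix=c\,\partial_ix+c'(x^+-x)$. If $x_1,x_2$ are Jonas transformations of $x$, a *coplanar common transform* of $(x;x_1,x_2)$ is a net $y$ which is a Jonas transformation of both $x_1$ and $x_2$ and for which the four points $x(\xi),x_1(\xi),x_2(\xi),y(\xi)$ are coplanar for every $\xi$. Non-degeneracy conditions at $\xi=0$. The triple $(x;x_1,x_2)$ is *generic* if at $\xi=0$, for all $i\neq j$ and $a=1,2$, each of the systems $(\partial_ix,\;x_1-x,\;x_2-x)$, $(\partial_ix,\partial_jx,\;x_a-x)$, $(\partial_ix_a,\;x_a-x)$ is linearly independent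 (the first and third for every $i$). A pair $(s,t)\in\mathbb R^2$ is *admissible* for $(x;x_1,x_2)$ if $s\ne0$, $t\neq0$, $s+t\ne1$ and for every $i$ the vectors $(1-s-t)\partial_ix+s\,\partial_ix_1+t\,\partial_ix_2$, $x_1-x$, $x_2-x$ are linearly independent at $\xi=0$. A point $p$ is *in general position* with respect to $(x;x_1,x_2)$ if $p=x(0)+s(x_1(0)-x(0))+t(x_2(0)-x(0))$ with $(s,t)$ admissible. 1. **Two transforms.** Let $x_1,x_2:B_0(r)\to\mathbb R^N$ be Jonas transformations of the conjugate net $x$, with $(x;x_1,x_2)$ generic. Then the set $U\subset\mathbb R^2$ of admissible pairs is open and dense, and every point of $U$ has an open neighbourhood $V$ for which there are $0<\rho\le r$ and a two-parameter family of nets $y_{s,t}:B_0(\rho)\to\mathbb R^N$, $(s,t)\in V$, jointly smooth in $(s,t,\xi)$, such that $y_{s,t}$ is a coplanar common transform of $(x;x_1,x_2)$ with $y_{s,t}(0)=x(0)+s(x_1(0)-x(0))+t(x_2(0)-x(0))$. For every $0<\rho'\le\rho$, any coplanar common transform of $(x;x_1,x_2)$ on $B_0(\rho')$ with this value at $0$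 coincides with $y_{s,t}$ on $B_0(\rho')$. Moreover, coplanarity of corresponding points is automatic in general position: let $x_1,x_2$ be any Jonas transformations of $x$, and let $y$ be any Jonas transformation of both $x_1$ and $x_2$, all on $B_0(r)$. If at a point $\xi\in B_0(r)$ there are indices $i,j$ such that $\partial_ix,\partial_jx,x_1-x,x_2-x$ are linearly independent and, for $k\in\{i,j\}$, $\partial_kx_1,\partial_kx_2,x_1-x_2$ are linearly independent and $\partial_ky\ne0$, then $x(\xi),x_1(\xi),x_2(\xi),y(\xi)$ are coplanar. 2. **Three transforms.** Let $x_1,x_2,x_3:B_0(r)\to\mathbb R^N$ be Jonas transformations of the conjugate net $x$, and for $a<b$ let $x_{ab}:B_0(r)\to\mathbb R^N$ be a coplanar common transform of $(x;x_a,x_b)$. Assume the following genericity conditions: each $(x;x_a,x_b)$ is generic; $x_1(0)-x(0),x_2(0)-x(0),x_3(0)-x(0)$ are linearly independent; each $x_{ab}(0)$ is in general position with respect to $(x;x_a,x_b)$; the affine spans of $\{x_1,x_{12},x_{13}\}$, $\{x_2,x_{12},x_{23}\}$, $\{x_3,x_{13},x_{23}\}$ at $\xi=0$ meet in exactly one point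 $p$; and $p$ is in general position with respect to $(x_1;x_{12},x_{13})$, $(x_2;x_{12},x_{23})$ and $(x_3;x_{13},x_{23})$. Then for some $0<\rho\le r$ there is a net $y:B_0(\rho)\to\mathbb R^N$ which is a Jonas transformation of all three nets $x_{12},x_{13},x_{23}$, with the points of each of the quadruples $(x_1,x_{12},x_{13},y)$, $(x_2,x_{12},x_{23},y)$, $(x_3,x_{13},x_{23},y)$ coplanar at every point of $B_0(\rho)$. It is unique: for every $0<\rho'\le\rho$, any net on $B_0(\rho')$ with these properties coincides with $y$ on $B_0(\rho')$. -/

import Mathlib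

open scoped ContDiff

namespace Jonas

/-- Maps from the parameter space `ℝ^m` to Euclidean space `ℝ^N`; only the values on a cube matter. -/
abbrev Net (m N : ℕ) : Type := (Fin m → ℝ) → EuclideanSpace ℝ (Fin N)

/-- The closed cube `{ξ ∈ ℝ^m | 0 ≤ ξ i ≤ r for all i}`. -/
def cube (m : ℕ) (r : ℝ) : Set (Fin m → ℝ) := Set.Icc 0 (fun _ => r)

/-- The partial derivative `∂_i x` of a map on the closed cube of size `r`
(one-sided at the boundary of the cube). -/
noncomputable def pd {m N : ℕ} (r : ℝ) (i : Fin m) (x : Net m N) : Net m N :=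
  fun ξ => fderivWithin ℝ x (cube m r) ξ (Pi.single i 1)

/-- A smooth map on the cube with `∂_i ∂_j x ∈ span (∂_i x, ∂_j x)` at every point, for `i ≠ j`. -/
def IsConjugateNet {m N : ℕ} (r : ℝ) (x : Net m N) : Prop :=
  ContDiffOn ℝ ∞ x (cube m r) ∧
  ∀ ξ ∈ cube m r, ∀ i j : Fin m, i ≠ j → ∃ c c' : ℝ,
    pd r i (pd r j x) ξ = c • pd r i x ξ + c' • pd r j x ξ

/-- `(x, x')` is a Jonas pair of conjugate nets, that is, `x'` is a Jonas transformation of `x`. -/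
def IsJonasPair {m N : ℕ} (r : ℝ) (x x' : Net m N) : Prop :=
  IsConjugateNet r x ∧ IsConjugateNet r x' ∧
  ∀ ξ ∈ cube m r, ∀ i : Fin m, ∃ c c' : ℝ,
    pd r i x' ξ - pd r i x ξ = c • pd r i x ξ + c' • (x' ξ - x ξ)

/-- `y` is a Jonas transformation of both `x₁` and `x₂`, and corresponding points of the four
nets `x`, `x₁`, `x₂`, `y` are coplanar. -/
def IsCoplanarCommonTransform {m N : ℕ} (r : ℝ) (x x₁ x₂ y : Net m N) : Prop :=
  IsJonasPair r x₁ y ∧ IsJonasPair r x₂ y ∧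
  ∀ ξ ∈ cube m r, Coplanar ℝ {x ξ, x₁ ξ, x₂ ξ, y ξ}

/-- Non-degeneracy, at the origin, of a net `x` with two transforms `x₁`, `x₂`: the edges
`∂_i x`, `x₁ - x`, `x₂ - x`, and the edges `∂_i x`, `∂_j x`, `x_a - x`, at the point `x 0` span
three-dimensional spaces, and `x_a - x` is not parallel to `∂_i x_a`. -/
def GenericPair {m N : ℕ} (r : ℝ) (x x₁ x₂ : Net m N) : Prop :=
  (∀ i : Fin m, LinearIndependent ℝ ![pd r i x 0, x₁ 0 - x 0, x₂ 0 - x 0]) ∧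
  (∀ i j : Fin m, i ≠ j →
    LinearIndependent ℝ ![pd r i x 0, pd r j x 0, x₁ 0 - x 0] ∧
    LinearIndependent ℝ ![pd r i x 0, pd r j x 0, x₂ 0 - x 0]) ∧
  (∀ i : Fin m,
    LinearIndependent ℝ ![pd r i x₁ 0, x₁ 0 - x 0] ∧
    LinearIndependent ℝ ![pd r i x₂ 0, x₂ 0 - x 0])

/-- The point of the plane through `x 0`, `x₁ 0`, `x₂ 0` with affine coordinates `q`. -/
noncomputable def planePoint {m N : ℕ} (x x₁ x₂ : Net m N) (q : ℝ × ℝ) :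
    EuclideanSpace ℝ (Fin N) :=
  x 0 + q.1 • (x₁ 0 - x 0) + q.2 • (x₂ 0 - x 0)

/-- Coordinates `q` of the points of that plane which are in general position: the point is on none
of the three lines through two of `x 0`, `x₁ 0`, `x₂ 0`, and, for every `i`, the affine
combination with coordinates `q` of `∂_i x`, `∂_i x₁`, `∂_i x₂` is transversal to the plane. -/
def admissible {m N : ℕ} (r : ℝ) (x x₁ x₂ : Net m N) : Set (ℝ × ℝ) :=
  {q | q.1 ≠ 0 ∧ q.2 ≠ 0 ∧ q.1 + q.2 ≠ 1 ∧
    ∀ i : Fin m, LinearIndependent ℝ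
      ![(1 - q.1 - q.2) • pd r i x 0 + q.1 • pd r i x₁ 0 + q.2 • pd r i x₂ 0,
        x₁ 0 - x 0, x₂ 0 - x 0]}

/-- `p` is a point in general position of the plane through `x 0`, `x₁ 0`, `x₂ 0`. -/
def IsGenericFourthPoint {m N : ℕ} (r : ℝ) (x x₁ x₂ : Net m N)
    (p : EuclideanSpace ℝ (Fin N)) : Prop :=
  ∃ q ∈ admissible r x x₁ x₂, p = planePoint x x₁ x₂ q

end Jonas

/-! Jonas transformations can be linearised. Near the origin a generic transform of $x$ has the form
$x' = x + uz$, where $z$ is parallel to $x$ ($\partial_i z=\kappa_i\partial_i x$) and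
$u=-\varphi/w$. Here $\varphi$ satisfies the same second-order equations as the coordinates of $x$,
and $\partial_i w=\kappa_i\partial_i\varphi$ (`exists_fundamentalDatum`). For several transforms all
the forms $\kappa_b\,\partial\varphi_a$ are closed, so they have potentials $\Omega_{ab}$. The
diagonal ones are fixed by $\varphi_a=-\Omega_{aa}u_a$; the off-diagonal ones carry free additive
constants.

Let $\sigma$ be supported in an index set $I$ and solve the rows $a\in I$ of
$\Omega\sigma=-\varphi$, the $I\times I$ block being invertible. Differentiating these rows shows
that $x+\sum\sigma_a z_a$ is a conjugate net (`IsTransformCoeff.isConjugateNet`) and that adding one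
index to $I$ is a Jonas transformation (`IsTransformCoeff.isJonasPair`), as long as the relevant
weights and coefficients do not vanish. One index gives the original transforms, two indices their
common transforms, three indices the eighth net.

Two transforms: the constants in $\Omega_{ab}$ and $\Omega_{ba}$ are the two parameters, and they
are determined by the prescribed point at $0$ (`GeneratingSystem.exists_family`). Conversely, if
$x+pz_a+qz_b$ is a transform of $x_a$, the defect $F=\Omega_{aa}p+\Omega_{ab}q+\varphi_a$ satisfies
$q\,\partial_iF=F\,\partial_iq$, so a zero of $F$ propagates where $q\ne0$; this gives uniqueness
(`GeneratingSystem.pair_unique`). Automatic coplanarity is linear algebra at a single point.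

Three transforms: the given nets $x_{ab}$ fix all off-diagonal constants. The points $x+\sum v_dz_d$
with $v$ solving row $a$ form the plane of $x_a,x_{ab},x_{ac}$. That the three planes meet in one
point at $0$ therefore says $\det\Omega(0)\ne0$, and the eighth net is given by the solution of the
full $3\times3$ system (`PairwiseSystem.exists_transform`). -/

open scoped Topology

namespace Jonas

/-! ### Differential calculus on the closed cube. -/

section Calculus

variable {m : ℕ} {r : ℝ} {F : Type*} [NormedAddCommGroup F] [NormedSpace ℝ F]

/-- The partial derivative on the closed cube, for maps into any normed space. -/
noncomputable def pderiv (r : ℝ) (i : Fin m) (f : (Fin m → ℝ) → F) : (Fin m → ℝ) → F :=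
  fun ξ => fderivWithin ℝ f (cube m r) ξ (Pi.single i 1)

/-- Smoothness on the closed cube. -/
abbrev SmoothOnCube (r : ℝ) (f : (Fin m → ℝ) → F) : Prop := ContDiffOn ℝ ∞ f (cube m r)

theorem pd_eq_pderiv {N : ℕ} (i : Fin m) (x : Net m N) : pd r i x = pderiv r i x := rfl

theorem convex_cube : Convex ℝ (cube m r) := convex_Icc _ _

theorem zero_mem_cube (hr : 0 ≤ r) : (0 : Fin m → ℝ) ∈ cube m r :=
  ⟨le_rfl, fun _ => hr⟩

theorem cube_mono {ρ : ℝ} (h : ρ ≤ r) : cube m ρ ⊆ cube m r :=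
  Set.Icc_subset_Icc_right fun _ => h

theorem interior_cube_nonempty (hr : 0 < r) : (interior (cube m r)).Nonempty := by
  refine ⟨fun _ => r / 2, ?_⟩
  rw [cube, ← Set.pi_univ_Icc, interior_pi_set Set.finite_univ]
  intro i _
  show r / 2 ∈ interior (Set.Icc 0 r)
  rw [interior_Icc]
  exact ⟨by simpa using half_pos hr, by simpa using half_lt_self hr⟩

theorem uniqueDiffOn_cube (hr : 0 < r) : UniqueDiffOn ℝ (cube m r) :=
  uniqueDiffOn_convex convex_cube (interior_cube_nonempty hr)

theorem cube_subset_closure_interior (hr : 0 < r) :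
    cube m r ⊆ closure (interior (cube m r)) := by
  rw [convex_cube.closure_interior_eq_closure_of_nonempty_interior (interior_cube_nonempty hr)]
  exact subset_closure

theorem SmoothOnCube.differentiableWithinAt {f : (Fin m → ℝ) → F} (hf : SmoothOnCube r f)
    {ξ : Fin m → ℝ} (hξ : ξ ∈ cube m r) : DifferentiableWithinAt ℝ f (cube m r) ξ :=
  hf.differentiableOn (by simp) ξ hξ

theorem SmoothOnCube.mono {ρ : ℝ} {f : (Fin m → ℝ) → F} (hf : SmoothOnCube r f) (h : ρ ≤ r) :
    SmoothOnCube ρ f := ContDiffOn.mono hf (cube_mono h)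

theorem SmoothOnCube.pderiv (hr : 0 < r) {f : (Fin m → ℝ) → F} (hf : SmoothOnCube r f)
    (i : Fin m) : SmoothOnCube r (pderiv r i f) :=
  (hf.fderivWithin (uniqueDiffOn_cube hr) (by simp)).clm_apply contDiffOn_const

theorem SmoothOnCube.const (c : F) : SmoothOnCube r (fun _ : Fin m → ℝ => c) :=
  contDiffOn_const

theorem SmoothOnCube.add {f g : (Fin m → ℝ) → F} (hf : SmoothOnCube r f)
    (hg : SmoothOnCube r g) : SmoothOnCube r (fun ξ => f ξ + g ξ) := ContDiffOn.add hf hg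

theorem SmoothOnCube.sub {f g : (Fin m → ℝ) → F} (hf : SmoothOnCube r f)
    (hg : SmoothOnCube r g) : SmoothOnCube r (fun ξ => f ξ - g ξ) := ContDiffOn.sub hf hg

theorem SmoothOnCube.neg {f : (Fin m → ℝ) → F} (hf : SmoothOnCube r f) :
    SmoothOnCube r (fun ξ => -f ξ) := ContDiffOn.neg hf

theorem SmoothOnCube.smul {c : (Fin m → ℝ) → ℝ} {f : (Fin m → ℝ) → F} (hc : SmoothOnCube r c)
    (hf : SmoothOnCube r f) : SmoothOnCube r (fun ξ => c ξ • f ξ) := ContDiffOn.smul hc hf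

theorem SmoothOnCube.mul {c f : (Fin m → ℝ) → ℝ} (hc : SmoothOnCube r c)
    (hf : SmoothOnCube r f) : SmoothOnCube r (fun ξ => c ξ * f ξ) := ContDiffOn.mul hc hf

theorem SmoothOnCube.inv {c : (Fin m → ℝ) → ℝ} (hc : SmoothOnCube r c)
    (h : ∀ ξ ∈ cube m r, c ξ ≠ 0) : SmoothOnCube r (fun ξ => (c ξ)⁻¹) := ContDiffOn.inv hc h

theorem SmoothOnCube.exp {c : (Fin m → ℝ) → ℝ} (hc : SmoothOnCube r c) :
    SmoothOnCube r (fun ξ => Real.exp (c ξ)) := ContDiffOn.exp hc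

theorem SmoothOnCube.sum {ι : Type*} (s : Finset ι) {f : ι → (Fin m → ℝ) → F}
    (hf : ∀ a, SmoothOnCube r (f a)) : SmoothOnCube r (fun ξ => ∑ a ∈ s, f a ξ) :=
  ContDiffOn.sum fun a _ => hf a

theorem pderiv_congr {f g : (Fin m → ℝ) → F} (h : Set.EqOn f g (cube m r)) {ξ : Fin m → ℝ}
    (hξ : ξ ∈ cube m r) (i : Fin m) : pderiv r i f ξ = pderiv r i g ξ := by
  unfold pderiv; rw [fderivWithin_congr h (h hξ)]

theorem pderiv_of_le {ρ : ℝ} (hρ : 0 < ρ) (h : ρ ≤ r) {f : (Fin m → ℝ) → F}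
    (hf : SmoothOnCube r f) {ξ : Fin m → ℝ} (hξ : ξ ∈ cube m ρ) (i : Fin m) :
    pderiv ρ i f ξ = pderiv r i f ξ := by
  unfold pderiv
  rw [fderivWithin_subset (cube_mono h) (uniqueDiffOn_cube hρ ξ hξ)
    (hf.differentiableWithinAt (cube_mono h hξ))]

theorem pderiv_pderiv_of_le (hr : 0 < r) {ρ : ℝ} (hρ : 0 < ρ) (h : ρ ≤ r) {f : (Fin m → ℝ) → F}
    (hf : SmoothOnCube r f) {ξ : Fin m → ℝ} (hξ : ξ ∈ cube m ρ) (i j : Fin m) :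
    pderiv ρ i (pderiv ρ j f) ξ = pderiv r i (pderiv r j f) ξ := by
  rw [pderiv_congr (fun η hη => pderiv_of_le hρ h hf hη j) hξ,
    pderiv_of_le hρ h (hf.pderiv hr j) hξ]

theorem pderiv_const (c : F) (i : Fin m) (ξ : Fin m → ℝ) :
    pderiv r i (fun _ => c) ξ = 0 := by
  simp [pderiv]

theorem pderiv_add (hr : 0 < r) {f g : (Fin m → ℝ) → F} (hf : SmoothOnCube r f)
    (hg : SmoothOnCube r g) {ξ : Fin m → ℝ} (hξ : ξ ∈ cube m r) (i : Fin m) :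
    pderiv r i (fun η => f η + g η) ξ = pderiv r i f ξ + pderiv r i g ξ := by
  unfold pderiv
  rw [fderivWithin_fun_add (uniqueDiffOn_cube hr ξ hξ) (hf.differentiableWithinAt hξ)
    (hg.differentiableWithinAt hξ)]
  rfl

theorem pderiv_sub (hr : 0 < r) {f g : (Fin m → ℝ) → F} (hf : SmoothOnCube r f)
    (hg : SmoothOnCube r g) {ξ : Fin m → ℝ} (hξ : ξ ∈ cube m r) (i : Fin m) :
    pderiv r i (fun η => f η - g η) ξ = pderiv r i f ξ - pderiv r i g ξ := by
  unfold pderiv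
  rw [fderivWithin_fun_sub (uniqueDiffOn_cube hr ξ hξ) (hf.differentiableWithinAt hξ)
    (hg.differentiableWithinAt hξ)]
  rfl

theorem pderiv_neg (hr : 0 < r) (f : (Fin m → ℝ) → F) {ξ : Fin m → ℝ} (hξ : ξ ∈ cube m r)
    (i : Fin m) : pderiv r i (fun η => -f η) ξ = -pderiv r i f ξ := by
  unfold pderiv
  rw [fderivWithin_fun_neg (uniqueDiffOn_cube hr ξ hξ)]
  rfl

theorem pderiv_smul (hr : 0 < r) {c : (Fin m → ℝ) → ℝ} {f : (Fin m → ℝ) → F}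
    (hc : SmoothOnCube r c) (hf : SmoothOnCube r f) {ξ : Fin m → ℝ} (hξ : ξ ∈ cube m r)
    (i : Fin m) :
    pderiv r i (fun η => c η • f η) ξ = pderiv r i c ξ • f ξ + c ξ • pderiv r i f ξ := by
  unfold pderiv
  rw [fderivWithin_fun_smul (uniqueDiffOn_cube hr ξ hξ) (hc.differentiableWithinAt hξ)
    (hf.differentiableWithinAt hξ)]
  simp [add_comm]

theorem pderiv_mul (hr : 0 < r) {c f : (Fin m → ℝ) → ℝ}
    (hc : SmoothOnCube r c) (hf : SmoothOnCube r f) {ξ : Fin m → ℝ} (hξ : ξ ∈ cube m r)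
    (i : Fin m) :
    pderiv r i (fun η => c η * f η) ξ = pderiv r i c ξ * f ξ + c ξ * pderiv r i f ξ :=
  pderiv_smul hr hc hf hξ i

theorem pderiv_sum (hr : 0 < r) {ι : Type*} (s : Finset ι) {f : ι → (Fin m → ℝ) → F}
    (hf : ∀ a, SmoothOnCube r (f a)) {ξ : Fin m → ℝ} (hξ : ξ ∈ cube m r) (i : Fin m) :
    pderiv r i (fun η => ∑ a ∈ s, f a η) ξ = ∑ a ∈ s, pderiv r i (f a) ξ := by
  unfold pderiv
  rw [fderivWithin_fun_sum (uniqueDiffOn_cube hr ξ hξ)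
    (fun a _ => (hf a).differentiableWithinAt hξ)]
  simp

/-- Symmetry extends to boundary points because the cube lies in the closure of its interior. -/
theorem pderiv_comm (hr : 0 < r) {f : (Fin m → ℝ) → F} (hf : SmoothOnCube r f)
    {ξ : Fin m → ℝ} (hξ : ξ ∈ cube m r) (i j : Fin m) :
    pderiv r i (pderiv r j f) ξ = pderiv r j (pderiv r i f) ξ := by
  have hsymm : IsSymmSndFDerivWithinAt ℝ f (cube m r) ξ :=
    (hf ξ hξ).isSymmSndFDerivWithinAt (by simpa using ENat.LEInfty.out)
      (uniqueDiffOn_cube hr) (cube_subset_closure_interior hr hξ) hξ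
  have hd : DifferentiableWithinAt ℝ (fderivWithin ℝ f (cube m r)) (cube m r) ξ :=
    ((hf.fderivWithin (m := ∞) (uniqueDiffOn_cube hr) (by simp)).differentiableOn
      (by simp)) ξ hξ
  have key : ∀ v w : Fin m → ℝ, fderivWithin ℝ (fun η => fderivWithin ℝ f (cube m r) η v)
      (cube m r) ξ w = fderivWithin ℝ (fderivWithin ℝ f (cube m r)) (cube m r) ξ w v := by
    intro v w
    rw [fderivWithin_clm_apply (uniqueDiffOn_cube hr ξ hξ) hd
      (differentiableWithinAt_const _)]
    simp
  unfold pderiv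
  rw [key, key]
  exact hsymm _ _

theorem fderivWithin_eq_sum_pderiv (f : (Fin m → ℝ) → F) (ξ v : Fin m → ℝ) :
    fderivWithin ℝ f (cube m r) ξ v = ∑ i, v i • pderiv r i f ξ := by
  conv_lhs => rw [pi_eq_sum_univ' v]
  rw [map_sum]
  refine Finset.sum_congr rfl fun i _ => ?_
  rw [map_smul]
  unfold pderiv
  congr 2

/-- Poincaré's lemma on the closed cube. -/
theorem exists_smooth_potential (hr : 0 < r) {θ : Fin m → (Fin m → ℝ) → ℝ}
    (hθ : ∀ i, SmoothOnCube r (θ i))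
    (hc : ∀ ξ ∈ cube m r, ∀ i j, i ≠ j → pderiv r i (θ j) ξ = pderiv r j (θ i) ξ) :
    ∃ f : (Fin m → ℝ) → ℝ, SmoothOnCube r f ∧
      ∀ ξ ∈ cube m r, ∀ i, pderiv r i f ξ = θ i ξ := by
  let Ω : (Fin m → ℝ) → (Fin m → ℝ) →L[ℝ] ℝ :=
    fun ξ => ∑ i, θ i ξ • ContinuousLinearMap.proj (R := ℝ) (φ := fun _ : Fin m => ℝ) i
  have hΩs : ContDiffOn ℝ ∞ Ω (cube m r) :=
    ContDiffOn.sum fun i _ => (hθ i).smul contDiffOn_const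
  have hΩ : ∀ ξ v, Ω ξ v = ∑ i, θ i ξ * v i := fun ξ v => by
    simp [Ω]
  have hdΩ : ∀ ξ ∈ cube m r, ∀ v w, fderivWithin ℝ Ω (cube m r) ξ v w
      = ∑ j, ∑ i, v i * pderiv r i (θ j) ξ * w j := by
    intro ξ hξ v w
    have h1 : fderivWithin ℝ (fun η => Ω η w) (cube m r) ξ v
        = fderivWithin ℝ Ω (cube m r) ξ v w := by
      rw [fderivWithin_clm_apply (uniqueDiffOn_cube hr ξ hξ)
        (hΩs.differentiableOn (by simp) ξ hξ) (differentiableWithinAt_const _)]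
      simp
    rw [← h1]
    simp_rw [hΩ]
    rw [fderivWithin_fun_sum (uniqueDiffOn_cube hr ξ hξ) (fun i _ =>
      ((hθ i).differentiableWithinAt hξ).mul_const _)]
    rw [sum_apply]
    refine Finset.sum_congr rfl fun j _ => ?_
    rw [fderivWithin_mul_const (uniqueDiffOn_cube hr ξ hξ) ((hθ j).differentiableWithinAt hξ)]
    rw [smul_apply, fderivWithin_eq_sum_pderiv, smul_eq_mul, mul_comm,
      Finset.sum_mul]
    simp
  -- The 1-form with components `θ i` is closed: its derivative is a symmetric bilinear form by
  -- `hc`, the diagonal terms being trivially symmetric.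
  obtain ⟨f, hf⟩ := convex_cube.exists_forall_hasFDerivWithinAt_of_fderivWithin_symmetric
    (hΩs.differentiableOn (by simp)) (fun ξ hξ v _ w _ => by
      rw [hdΩ ξ hξ, hdΩ ξ hξ, Finset.sum_comm]
      refine Finset.sum_congr rfl fun i _ => Finset.sum_congr rfl fun j _ => ?_
      rcases eq_or_ne i j with rfl | hij
      · ring
      · rw [hc ξ hξ i j hij]; ring)
  have hfd : ∀ ξ ∈ cube m r, fderivWithin ℝ f (cube m r) ξ = Ω ξ := fun ξ hξ =>
    (hf ξ hξ).fderivWithin (uniqueDiffOn_cube hr ξ hξ)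
  refine ⟨f, ?_, fun ξ hξ i => ?_⟩
  · exact (contDiffOn_infty_iff_fderivWithin (uniqueDiffOn_cube hr)).2
      ⟨fun ξ hξ => (hf ξ hξ).differentiableWithinAt, hΩs.congr hfd⟩
  · unfold pderiv
    rw [hfd ξ hξ, hΩ]
    simp [Pi.single_apply]

/-- If `g • ∂f = f • ∂g` where `g` does not vanish, a zero of `f` propagates. -/
theorem eq_zero_of_wronskian {f g : (Fin m → ℝ) → ℝ}
    (hf : SmoothOnCube r f) (hg : SmoothOnCube r g) {S : Set (Fin m → ℝ)} (hS : Convex ℝ S)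
    (hSr : S ⊆ cube m r) (hgS : ∀ ξ ∈ S, g ξ ≠ 0)
    (hw : ∀ ξ ∈ S, ∀ i, g ξ * pderiv r i f ξ = f ξ * pderiv r i g ξ)
    {ξ₀ : Fin m → ℝ} (h₀ : ξ₀ ∈ S) (hf₀ : f ξ₀ = 0) {ξ : Fin m → ℝ} (hξ : ξ ∈ S) :
    f ξ = 0 := by
  -- By the quotient rule `hw` says that `f / g` has zero derivative on the convex set `S`, so it is
  -- constant there.
  have hder : ∀ η ∈ S, HasFDerivWithinAt (fun η => f η / g η)
      (0 : (Fin m → ℝ) →L[ℝ] ℝ) S η := by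
    intro η hη
    have h1 := (hf.differentiableWithinAt (hSr hη)).hasFDerivWithinAt
    have h2 := (hg.differentiableWithinAt (hSr hη)).hasFDerivWithinAt
    have h3 := (h1.mul ((hasDerivAt_inv (hgS η hη)).comp_hasFDerivWithinAt η h2)).mono hSr
    have hz : f η • -(g η ^ 2)⁻¹ • fderivWithin ℝ g (cube m r) η +
        (g η)⁻¹ • fderivWithin ℝ f (cube m r) η = 0 := by
      ext v
      have : g η * fderivWithin ℝ f (cube m r) η v
          = f η * fderivWithin ℝ g (cube m r) η v := by
        rw [fderivWithin_eq_sum_pderiv, fderivWithin_eq_sum_pderiv, Finset.mul_sum,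
          Finset.mul_sum]
        refine Finset.sum_congr rfl fun i _ => ?_
        have := hw η hη i
        simp only [smul_eq_mul]
        linear_combination v i * this
      have hg0 := hgS η hη
      simp only [add_apply, smul_apply, smul_eq_mul, zero_apply]
      field_simp
      linear_combination this
    exact hz ▸ h3
  have hconst : f ξ / g ξ = f ξ₀ / g ξ₀ := by
    have hb := hS.norm_image_sub_le_of_norm_hasFDerivWithin_le (C := 0) hder
      (fun η _ => by simp) h₀ hξ
    simpa [sub_eq_zero] using hb
  rw [hf₀, zero_div, div_eq_zero_iff] at hconst
  exact hconst.resolve_right (hgS ξ hξ)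

end Calculus

/-! ### Smooth dependence of solutions of linear systems. -/

section LinearAlgebra

variable {X : Type*} [NormedAddCommGroup X] [NormedSpace ℝ X]

theorem contDiffOn_det {n : ℕ} {A : X → Matrix (Fin n) (Fin n) ℝ} {S : Set X}
    (hA : ∀ i j, ContDiffOn ℝ ∞ (fun ξ => A ξ i j) S) :
    ContDiffOn ℝ ∞ (fun ξ => (A ξ).det) S := by
  simp_rw [Matrix.det_apply]
  exact ContDiffOn.sum fun s _ => (contDiffOn_prod fun i _ => hA _ _).const_smul _

/-- Solutions of linear systems depend smoothly on the coefficients. -/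
theorem contDiffOn_of_mulVec_eq {n : ℕ} {A : X → Matrix (Fin n) (Fin n) ℝ}
    {b c : X → Fin n → ℝ} {S : Set X} (hA : ∀ i j, ContDiffOn ℝ ∞ (fun ξ => A ξ i j) S)
    (hb : ∀ i, ContDiffOn ℝ ∞ (fun ξ => b ξ i) S) (hdet : ∀ ξ ∈ S, (A ξ).det ≠ 0)
    (h : ∀ ξ ∈ S, (A ξ).mulVec (c ξ) = b ξ) (k : Fin n) :
    ContDiffOn ℝ ∞ (fun ξ => c ξ k) S := by
  -- Cramer's rule expresses the solution as a quotient of determinants.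
  have hc : ∀ ξ ∈ S, c ξ k = ((A ξ).det)⁻¹ * ((A ξ).updateCol k (b ξ)).det := by
    intro ξ hξ
    have h1 : Matrix.cramer (A ξ) (b ξ) = (A ξ).det • c ξ := by
      rw [← h ξ hξ, Matrix.cramer_eq_adjugate_mulVec, Matrix.mulVec_mulVec,
        Matrix.adjugate_mul, Matrix.smul_mulVec, Matrix.one_mulVec]
    rw [← Matrix.cramer_apply, h1, Pi.smul_apply, smul_eq_mul, inv_mul_cancel_left₀ (hdet ξ hξ)]
  refine ContDiffOn.congr ?_ hc
  refine ((contDiffOn_det hA).inv hdet).mul (contDiffOn_det fun i j => ?_)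
  by_cases hjk : j = k
  · subst hjk; simpa using hb i
  · simpa [Matrix.updateCol_apply, hjk] using hA i j

/-- The coefficients of a smooth combination of smooth independent vectors are smooth. -/
theorem contDiffOn_coeff {E : Type*} [NormedAddCommGroup E] [InnerProductSpace ℝ E] {n : ℕ}
    {v : Fin n → X → E} {w : X → E} {c : Fin n → X → ℝ} {S : Set X}
    (hv : ∀ k, ContDiffOn ℝ ∞ (v k) S) (hw : ContDiffOn ℝ ∞ w S)
    (hind : ∀ ξ ∈ S, LinearIndependent ℝ fun k => v k ξ)
    (h : ∀ ξ ∈ S, w ξ = ∑ k, c k ξ • v k ξ) (k : Fin n) : ContDiffOn ℝ ∞ (c k) S := by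
  -- Inner products with the `v j` turn the expansion into a square system whose matrix is the Gram
  -- matrix, invertible by independence.
  refine contDiffOn_of_mulVec_eq (A := fun ξ => Matrix.gram ℝ fun k => v k ξ)
    (b := fun ξ j => inner ℝ (v j ξ) (w ξ)) (c := fun ξ k => c k ξ) (fun i j => ?_) (fun j => ?_)
    (fun ξ hξ => ?_) (fun ξ hξ => ?_) k
  · exact (hv i).inner ℝ (hv j)
  · exact (hv j).inner ℝ hw
  · exact Matrix.det_gram_ne_zero_iff_linearIndependent.2 (hind ξ hξ)
  · ext j
    simp only [Matrix.mulVec, dotProduct, Matrix.gram_apply]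
    rw [h ξ hξ, inner_sum]
    exact Finset.sum_congr rfl fun l _ => by rw [inner_smul_right, mul_comm]

end LinearAlgebra


/-! ### Comparing coefficients of two, three or four independent vectors. -/

section Independence

variable {V : Type*} [AddCommGroup V] [Module ℝ V]

theorem coeff_eq_zero_of_pair {a b : V} (h : LinearIndependent ℝ ![a, b]) {p q : ℝ}
    (e : p • a + q • b = 0) : p = 0 ∧ q = 0 :=
  LinearIndependent.pair_iff.1 h p q e

theorem coeff_eq_zero_of_triple {a b c : V} (h : LinearIndependent ℝ ![a, b, c]) {p q s : ℝ}
    (e : p • a + q • b + s • c = 0) : p = 0 ∧ q = 0 ∧ s = 0 := by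
  have := Fintype.linearIndependent_iff.1 h ![p, q, s] (by simpa [Fin.sum_univ_three] using e)
  exact ⟨this 0, this 1, this 2⟩

theorem coeff_eq_zero_of_quadruple {a b c d : V} (h : LinearIndependent ℝ ![a, b, c, d])
    {p q s t : ℝ} (e : p • a + q • b + s • c + t • d = 0) : p = 0 ∧ q = 0 ∧ s = 0 ∧ t = 0 := by
  have := Fintype.linearIndependent_iff.1 h ![p, q, s, t]
    (by simpa [Fin.sum_univ_four] using e)
  exact ⟨this 0, this 1, this 2, this 3⟩

theorem linearIndependent_triple {a b c : V}
    (h : ∀ p q s : ℝ, p • a + q • b + s • c = 0 → p = 0 ∧ q = 0 ∧ s = 0) :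
    LinearIndependent ℝ ![a, b, c] := by
  refine Fintype.linearIndependent_iff.2 fun g hg => ?_
  have := h (g 0) (g 1) (g 2) (by simpa [Fin.sum_univ_three] using hg)
  intro i
  fin_cases i
  exacts [this.1, this.2.1, this.2.2]

end Independence

/-! ### A single Jonas transformation in terms of a parallel net and a solution of the point
equation. -/

section SingleTransform

variable {m N : ℕ} {r : ℝ}

/-- Every closed form is a logarithmic derivative. -/
theorem exists_logarithmic_potential (hr : 0 < r) {θ : Fin m → (Fin m → ℝ) → ℝ}
    (hθ : ∀ i, SmoothOnCube r (θ i))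
    (hc : ∀ ξ ∈ cube m r, ∀ i j, i ≠ j → pderiv r i (θ j) ξ = pderiv r j (θ i) ξ) :
    ∃ u v : (Fin m → ℝ) → ℝ, SmoothOnCube r u ∧ SmoothOnCube r v ∧ (∀ ξ, u ξ * v ξ = 1) ∧
      (∀ ξ ∈ cube m r, ∀ i, pderiv r i u ξ = u ξ * θ i ξ) ∧
      ∀ ξ ∈ cube m r, ∀ i, pderiv r i v ξ = -(v ξ * θ i ξ) := by
  obtain ⟨f, hf, hdf⟩ := exists_smooth_potential hr hθ hc
  refine ⟨fun ξ => Real.exp (f ξ), fun ξ => Real.exp (-f ξ), hf.exp, hf.neg.exp,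
    fun ξ => by rw [← Real.exp_add]; simp, fun ξ hξ i => ?_, fun ξ hξ i => ?_⟩
  · have h := (hf.differentiableWithinAt hξ).hasFDerivWithinAt.exp.fderivWithin
      (uniqueDiffOn_cube hr ξ hξ)
    unfold pderiv
    rw [h, ← hdf ξ hξ i]
    rfl
  · have h := (hf.differentiableWithinAt hξ).hasFDerivWithinAt.fun_neg.exp.fderivWithin
      (uniqueDiffOn_cube hr ξ hξ)
    unfold pderiv
    rw [h, ← hdf ξ hξ i]
    simp [pderiv]

/-- `z` is parallel to the conjugate net `x`, with ratios `κ`, and `φ` solves the point equation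
of `x`. -/
structure FundamentalDatum (r : ℝ) (x z : Net m N) (κ : Fin m → (Fin m → ℝ) → ℝ)
    (φ : (Fin m → ℝ) → ℝ) : Prop where
  smooth_z : SmoothOnCube r z
  smooth_κ : ∀ i, SmoothOnCube r (κ i)
  smooth_φ : SmoothOnCube r φ
  pderiv_z : ∀ ξ ∈ cube m r, ∀ i, pderiv r i z ξ = κ i ξ • pderiv r i x ξ
  pderiv_κ : ∀ ξ ∈ cube m r, ∀ i j, i ≠ j → ∀ c c' : ℝ,
    pderiv r i (pderiv r j x) ξ = c • pderiv r i x ξ + c' • pderiv r j x ξ →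
    pderiv r i (κ j) ξ = c' * (κ i ξ - κ j ξ)
  pderiv_φ : ∀ ξ ∈ cube m r, ∀ i j, i ≠ j → ∀ c c' : ℝ,
    pderiv r i (pderiv r j x) ξ = c • pderiv r i x ξ + c' • pderiv r j x ξ →
    pderiv r i (pderiv r j φ) ξ = c * pderiv r i φ ξ + c' * pderiv r j φ ξ

/-- A Jonas pair only has coefficients point by point. Independence of `∂_i x` and `x' - x` makes
them unique, hence smooth; independence of `∂_i x'` and `x' - x` rules out `1 + b i = 0`. -/
theorem exists_smooth_jonas_coeff (hr : 0 < r) {x x' : Net m N} (h : IsJonasPair r x x')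
    (h₂ : ∀ ξ ∈ cube m r, ∀ i, LinearIndependent ℝ ![pderiv r i x ξ, x' ξ - x ξ])
    (h₂' : ∀ ξ ∈ cube m r, ∀ i, LinearIndependent ℝ ![pderiv r i x' ξ, x' ξ - x ξ]) :
    ∃ b e : Fin m → (Fin m → ℝ) → ℝ, (∀ i, SmoothOnCube r (b i)) ∧ (∀ i, SmoothOnCube r (e i)) ∧
      ∀ ξ ∈ cube m r, ∀ i, 1 + b i ξ ≠ 0 ∧
        pderiv r i x' ξ = (1 + b i ξ) • pderiv r i x ξ + e i ξ • (x' ξ - x ξ) := by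
  have hx := h.1.1
  have hx' := h.2.1.1
  have hc : ∀ i ξ, ∃ c : Fin 2 → ℝ, ξ ∈ cube m r →
      pderiv r i x' ξ - pderiv r i x ξ = c 0 • pderiv r i x ξ + c 1 • (x' ξ - x ξ) := by
    intro i ξ
    by_cases hξ : ξ ∈ cube m r
    · obtain ⟨c, c', hcc⟩ := h.2.2 ξ hξ i
      exact ⟨![c, c'], fun _ => hcc⟩
    · exact ⟨0, fun h => absurd h hξ⟩
  choose c hc using hc
  have hs : ∀ i k, SmoothOnCube r (fun ξ => c i ξ k) := fun i =>
    contDiffOn_coeff (v := ![pderiv r i x, fun ξ => x' ξ - x ξ])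
      (w := fun ξ => pderiv r i x' ξ - pderiv r i x ξ) (c := fun k ξ => c i ξ k)
      (fun k => by
        fin_cases k
        exacts [SmoothOnCube.pderiv hr hx i, hx'.sub hx])
      ((SmoothOnCube.pderiv hr hx' i).sub (SmoothOnCube.pderiv hr hx i))
      (fun ξ hξ => by
        have e : (fun k => (![pderiv r i x, fun ξ => x' ξ - x ξ] : Fin 2 → Net m N) k ξ)
            = ![pderiv r i x ξ, x' ξ - x ξ] := by
          ext k; fin_cases k <;> rfl
        rw [e]
        exact h₂ ξ hξ i)
      (fun ξ hξ => by simpa [Fin.sum_univ_two] using hc i ξ hξ)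
  refine ⟨fun i ξ => c i ξ 0, fun i ξ => c i ξ 1, fun i => hs i 0, fun i => hs i 1,
    fun ξ hξ i => ?_⟩
  have hd : pderiv r i x' ξ
      = (1 + c i ξ 0) • pderiv r i x ξ + c i ξ 1 • (x' ξ - x ξ) := by
    linear_combination (norm := module) hc i ξ hξ
  refine ⟨fun h0 => ?_, hd⟩
  rw [h0, zero_smul, zero_add] at hd
  have := coeff_eq_zero_of_pair (h₂' ξ hξ i) (p := 1) (q := -c i ξ 1) (by rw [hd]; module)
  exact one_ne_zero this.1

/-- Write `d = x' - x`, so that `∂_i d = b i ∂_i x + e i d`. Rescaling `d` by a factor with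
logarithmic derivative `e` removes the component along `d` and leaves a net parallel to `x`. The
conjugacy of `x'` then yields a second closed form, whose potential gives `w` and `φ`. -/
theorem exists_fundamentalDatum (hr : 0 < r) {x x' : Net m N} (h : IsJonasPair r x x')
    (h₂ : ∀ ξ ∈ cube m r, ∀ i, LinearIndependent ℝ ![pderiv r i x ξ, x' ξ - x ξ])
    (h₂' : ∀ ξ ∈ cube m r, ∀ i, LinearIndependent ℝ ![pderiv r i x' ξ, x' ξ - x ξ])
    (h₃ : ∀ ξ ∈ cube m r, ∀ i j, i ≠ j →
      LinearIndependent ℝ ![pderiv r i x ξ, pderiv r j x ξ, x' ξ - x ξ]) :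
    ∃ (z : Net m N) (κ : Fin m → (Fin m → ℝ) → ℝ) (φ u w : (Fin m → ℝ) → ℝ),
      FundamentalDatum r x z κ φ ∧ SmoothOnCube r u ∧ SmoothOnCube r w ∧
      ∀ ξ ∈ cube m r, u ξ ≠ 0 ∧ w ξ ≠ 0 ∧ x' ξ = x ξ + u ξ • z ξ ∧ φ ξ = -(w ξ * u ξ) ∧
        ∀ i, pderiv r i w ξ = pderiv r i φ ξ * κ i ξ ∧ 1 + κ i ξ * u ξ ≠ 0 := by
  have hx : SmoothOnCube r x := h.1.1
  have hx' : SmoothOnCube r x' := h.2.1.1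
  obtain ⟨b, e, hb, he, hbe⟩ := exists_smooth_jonas_coeff hr h h₂ h₂'
  have hDx := fun i => SmoothOnCube.pderiv hr hx i
  let d : Net m N := fun ξ => x' ξ - x ξ
  have hd : SmoothOnCube r d := hx'.sub hx
  have hDd : ∀ ξ ∈ cube m r, ∀ i, pderiv r i d ξ = b i ξ • pderiv r i x ξ + e i ξ • d ξ := by
    intro ξ hξ i
    rw [pderiv_sub hr hx' hx hξ, (hbe ξ hξ i).2]
    module
  have hDDd : ∀ ξ ∈ cube m r, ∀ i j, pderiv r i (pderiv r j d) ξ =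
      pderiv r i (b j) ξ • pderiv r j x ξ + b j ξ • pderiv r i (pderiv r j x) ξ +
      (pderiv r i (e j) ξ • d ξ + e j ξ • (b i ξ • pderiv r i x ξ + e i ξ • d ξ)) := by
    intro ξ hξ i j
    rw [pderiv_congr (fun η hη => hDd η hη j) hξ,
      pderiv_add hr ((hb j).smul (hDx j)) ((he j).smul hd) hξ,
      pderiv_smul hr (hb j) (hDx j) hξ, pderiv_smul hr (he j) hd hξ, hDd ξ hξ]
  -- Equate `∂_i ∂_j d` and `∂_j ∂_i d` and compare coefficients of `∂_i x`, `∂_j x`, `d`: this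
  -- gives the equation for `b` and the closedness of `e`.
  have hbc : ∀ ξ ∈ cube m r, ∀ i j, i ≠ j → ∀ c c' : ℝ,
      pderiv r i (pderiv r j x) ξ = c • pderiv r i x ξ + c' • pderiv r j x ξ →
      pderiv r i (b j) ξ = (b i ξ - b j ξ) * c' + e i ξ * b j ξ ∧
      pderiv r i (e j) ξ = pderiv r j (e i) ξ := by
    intro ξ hξ i j hij c c' hcc
    have h1 := hDDd ξ hξ i j
    have h2 := hDDd ξ hξ j i
    rw [pderiv_comm hr hx hξ j i, hcc] at h2
    rw [pderiv_comm hr hd hξ i j, hcc] at h1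
    have := coeff_eq_zero_of_triple (h₃ ξ hξ i j hij)
      (p := b j ξ * c + e j ξ * b i ξ - pderiv r j (b i) ξ - b i ξ * c)
      (q := pderiv r i (b j) ξ + b j ξ * c' - b i ξ * c' - e i ξ * b j ξ)
      (s := pderiv r i (e j) ξ - pderiv r j (e i) ξ)
      (by
        change _ + _ + _ • d ξ = 0
        linear_combination (norm := module) h2 - h1)
    exact ⟨by linear_combination this.2.1, by linear_combination this.2.2⟩
  obtain ⟨u, v, hu, hv, huv, hDu, hDv⟩ := exists_logarithmic_potential hr he
    (fun ξ hξ i j hij => by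
      obtain ⟨c, c', hcc⟩ := h.1.2 ξ hξ i j hij
      exact (hbc ξ hξ i j hij c c' hcc).2)
  have hv0 : ∀ ξ, v ξ ≠ 0 := fun ξ h0 => by simpa [h0] using huv ξ
  have hu0 : ∀ ξ, u ξ ≠ 0 := fun ξ h0 => by simpa [h0] using huv ξ
  let z : Net m N := fun ξ => v ξ • d ξ
  let κ : Fin m → (Fin m → ℝ) → ℝ := fun i ξ => b i ξ * v ξ
  let g : Fin m → (Fin m → ℝ) → ℝ := fun i ξ => 1 + b i ξ
  -- Chosen so that `∂_i x' = g i (∂_i x + k i z)`.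
  let k : Fin m → (Fin m → ℝ) → ℝ := fun i ξ => u ξ * e i ξ * (g i ξ)⁻¹
  have hz : SmoothOnCube r z := hv.smul hd
  have hκ : ∀ i, SmoothOnCube r (κ i) := fun i => (hb i).mul hv
  have hg : ∀ i, SmoothOnCube r (g i) := fun i => contDiffOn_const.add (hb i)
  have hg0 : ∀ ξ ∈ cube m r, ∀ i, g i ξ ≠ 0 := fun ξ hξ i => (hbe ξ hξ i).1
  have hk : ∀ i, SmoothOnCube r (k i) := fun i =>
    (hu.mul (he i)).mul ((hg i).inv fun ξ hξ => hg0 ξ hξ i)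
  have hgκ : ∀ ξ i, g i ξ = 1 + κ i ξ * u ξ := fun ξ i => by
    change 1 + b i ξ = 1 + b i ξ * v ξ * u ξ
    linear_combination -b i ξ * huv ξ
  have hgk : ∀ ξ ∈ cube m r, ∀ i, g i ξ * k i ξ = u ξ * e i ξ := fun ξ hξ i => by
    change g i ξ * (u ξ * e i ξ * (g i ξ)⁻¹) = _
    have := hg0 ξ hξ i
    field_simp
  have hdz : ∀ ξ, d ξ = u ξ • z ξ := fun ξ => by
    change _ = u ξ • v ξ • d ξ
    rw [smul_smul, huv, one_smul]
  have hDz : ∀ ξ ∈ cube m r, ∀ i, pderiv r i z ξ = κ i ξ • pderiv r i x ξ := by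
    intro ξ hξ i
    rw [pderiv_smul hr hv hd hξ, hDv ξ hξ, hDd ξ hξ]
    change _ = (b i ξ * v ξ) • _
    module
  have hDκ : ∀ ξ ∈ cube m r, ∀ i j, i ≠ j → ∀ c c' : ℝ,
      pderiv r i (pderiv r j x) ξ = c • pderiv r i x ξ + c' • pderiv r j x ξ →
      pderiv r i (κ j) ξ = c' * (κ i ξ - κ j ξ) := by
    intro ξ hξ i j hij c c' hcc
    rw [pderiv_mul hr (hb j) hv hξ, hDv ξ hξ, (hbc ξ hξ i j hij c c' hcc).1]
    change _ = c' * (b i ξ * v ξ - b j ξ * v ξ)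
    ring
  have hDx' : ∀ ξ ∈ cube m r, ∀ i,
      pderiv r i x' ξ = g i ξ • (pderiv r i x ξ + k i ξ • z ξ) := by
    intro ξ hξ i
    rw [(hbe ξ hξ i).2, smul_add, smul_smul, hgk ξ hξ]
    change g i ξ • _ + e i ξ • d ξ = _
    rw [hdz]
    module
  -- This is the conjugacy of `x'`, read off in the independent vectors `∂_i x`, `∂_j x`, `d`;
  -- multiplying the `d`-coefficient by `v ξ` passes from `z` to `d`.
  have hDk : ∀ ξ ∈ cube m r, ∀ i j, i ≠ j → ∀ c c' : ℝ,
      pderiv r i (pderiv r j x) ξ = c • pderiv r i x ξ + c' • pderiv r j x ξ →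
      pderiv r i (k j) ξ = (c + k j ξ * κ i ξ) * k i ξ + c' * k j ξ := by
    intro ξ hξ i j hij c c' hcc
    obtain ⟨α, β, hαβ⟩ := h.2.1.2 ξ hξ i j hij
    simp only [pd_eq_pderiv] at hαβ
    rw [pderiv_congr (fun η hη => hDx' η hη j) hξ,
      pderiv_smul hr (hg j) ((hDx j).add ((hk j).smul hz)) hξ,
      pderiv_add hr (hDx j) ((hk j).smul hz) hξ, pderiv_smul hr (hk j) hz hξ, hcc,
      hDx' ξ hξ, hDx' ξ hξ, hDz ξ hξ] at hαβ
    have := coeff_eq_zero_of_triple (h₃ ξ hξ i j hij)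
      (p := g j ξ * (c + k j ξ * κ i ξ) - α * g i ξ)
      (q := pderiv r i (g j) ξ + g j ξ * c' - β * g j ξ)
      (s := (pderiv r i (g j) ξ * k j ξ + g j ξ * pderiv r i (k j) ξ
        - α * g i ξ * k i ξ - β * g j ξ * k j ξ) * v ξ)
      (by
        change _ + _ + _ • d ξ = 0
        rw [mul_smul]
        change _ + _ + _ • z ξ = 0
        linear_combination (norm := module) hαβ)
    obtain ⟨h1, h2, h3⟩ := this
    have h3 := (mul_eq_zero.1 h3).resolve_right (hv0 ξ)
    refine mul_left_cancel₀ (hg0 ξ hξ j) ?_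
    linear_combination h3 - k i ξ * h1 - k j ξ * h2
  -- The equations for `k` and `κ` make `k i * κ i` a closed form. Taking the reciprocal exponential
  -- gives `∂_i w = -(w k i κ i)`, and hence `∂_i φ = -(w k i)` for `φ = -(w u)`.
  obtain ⟨_, w, _, hw, hww, _, hDw⟩ := exists_logarithmic_potential hr
    (θ := fun i ξ => k i ξ * κ i ξ) (fun i => (hk i).mul (hκ i))
    (fun ξ hξ i j hij => by
      obtain ⟨c, c', hcc⟩ := h.1.2 ξ hξ i j hij
      have hcc' := hcc
      simp only [pd_eq_pderiv] at hcc hcc'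
      rw [pderiv_comm hr hx hξ, add_comm] at hcc'
      rw [pderiv_mul hr (hk j) (hκ j) hξ, pderiv_mul hr (hk i) (hκ i) hξ,
        hDk ξ hξ i j hij c c' hcc, hDκ ξ hξ i j hij c c' hcc,
        hDk ξ hξ j i hij.symm c' c hcc', hDκ ξ hξ j i hij.symm c' c hcc']
      ring)
  have hw0 : ∀ ξ, w ξ ≠ 0 := fun ξ h0 => by simpa [h0] using hww ξ
  let φ : (Fin m → ℝ) → ℝ := fun ξ => -(w ξ * u ξ)
  have hφ : SmoothOnCube r φ := (hw.mul hu).neg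
  have hDφ : ∀ ξ ∈ cube m r, ∀ i, pderiv r i φ ξ = -(w ξ * k i ξ) := by
    intro ξ hξ i
    rw [pderiv_neg hr _ hξ, pderiv_mul hr hw hu hξ, hDw ξ hξ, hDu ξ hξ, ← hgk ξ hξ, hgκ]
    ring
  refine ⟨z, κ, φ, u, w, ⟨hz, hκ, hφ, hDz, hDκ, ?_⟩, hu, hw, fun ξ hξ =>
    ⟨hu0 ξ, hw0 ξ, ?_, rfl, fun i => ⟨?_, ?_⟩⟩⟩
  · intro ξ hξ i j hij c c' hcc
    rw [pderiv_congr (fun η hη => hDφ η hη j) hξ, pderiv_neg hr _ hξ,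
      pderiv_mul hr hw (hk j) hξ, hDw ξ hξ, hDφ ξ hξ, hDφ ξ hξ, hDk ξ hξ i j hij c c' hcc]
    ring
  · rw [← hdz]
    change _ = x ξ + (x' ξ - x ξ)
    abel
  · rw [hDw ξ hξ, hDφ ξ hξ]
    ring
  · rw [← hgκ]
    exact hg0 ξ hξ i

end SingleTransform

/-! ### Restriction to smaller cubes. -/

section Restriction

variable {m N : ℕ} {r ρ : ℝ}

theorem IsConjugateNet.mono (hr : 0 < r) (hρ : 0 < ρ) (h : ρ ≤ r) {x : Net m N}
    (hx : IsConjugateNet r x) : IsConjugateNet ρ x := by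
  refine ⟨SmoothOnCube.mono hx.1 h, fun ξ hξ i j hij => ?_⟩
  obtain ⟨c, c', hc⟩ := hx.2 ξ (cube_mono h hξ) i j hij
  refine ⟨c, c', ?_⟩
  simp only [pd_eq_pderiv] at hc ⊢
  rw [pderiv_pderiv_of_le hr hρ h hx.1 hξ, pderiv_of_le hρ h hx.1 hξ, pderiv_of_le hρ h hx.1 hξ,
    hc]

theorem IsJonasPair.mono (hr : 0 < r) (hρ : 0 < ρ) (h : ρ ≤ r) {x x' : Net m N}
    (hx : IsJonasPair r x x') : IsJonasPair ρ x x' := by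
  refine ⟨hx.1.mono hr hρ h, hx.2.1.mono hr hρ h, fun ξ hξ i => ?_⟩
  obtain ⟨c, c', hc⟩ := hx.2.2 ξ (cube_mono h hξ) i
  refine ⟨c, c', ?_⟩
  simp only [pd_eq_pderiv] at hc ⊢
  rw [pderiv_of_le hρ h hx.1.1 hξ, pderiv_of_le hρ h hx.2.1.1 hξ, hc]

theorem IsCoplanarCommonTransform.mono (hr : 0 < r) (hρ : 0 < ρ) (h : ρ ≤ r)
    {x x₁ x₂ y : Net m N} (hy : IsCoplanarCommonTransform r x x₁ x₂ y) :
    IsCoplanarCommonTransform ρ x x₁ x₂ y :=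
  ⟨hy.1.mono hr hρ h, hy.2.1.mono hr hρ h, fun ξ hξ => hy.2.2 ξ (cube_mono h hξ)⟩

theorem FundamentalDatum.mono (hr : 0 < r) (hρ : 0 < ρ) (h : ρ ≤ r) {x z : Net m N}
    {κ : Fin m → (Fin m → ℝ) → ℝ} {φ : (Fin m → ℝ) → ℝ} (hx : SmoothOnCube r x)
    (hd : FundamentalDatum r x z κ φ) : FundamentalDatum ρ x z κ φ where
  smooth_z := hd.smooth_z.mono h
  smooth_κ i := (hd.smooth_κ i).mono h
  smooth_φ := hd.smooth_φ.mono h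
  pderiv_z ξ hξ i := by
    rw [pderiv_of_le hρ h hd.smooth_z hξ, pderiv_of_le hρ h hx hξ,
      hd.pderiv_z ξ (cube_mono h hξ)]
  pderiv_κ ξ hξ i j hij c c' hc := by
    rw [pderiv_pderiv_of_le hr hρ h hx hξ, pderiv_of_le hρ h hx hξ, pderiv_of_le hρ h hx hξ] at hc
    rw [pderiv_of_le hρ h (hd.smooth_κ j) hξ]
    exact hd.pderiv_κ ξ (cube_mono h hξ) i j hij c c' hc
  pderiv_φ ξ hξ i j hij c c' hc := by
    rw [pderiv_pderiv_of_le hr hρ h hx hξ, pderiv_of_le hρ h hx hξ, pderiv_of_le hρ h hx hξ] at hc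
    rw [pderiv_pderiv_of_le hr hρ h hd.smooth_φ hξ, pderiv_of_le hρ h hd.smooth_φ hξ,
      pderiv_of_le hρ h hd.smooth_φ hξ]
    exact hd.pderiv_φ ξ (cube_mono h hξ) i j hij c c' hc

end Restriction

/-! ### Nets `x + ∑ σ_a z_a` with `Ω σ = -φ`. -/

section PotentialSystem

variable {m N : ℕ} {r : ℝ} {ι : Type*}

/-- The form `∂φ_a κ_b` is closed. -/
theorem exists_potential (hr : 0 < r) {x z z' : Net m N} {κ κ' : Fin m → (Fin m → ℝ) → ℝ}
    {φ φ' : (Fin m → ℝ) → ℝ} (hx : IsConjugateNet r x) (hd : FundamentalDatum r x z κ φ)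
    (hd' : FundamentalDatum r x z' κ' φ') :
    ∃ ω' : (Fin m → ℝ) → ℝ, SmoothOnCube r ω' ∧
      ∀ ξ ∈ cube m r, ∀ i, pderiv r i ω' ξ = pderiv r i φ ξ * κ' i ξ := by
  refine exists_smooth_potential hr
    (fun i => (hd.smooth_φ.pderiv hr i).mul (hd'.smooth_κ i)) fun ξ hξ i j hij => ?_
  obtain ⟨c, c', hc⟩ := hx.2 ξ hξ i j hij
  simp only [pd_eq_pderiv] at hc
  have hc' := hc
  rw [pderiv_comm hr hx.1 hξ, add_comm] at hc'
  rw [pderiv_mul hr (hd.smooth_φ.pderiv hr j) (hd'.smooth_κ j) hξ,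
    pderiv_mul hr (hd.smooth_φ.pderiv hr i) (hd'.smooth_κ i) hξ,
    hd.pderiv_φ ξ hξ i j hij c c' hc, hd.pderiv_φ ξ hξ j i hij.symm c' c hc',
    hd'.pderiv_κ ξ hξ i j hij c c' hc, hd'.pderiv_κ ξ hξ j i hij.symm c' c hc']
  ring

/-- A family of fundamental data of `x` with all their mutual potentials `Ω`. -/
structure PotentialSystem (r : ℝ) (x : Net m N) (z : ι → Net m N)
    (κ : ι → Fin m → (Fin m → ℝ) → ℝ) (φ : ι → (Fin m → ℝ) → ℝ)
    (Ω : ι → ι → (Fin m → ℝ) → ℝ) : Prop where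
  conj : IsConjugateNet r x
  datum : ∀ a, FundamentalDatum r x (z a) (κ a) (φ a)
  smooth_Ω : ∀ a b, SmoothOnCube r (Ω a b)
  pderiv_Ω : ∀ ξ ∈ cube m r, ∀ i a b,
    pderiv r i (Ω a b) ξ = pderiv r i (φ a) ξ * κ b i ξ

variable {x : Net m N} {z : ι → Net m N} {κ : ι → Fin m → (Fin m → ℝ) → ℝ}
  {φ : ι → (Fin m → ℝ) → ℝ} {Ω : ι → ι → (Fin m → ℝ) → ℝ} {I : Finset ι}
  {σ : ι → (Fin m → ℝ) → ℝ}

theorem PotentialSystem.mono (hr : 0 < r) {ρ : ℝ} (hρ : 0 < ρ) (h : ρ ≤ r)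
    (hS : PotentialSystem r x z κ φ Ω) : PotentialSystem ρ x z κ φ Ω where
  conj := hS.conj.mono hr hρ h
  datum a := (hS.datum a).mono hr hρ h hS.conj.1
  smooth_Ω a b := (hS.smooth_Ω a b).mono h
  pderiv_Ω ξ hξ i a b := by
    rw [pderiv_of_le hρ h (hS.smooth_Ω a b) hξ, pderiv_of_le hρ h (hS.datum a).smooth_φ hξ,
      hS.pderiv_Ω ξ (cube_mono h hξ)]

theorem pderiv_eq_zero_of_supp (hsupp : ∀ ξ ∈ cube m r, ∀ a ∉ I, σ a ξ = 0) {ξ : Fin m → ℝ}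
    (hξ : ξ ∈ cube m r) (i : Fin m) {a : ι} (ha : a ∉ I) : pderiv r i (σ a) ξ = 0 := by
  rw [pderiv_congr (fun η hη => hsupp η hη a ha) hξ, pderiv_const]

variable [Fintype ι]

/-- The factor by which the `i`-th tangent of `x` is multiplied in `x + ∑ σ_a z_a`. -/
def weight (κ : ι → Fin m → (Fin m → ℝ) → ℝ) (σ : ι → (Fin m → ℝ) → ℝ) (i : Fin m) :
    (Fin m → ℝ) → ℝ :=
  fun ξ => 1 + ∑ a, κ a i ξ * σ a ξ

/-- The map `x + ∑ σ_a z_a`. -/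
noncomputable def combination (x : Net m N) (z : ι → Net m N) (σ : ι → (Fin m → ℝ) → ℝ) :
    Net m N :=
  fun ξ => x ξ + ∑ a, σ a ξ • z a ξ

/-- `σ` is supported in `I`, where it solves the linear system `Ω σ = -φ`. -/
structure IsTransformCoeff (r : ℝ) (κ : ι → Fin m → (Fin m → ℝ) → ℝ)
    (φ : ι → (Fin m → ℝ) → ℝ) (Ω : ι → ι → (Fin m → ℝ) → ℝ) (I : Finset ι)
    (σ : ι → (Fin m → ℝ) → ℝ) : Prop where
  smooth : ∀ a, SmoothOnCube r (σ a)
  supp : ∀ ξ ∈ cube m r, ∀ a ∉ I, σ a ξ = 0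
  row : ∀ ξ ∈ cube m r, ∀ a ∈ I, ∑ b, Ω a b ξ * σ b ξ = -φ a ξ
  nondeg : ∀ ξ ∈ cube m r, ∀ v : ι → ℝ, (∀ a ∉ I, v a = 0) →
    (∀ a ∈ I, ∑ b, Ω a b ξ * v b = 0) → v = 0
  weight_ne_zero : ∀ ξ ∈ cube m r, ∀ i, weight κ σ i ξ ≠ 0

theorem PotentialSystem.smooth_weight (hS : PotentialSystem r x z κ φ Ω)
    (hσ : ∀ a, SmoothOnCube r (σ a)) (i : Fin m) : SmoothOnCube r (weight κ σ i) :=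
  (SmoothOnCube.const 1).add
    (SmoothOnCube.sum _ fun a => ((hS.datum a).smooth_κ i).mul (hσ a))

theorem PotentialSystem.smooth_combination (hS : PotentialSystem r x z κ φ Ω)
    (hσ : ∀ a, SmoothOnCube r (σ a)) : SmoothOnCube r (combination x z σ) :=
  SmoothOnCube.add hS.conj.1 (SmoothOnCube.sum _ fun a => (hσ a).smul (hS.datum a).smooth_z)

/-- Since `∂_i Ω a b = ∂_i φ a * κ b i` splits as a product, `∂_i φ a` factors out of the sum over
`b`. The remaining sum is, for `σ` itself, the weight minus one. -/
theorem PotentialSystem.pderiv_row (hr : 0 < r) (hS : PotentialSystem r x z κ φ Ω)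
    (hσ : ∀ a, SmoothOnCube r (σ a)) {ξ : Fin m → ℝ} (hξ : ξ ∈ cube m r) (i : Fin m) (a : ι) :
    pderiv r i (fun η => ∑ b, Ω a b η * σ b η) ξ =
      pderiv r i (φ a) ξ * ∑ b, κ b i ξ * σ b ξ + ∑ b, Ω a b ξ * pderiv r i (σ b) ξ := by
  rw [pderiv_sum hr _ (fun b => (hS.smooth_Ω a b).mul (hσ b)) hξ, Finset.mul_sum,
    ← Finset.sum_add_distrib]
  refine Finset.sum_congr rfl fun b _ => ?_
  rw [pderiv_mul hr (hS.smooth_Ω a b) (hσ b) hξ, hS.pderiv_Ω ξ hξ]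
  ring

theorem PotentialSystem.pderiv_combination (hr : 0 < r) (hS : PotentialSystem r x z κ φ Ω)
    (hσ : ∀ a, SmoothOnCube r (σ a)) {ξ : Fin m → ℝ} (hξ : ξ ∈ cube m r) (i : Fin m) :
    pderiv r i (combination x z σ) ξ =
      weight κ σ i ξ • pderiv r i x ξ + ∑ a, pderiv r i (σ a) ξ • z a ξ := by
  have h : ∀ a, SmoothOnCube r (fun ξ => σ a ξ • z a ξ) :=
    fun a => (hσ a).smul (hS.datum a).smooth_z
  unfold combination weight
  rw [pderiv_add hr hS.conj.1 (SmoothOnCube.sum _ h) hξ, pderiv_sum hr _ h hξ, add_smul, one_smul,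
    add_assoc, Finset.sum_smul, ← Finset.sum_add_distrib]
  congr 1
  refine Finset.sum_congr rfl fun a _ => ?_
  rw [pderiv_smul hr (hσ a) (hS.datum a).smooth_z hξ, (hS.datum a).pderiv_z ξ hξ]
  module

theorem IsTransformCoeff.row_pderiv (hr : 0 < r) (hS : PotentialSystem r x z κ φ Ω)
    (hσ : IsTransformCoeff r κ φ Ω I σ) {ξ : Fin m → ℝ} (hξ : ξ ∈ cube m r) (i : Fin m)
    {a : ι} (ha : a ∈ I) :
    ∑ b, Ω a b ξ * pderiv r i (σ b) ξ = -(weight κ σ i ξ * pderiv r i (φ a) ξ) := by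
  have h := hS.pderiv_row hr hσ.smooth hξ i a
  rw [pderiv_congr (fun η hη => hσ.row η hη a ha) hξ, pderiv_neg hr _ hξ] at h
  unfold weight
  linear_combination -h

/-- Differentiating the rows twice shows that `∂_i ∂_j σ - α ∂_i σ - β ∂_j σ` is annihilated by the
rows in `I`, for suitable `α` and `β`. It is supported in `I`, so it vanishes by nondegeneracy, and
the same `α`, `β` work for the net. -/
theorem IsTransformCoeff.isConjugateNet (hr : 0 < r) (hS : PotentialSystem r x z κ φ Ω)
    (hσ : IsTransformCoeff r κ φ Ω I σ) : IsConjugateNet r (combination x z σ) := by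
  refine ⟨hS.smooth_combination hσ.smooth, fun ξ hξ i j hij => ?_⟩
  simp only [pd_eq_pderiv]
  have hDσ : ∀ i a, SmoothOnCube r (pderiv r i (σ a)) := fun i a => (hσ.smooth a).pderiv hr i
  have hW := fun i => hS.smooth_weight hσ.smooth i
  have hDx := fun i => SmoothOnCube.pderiv hr hS.conj.1 i
  obtain ⟨c, c', hc⟩ := hS.conj.2 ξ hξ i j hij
  simp only [pd_eq_pderiv] at hc
  set K := ∑ b, κ b i ξ * pderiv r j (σ b) ξ with hK
  -- `α` and `β` are dictated by the coefficients of `∂_i x` and `∂_j x`; solving for them is where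
  -- nonvanishing weights are needed.
  obtain ⟨α, hα⟩ : ∃ α, α * weight κ σ i ξ = weight κ σ j ξ * c + K :=
    ⟨_, div_mul_cancel₀ _ (hσ.weight_ne_zero ξ hξ i)⟩
  obtain ⟨β, hβ⟩ : ∃ β, β * weight κ σ j ξ =
      pderiv r i (weight κ σ j) ξ + weight κ σ j ξ * c' :=
    ⟨_, div_mul_cancel₀ _ (hσ.weight_ne_zero ξ hξ j)⟩
  have hv : ∀ b, pderiv r i (pderiv r j (σ b)) ξ =
      α * pderiv r i (σ b) ξ + β * pderiv r j (σ b) ξ := by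
    have := hσ.nondeg ξ hξ (fun b => pderiv r i (pderiv r j (σ b)) ξ -
      (α * pderiv r i (σ b) ξ + β * pderiv r j (σ b) ξ)) (fun a ha => ?_) (fun a ha => ?_)
    · exact fun b => sub_eq_zero.1 (congrFun this b)
    · rw [pderiv_eq_zero_of_supp hσ.supp hξ i ha, pderiv_eq_zero_of_supp hσ.supp hξ j ha,
        pderiv_congr (fun η hη => pderiv_eq_zero_of_supp hσ.supp hη j ha) hξ, pderiv_const]
      ring
    · have h1 := hS.pderiv_row hr (hDσ j) hξ i a
      rw [pderiv_congr (fun η hη => hσ.row_pderiv hr hS hη j ha) hξ, pderiv_neg hr _ hξ,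
        pderiv_mul hr (hW j) ((hS.datum a).smooth_φ.pderiv hr j) hξ,
        (hS.datum a).pderiv_φ ξ hξ i j hij c c' hc, ← hK] at h1
      have h2 : ∑ b, Ω a b ξ * (pderiv r i (pderiv r j (σ b)) ξ -
          (α * pderiv r i (σ b) ξ + β * pderiv r j (σ b) ξ)) =
          ∑ b, Ω a b ξ * pderiv r i (pderiv r j (σ b)) ξ -
          (α * ∑ b, Ω a b ξ * pderiv r i (σ b) ξ + β * ∑ b, Ω a b ξ * pderiv r j (σ b) ξ) := by
        rw [Finset.mul_sum, Finset.mul_sum, ← Finset.sum_add_distrib, ← Finset.sum_sub_distrib]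
        exact Finset.sum_congr rfl fun b _ => by ring
      rw [h2, hσ.row_pderiv hr hS hξ i ha, hσ.row_pderiv hr hS hξ j ha]
      linear_combination -h1 + pderiv r i (φ a) ξ * hα + pderiv r j (φ a) ξ * hβ
  refine ⟨α, β, ?_⟩
  have hs : ∀ a, SmoothOnCube r (fun ξ => pderiv r j (σ a) ξ • z a ξ) :=
    fun a => (hDσ j a).smul (hS.datum a).smooth_z
  have hsum : ∑ a, pderiv r i (fun ξ => pderiv r j (σ a) ξ • z a ξ) ξ =
      α • ∑ a, pderiv r i (σ a) ξ • z a ξ + β • ∑ a, pderiv r j (σ a) ξ • z a ξ +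
        K • pderiv r i x ξ := by
    rw [hK, Finset.smul_sum, Finset.smul_sum, Finset.sum_smul, ← Finset.sum_add_distrib,
      ← Finset.sum_add_distrib]
    refine Finset.sum_congr rfl fun a _ => ?_
    rw [pderiv_smul hr (hDσ j a) (hS.datum a).smooth_z hξ, (hS.datum a).pderiv_z ξ hξ, hv]
    module
  rw [pderiv_congr (fun η hη => hS.pderiv_combination hr hσ.smooth hη j) hξ,
    pderiv_add hr ((hW j).smul (hDx j)) (SmoothOnCube.sum _ hs) hξ,
    pderiv_smul hr (hW j) (hDx j) hξ, hc, pderiv_sum hr _ hs hξ, hsum,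
    hS.pderiv_combination hr hσ.smooth hξ i, hS.pderiv_combination hr hσ.smooth hξ j]
  have h1 : (α * weight κ σ i ξ) • pderiv r i x ξ
      = (weight κ σ j ξ * c + K) • pderiv r i x ξ := by rw [hα]
  have h2 : (β * weight κ σ j ξ) • pderiv r j x ξ
      = (pderiv r i (weight κ σ j) ξ + weight κ σ j ξ * c') • pderiv r j x ξ := by rw [hβ]
  linear_combination (norm := module) -h1 - h2

/-- Enlarging the support of the coefficients by one index is a Jonas transformation. -/
theorem IsTransformCoeff.isJonasPair [DecidableEq ι] (hr : 0 < r) (hS : PotentialSystem r x z κ φ Ω)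
    (hσ : IsTransformCoeff r κ φ Ω I σ) {b : ι} {σ' : ι → (Fin m → ℝ) → ℝ}
    (hσ' : IsTransformCoeff r κ φ Ω (insert b I) σ') (hb : b ∉ I)
    (hne : ∀ ξ ∈ cube m r, σ' b ξ ≠ 0) :
    IsJonasPair r (combination x z σ) (combination x z σ') := by
  refine ⟨hσ.isConjugateNet hr hS, hσ'.isConjugateNet hr hS, fun ξ hξ i => ?_⟩
  simp only [pd_eq_pderiv]
  rw [hS.pderiv_combination hr hσ.smooth hξ i, hS.pderiv_combination hr hσ'.smooth hξ i]
  set W := weight κ σ i ξ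
  set W' := weight κ σ' i ξ
  have hW : W ≠ 0 := hσ.weight_ne_zero ξ hξ i
  -- This choice of `μ` kills the component at the new index `b`, where `σ` vanishes.
  obtain ⟨μ, hμ⟩ : ∃ μ, μ * σ' b ξ = W * pderiv r i (σ' b) ξ :=
    ⟨_, div_mul_cancel₀ _ (hne ξ hξ)⟩
  have hsb : σ b ξ = 0 := hσ.supp ξ hξ b hb
  have hsb' : pderiv r i (σ b) ξ = 0 := pderiv_eq_zero_of_supp hσ.supp hξ i hb
  -- The difference of the two sides is supported in `I` and killed by the rows in `I`: there `Ω ∂_i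
  -- σ = -W ∂_i φ`, `Ω ∂_i σ' = -W' ∂_i φ`, and `σ`, `σ'` have the same right-hand side.
  have hv : ∀ a, W * pderiv r i (σ' a) ξ - W' * pderiv r i (σ a) ξ = μ * (σ' a ξ - σ a ξ) := by
    have := hσ.nondeg ξ hξ (fun a => W * pderiv r i (σ' a) ξ - W' * pderiv r i (σ a) ξ -
      μ * (σ' a ξ - σ a ξ)) (fun a ha => ?_) (fun a ha => ?_)
    · exact fun b => sub_eq_zero.1 (congrFun this b)
    · by_cases hab : a = b
      · subst hab
        rw [hsb, hsb', sub_zero, hμ]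
        ring
      · have ha' : a ∉ insert b I := by simp [hab, ha]
        rw [hσ.supp ξ hξ a ha, hσ'.supp ξ hξ a ha', pderiv_eq_zero_of_supp hσ.supp hξ i ha,
          pderiv_eq_zero_of_supp hσ'.supp hξ i ha']
        ring
    · have ha' : a ∈ insert b I := Finset.mem_insert_of_mem ha
      have h2 : ∑ b, Ω a b ξ * (W * pderiv r i (σ' b) ξ - W' * pderiv r i (σ b) ξ -
          μ * (σ' b ξ - σ b ξ)) = W * ∑ b, Ω a b ξ * pderiv r i (σ' b) ξ -
          W' * ∑ b, Ω a b ξ * pderiv r i (σ b) ξ -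
          μ * (∑ b, Ω a b ξ * σ' b ξ - ∑ b, Ω a b ξ * σ b ξ) := by
        simp only [Finset.mul_sum, ← Finset.sum_sub_distrib]
        exact Finset.sum_congr rfl fun b _ => by ring
      rw [h2, hσ.row_pderiv hr hS hξ i ha, hσ'.row_pderiv hr hS hξ i ha', hσ.row ξ hξ a ha,
        hσ'.row ξ hξ a ha']
      ring
  have hsum : W • ∑ a, pderiv r i (σ' a) ξ • z a ξ =
      W' • ∑ a, pderiv r i (σ a) ξ • z a ξ +
        μ • (combination x z σ' ξ - combination x z σ ξ) := by
    rw [combination, combination, add_sub_add_left_eq_sub, ← Finset.sum_sub_distrib,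
      Finset.smul_sum, Finset.smul_sum, Finset.smul_sum, ← Finset.sum_add_distrib]
    refine Finset.sum_congr rfl fun a _ => ?_
    rw [smul_smul, sub_eq_iff_eq_add.1 (hv a)]
    module
  have hsum' := congrArg (fun v => W⁻¹ • v) hsum
  simp only [smul_add, smul_smul, inv_mul_cancel₀ hW, one_smul] at hsum'
  refine ⟨W⁻¹ * W' - 1, W⁻¹ * μ, ?_⟩
  rw [hsum', smul_add, smul_smul]
  have : (W⁻¹ * W' * W) • pderiv r i x ξ = W' • pderiv r i x ξ := by
    congr 1
    field_simp
  linear_combination (norm := module) -this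

end PotentialSystem

/-! ### Coplanarity of four points in affine coordinates. -/

section Planes

variable {V : Type*} [NormedAddCommGroup V] [InnerProductSpace ℝ V]

theorem mem_affineSpan_triple (x x₁ x₂ : V) (s t : ℝ) :
    x + s • (x₁ - x) + t • (x₂ - x) ∈ affineSpan ℝ {x, x₁, x₂} := by
  have h : ∀ y ∈ ({x, x₁, x₂} : Set V), y - x ∈ (affineSpan ℝ {x, x₁, x₂}).direction := by
    intro y hy
    rw [direction_affineSpan]
    exact vsub_mem_vectorSpan ℝ hy (by simp)
  have := AffineSubspace.vadd_mem_of_mem_direction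
    (Submodule.add_mem _ (Submodule.smul_mem _ s (h x₁ (by simp)))
      (Submodule.smul_mem _ t (h x₂ (by simp))))
    (subset_affineSpan ℝ {x, x₁, x₂} (show x ∈ ({x, x₁, x₂} : Set V) by simp))
  convert this using 1
  rw [vadd_eq_add]
  abel

theorem coplanar_of_eq {x x₁ x₂ y : V} {s t : ℝ} (h : y = x + s • (x₁ - x) + t • (x₂ - x)) :
    Coplanar ℝ {x, x₁, x₂, y} := by
  have e : ({x, x₁, x₂, y} : Set V) = insert y {x, x₁, x₂} := by
    ext w
    simp only [Set.mem_insert_iff, Set.mem_singleton_iff]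
    tauto
  rw [e, coplanar_insert_iff_of_mem_affineSpan (h ▸ mem_affineSpan_triple x x₁ x₂ s t)]
  exact coplanar_triple ℝ _ _ _

/-- The two independent edges already span a plane, so by dimension their span is the whole
direction space of the four points. -/
theorem exists_eq_of_coplanar {x x₁ x₂ y : V} (h : Coplanar ℝ {x, x₁, x₂, y})
    (hind : LinearIndependent ℝ ![x₁ - x, x₂ - x]) :
    ∃ s t : ℝ, y = x + s • (x₁ - x) + t • (x₂ - x) := by
  have := h.finiteDimensional_vectorSpan
  have hm : ∀ w ∈ ({x, x₁, x₂, y} : Set V), w - x ∈ vectorSpan ℝ ({x, x₁, x₂, y} : Set V) :=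
    fun w hw => vsub_mem_vectorSpan ℝ hw (by simp)
  have hle : Submodule.span ℝ (Set.range ![x₁ - x, x₂ - x]) ≤
      vectorSpan ℝ ({x, x₁, x₂, y} : Set V) := by
    rw [Submodule.span_le]
    rintro _ ⟨k, rfl⟩
    fin_cases k
    exacts [hm x₁ (by simp), hm x₂ (by simp)]
  have heq := Submodule.eq_of_le_of_finrank_le hle
    (by rw [finrank_span_eq_card hind]; simpa using h.finrank_le_two)
  have hy := hm y (by simp)
  rw [← heq] at hy
  simp only [Matrix.range_cons, Matrix.range_empty, Set.union_empty, Set.singleton_union,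
    Submodule.mem_span_pair] at hy
  obtain ⟨s, t, hst⟩ := hy
  exact ⟨s, t, by rw [add_assoc, hst]; abel⟩

end Planes

/-! ### Dependence on the values on the cube only. -/

section Congr

variable {m N : ℕ} {r : ℝ}

theorem IsConjugateNet.congr {x x' : Net m N} (h : Set.EqOn x x' (cube m r))
    (hx : IsConjugateNet r x) : IsConjugateNet r x' := by
  refine ⟨hx.1.congr fun ξ hξ => (h hξ).symm, fun ξ hξ i j hij => ?_⟩
  obtain ⟨c, c', hc⟩ := hx.2 ξ hξ i j hij
  refine ⟨c, c', ?_⟩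
  simp only [pd_eq_pderiv] at hc ⊢
  rw [pderiv_congr (fun η hη => (pderiv_congr h hη j).symm) hξ, ← pderiv_congr h hξ,
    ← pderiv_congr h hξ, hc]

theorem IsJonasPair.congr {x x' y y' : Net m N} (hx : Set.EqOn x x' (cube m r))
    (hy : Set.EqOn y y' (cube m r)) (h : IsJonasPair r x y) : IsJonasPair r x' y' := by
  refine ⟨h.1.congr hx, h.2.1.congr hy, fun ξ hξ i => ?_⟩
  obtain ⟨c, c', hc⟩ := h.2.2 ξ hξ i
  refine ⟨c, c', ?_⟩
  simp only [pd_eq_pderiv] at hc ⊢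
  rw [← pderiv_congr hx hξ, ← pderiv_congr hy hξ, ← hx hξ, ← hy hξ, hc]

end Congr

/-! ### Families of transforms and their mutual potentials. -/

section Family

variable {m N : ℕ} {r : ℝ} {ι : Type*}

/-- A potential system which generates the transforms `X a` of `x`. -/
structure GeneratingSystem (r : ℝ) (x : Net m N) (X z : ι → Net m N)
    (κ : ι → Fin m → (Fin m → ℝ) → ℝ) (φ u : ι → (Fin m → ℝ) → ℝ)
    (Ω : ι → ι → (Fin m → ℝ) → ℝ) : Prop extends PotentialSystem r x z κ φ Ω where
  smooth_u : ∀ a, SmoothOnCube r (u a)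
  u_ne_zero : ∀ ξ ∈ cube m r, ∀ a, u a ξ ≠ 0
  diag_ne_zero : ∀ ξ ∈ cube m r, ∀ a, Ω a a ξ ≠ 0
  eq_add : ∀ ξ ∈ cube m r, ∀ a, X a ξ = x ξ + u a ξ • z a ξ
  φ_eq : ∀ ξ ∈ cube m r, ∀ a, φ a ξ = -(Ω a a ξ * u a ξ)
  factor_ne_zero : ∀ ξ ∈ cube m r, ∀ a i, 1 + κ a i ξ * u a ξ ≠ 0

/-- The diagonal potentials are the functions `w` of the single transforms, for which `φ = -(w u)`;
the off-diagonal ones come from Poincaré's lemma with arbitrary constants, adjusted later by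
`GeneratingSystem.shift`. -/
theorem exists_generatingSystem [DecidableEq ι] (hr : 0 < r) {x : Net m N} {X : ι → Net m N}
    (h : ∀ a, IsJonasPair r x (X a)) (hx : IsConjugateNet r x)
    (h₂ : ∀ ξ ∈ cube m r, ∀ a i, LinearIndependent ℝ ![pderiv r i x ξ, X a ξ - x ξ])
    (h₂' : ∀ ξ ∈ cube m r, ∀ a i, LinearIndependent ℝ ![pderiv r i (X a) ξ, X a ξ - x ξ])
    (h₃ : ∀ ξ ∈ cube m r, ∀ a i j, i ≠ j →
      LinearIndependent ℝ ![pderiv r i x ξ, pderiv r j x ξ, X a ξ - x ξ]) :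
    ∃ z κ φ u Ω, GeneratingSystem r x X z κ φ u Ω := by
  choose z κ φ u w hd hu hw hall using fun a => exists_fundamentalDatum hr (h a)
    (fun ξ hξ i => h₂ ξ hξ a i) (fun ξ hξ i => h₂' ξ hξ a i) (fun ξ hξ i j => h₃ ξ hξ a i j)
  choose P hP hDP using fun a b => exists_potential hr hx (hd a) (hd b)
  refine ⟨z, κ, φ, u, fun a b => if a = b then w a else P a b, ⟨⟨hx, hd, fun a b => ?_,
    fun ξ hξ i a b => ?_⟩, hu, fun ξ hξ a => (hall a ξ hξ).1, fun ξ hξ a => ?_,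
    fun ξ hξ a => (hall a ξ hξ).2.2.1, fun ξ hξ a => ?_,
    fun ξ hξ a i => ((hall a ξ hξ).2.2.2.2 i).2⟩⟩
  · split_ifs
    exacts [hw a, hP a b]
  · split_ifs with hab
    · subst hab
      exact ((hall a ξ hξ).2.2.2.2 i).1
    · exact hDP a b ξ hξ i
  · simpa using (hall a ξ hξ).2.1
  · simpa using (hall a ξ hξ).2.2.2.1

variable {x : Net m N} {X z : ι → Net m N} {κ : ι → Fin m → (Fin m → ℝ) → ℝ}
  {φ u : ι → (Fin m → ℝ) → ℝ} {Ω : ι → ι → (Fin m → ℝ) → ℝ}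

theorem GeneratingSystem.mono (hr : 0 < r) {ρ : ℝ} (hρ : 0 < ρ) (h : ρ ≤ r)
    (hG : GeneratingSystem r x X z κ φ u Ω) : GeneratingSystem ρ x X z κ φ u Ω where
  toPotentialSystem := hG.toPotentialSystem.mono hr hρ h
  smooth_u a := (hG.smooth_u a).mono h
  u_ne_zero ξ hξ := hG.u_ne_zero ξ (cube_mono h hξ)
  diag_ne_zero ξ hξ := hG.diag_ne_zero ξ (cube_mono h hξ)
  eq_add ξ hξ := hG.eq_add ξ (cube_mono h hξ)
  φ_eq ξ hξ := hG.φ_eq ξ (cube_mono h hξ)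
  factor_ne_zero ξ hξ := hG.factor_ne_zero ξ (cube_mono h hξ)

/-- The off-diagonal potentials are determined up to additive constants. -/
theorem GeneratingSystem.shift (hr : 0 < r) (hG : GeneratingSystem r x X z κ φ u Ω)
    (C : ι → ι → ℝ) (hC : ∀ a, C a a = 0) :
    GeneratingSystem r x X z κ φ u (fun a b ξ => Ω a b ξ + C a b) where
  conj := hG.conj
  datum := hG.datum
  smooth_Ω a b := (hG.smooth_Ω a b).add (.const _)
  pderiv_Ω ξ hξ i a b := by
    rw [pderiv_add hr (hG.smooth_Ω a b) (.const _) hξ, pderiv_const, add_zero,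
      hG.pderiv_Ω ξ hξ]
  smooth_u := hG.smooth_u
  u_ne_zero := hG.u_ne_zero
  diag_ne_zero ξ hξ a := by simpa [hC] using hG.diag_ne_zero ξ hξ a
  eq_add := hG.eq_add
  φ_eq ξ hξ a := by simpa [hC] using hG.φ_eq ξ hξ a
  factor_ne_zero := hG.factor_ne_zero

/-- The derivative of a transform `X a` in terms of the generating system. -/
theorem GeneratingSystem.pderiv_X (hr : 0 < r) (hG : GeneratingSystem r x X z κ φ u Ω)
    {ξ : Fin m → ℝ} (hξ : ξ ∈ cube m r) (i : Fin m) (a : ι) :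
    pderiv r i (X a) ξ =
      (1 + κ a i ξ * u a ξ) • pderiv r i x ξ + pderiv r i (u a) ξ • z a ξ := by
  rw [pderiv_congr (fun η hη => hG.eq_add η hη a) hξ,
    pderiv_add hr hG.conj.1 ((hG.smooth_u a).smul (hG.datum a).smooth_z) hξ,
    pderiv_smul hr (hG.smooth_u a) (hG.datum a).smooth_z hξ, (hG.datum a).pderiv_z ξ hξ]
  module

theorem GeneratingSystem.diag_mul_pderiv_u (hr : 0 < r)
    (hG : GeneratingSystem r x X z κ φ u Ω) {ξ : Fin m → ℝ} (hξ : ξ ∈ cube m r) (i : Fin m)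
    (a : ι) :
    Ω a a ξ * pderiv r i (u a) ξ = -((1 + κ a i ξ * u a ξ) * pderiv r i (φ a) ξ) := by
  have h := pderiv_congr (fun η hη => hG.φ_eq η hη a) hξ i
  rw [pderiv_neg hr _ hξ, pderiv_mul hr (hG.smooth_Ω a a) (hG.smooth_u a) hξ,
    hG.pderiv_Ω ξ hξ] at h
  linear_combination h

/-- The coefficients of a planar combination `x + p z_a + q z_b` which is a Jonas transform of
`X a`: the defect in the linear equation number `a` satisfies a homogeneous equation. -/
theorem GeneratingSystem.wronskian_defect (hr : 0 < r)
    (hG : GeneratingSystem r x X z κ φ u Ω) {a b : ι}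
    (hind : ∀ ξ ∈ cube m r, ∀ i, LinearIndependent ℝ ![pderiv r i x ξ, z a ξ, z b ξ])
    {y : Net m N} {p q : (Fin m → ℝ) → ℝ} (hp : SmoothOnCube r p) (hq : SmoothOnCube r q)
    (hy : ∀ ξ ∈ cube m r, y ξ = x ξ + (p ξ • z a ξ + q ξ • z b ξ))
    (hJ : IsJonasPair r (X a) y) {ξ : Fin m → ℝ} (hξ : ξ ∈ cube m r) (i : Fin m) :
    q ξ * pderiv r i (fun η => Ω a a η * p η + Ω a b η * q η + φ a η) ξ =
      (Ω a a ξ * p ξ + Ω a b ξ * q ξ + φ a ξ) * pderiv r i q ξ := by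
  have hza := (hG.datum a).smooth_z
  have hzb := (hG.datum b).smooth_z
  have hΩa := hG.smooth_Ω a a
  have hΩb := hG.smooth_Ω a b
  obtain ⟨c, μ, hc⟩ := hJ.2.2 ξ hξ i
  simp only [pd_eq_pderiv] at hc
  rw [pderiv_congr hy hξ, pderiv_add hr hG.conj.1 ((hp.smul hza).add (hq.smul hzb)) hξ,
    pderiv_add hr (hp.smul hza) (hq.smul hzb) hξ, pderiv_smul hr hp hza hξ,
    pderiv_smul hr hq hzb hξ, (hG.datum a).pderiv_z ξ hξ, (hG.datum b).pderiv_z ξ hξ,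
    hG.pderiv_X hr hξ, hy ξ hξ, hG.eq_add ξ hξ] at hc
  -- The Jonas relation between `X a` and `y` is compared in the frame `∂_i x`, `z a`, `z b`; its
  -- third component says `∂_i q = μ q`, which lets `μ` be eliminated.
  obtain ⟨h1, h2, h3⟩ := coeff_eq_zero_of_triple (hind ξ hξ i)
    (p := 1 + κ a i ξ * p ξ + κ b i ξ * q ξ - (1 + c) * (1 + κ a i ξ * u a ξ))
    (q := pderiv r i p ξ - (1 + c) * pderiv r i (u a) ξ - μ * (p ξ - u a ξ))
    (s := pderiv r i q ξ - μ * q ξ)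
    (by linear_combination (norm := module) hc)
  rw [pderiv_add hr ((hΩa.mul hp).add (hΩb.mul hq)) (hG.datum a).smooth_φ hξ,
    pderiv_add hr (hΩa.mul hp) (hΩb.mul hq) hξ, pderiv_mul hr hΩa hp hξ,
    pderiv_mul hr hΩb hq hξ, hG.pderiv_Ω ξ hξ, hG.pderiv_Ω ξ hξ]
  have h4 := hG.diag_mul_pderiv_u hr hξ i a
  have h5 := hG.φ_eq ξ hξ a
  linear_combination q ξ * pderiv r i (φ a) ξ * h1 + q ξ * Ω a a ξ * h2 +
    (q ξ * Ω a b ξ - (Ω a a ξ * p ξ + Ω a b ξ * q ξ + φ a ξ)) * h3 +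
    q ξ * (1 + c) * h4 - q ξ * μ * h5

end Family

/-! ### Coefficient families supported on one or two indices. -/

section Coefficients

variable {m N : ℕ} {r : ℝ} {ι : Type*} [DecidableEq ι]

/-- The coefficient family concentrated in `a`. -/
noncomputable def singleCoeff (a : ι) (p : (Fin m → ℝ) → ℝ) : ι → (Fin m → ℝ) → ℝ :=
  fun c ξ => if c = a then p ξ else 0

/-- The coefficient family concentrated in `a` and `b`. -/
noncomputable def pairCoeff (a b : ι) (p q : (Fin m → ℝ) → ℝ) : ι → (Fin m → ℝ) → ℝ :=
  fun c ξ => singleCoeff a p c ξ + singleCoeff b q c ξ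

theorem SmoothOnCube.singleCoeff {a : ι} {p : (Fin m → ℝ) → ℝ} (hp : SmoothOnCube r p) (c : ι) :
    SmoothOnCube r (singleCoeff a p c) := by
  by_cases h : c = a
  · have e : Jonas.singleCoeff a p c = p := funext fun ξ => if_pos h
    rwa [e]
  · have e : Jonas.singleCoeff a p c = fun _ => 0 := funext fun ξ => if_neg h
    rw [e]
    exact .const 0

variable [Fintype ι]
variable {x : Net m N} {X z : ι → Net m N} {κ : ι → Fin m → (Fin m → ℝ) → ℝ}
  {φ u : ι → (Fin m → ℝ) → ℝ} {Ω : ι → ι → (Fin m → ℝ) → ℝ} {a b : ι}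
  {p q : (Fin m → ℝ) → ℝ}

theorem combination_singleCoeff (ξ : Fin m → ℝ) :
    combination x z (singleCoeff a p) ξ = x ξ + p ξ • z a ξ := by
  simp [combination, singleCoeff, ite_smul]

theorem combination_pairCoeff (ξ : Fin m → ℝ) :
    combination x z (pairCoeff a b p q) ξ = x ξ + (p ξ • z a ξ + q ξ • z b ξ) := by
  simp [combination, pairCoeff, singleCoeff, ite_smul, add_smul, Finset.sum_add_distrib]

theorem weight_singleCoeff (i : Fin m) (ξ : Fin m → ℝ) :
    weight κ (singleCoeff a p) i ξ = 1 + κ a i ξ * p ξ := by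
  simp [weight, singleCoeff]

theorem weight_pairCoeff (i : Fin m) (ξ : Fin m → ℝ) :
    weight κ (pairCoeff a b p q) i ξ = 1 + (κ a i ξ * p ξ + κ b i ξ * q ξ) := by
  simp [weight, pairCoeff, singleCoeff, mul_add, Finset.sum_add_distrib]

theorem GeneratingSystem.isTransformCoeff_single (hG : GeneratingSystem r x X z κ φ u Ω)
    (a : ι) : IsTransformCoeff r κ φ Ω {a} (singleCoeff a (u a)) where
  smooth := (hG.smooth_u a).singleCoeff
  supp ξ hξ c hc := by simpa [singleCoeff] using fun h => absurd h (by simpa using hc)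
  row ξ hξ c hc := by
    obtain rfl : c = a := by simpa using hc
    simp [singleCoeff, hG.φ_eq ξ hξ]
  nondeg ξ hξ v hv hΩ := by
    have h := hΩ a (by simp)
    rw [Finset.sum_eq_single a (fun c _ hc => by rw [hv c (by simpa using hc), mul_zero])
      (by simp)] at h
    ext c
    by_cases hc : c = a
    · subst hc
      exact (mul_eq_zero.1 h).resolve_left (hG.diag_ne_zero ξ hξ c)
    · exact hv c (by simpa using hc)
  weight_ne_zero ξ hξ i := by
    rw [weight_singleCoeff]
    exact hG.factor_ne_zero ξ hξ a i

theorem isTransformCoeff_pair (hab : a ≠ b) (hp : SmoothOnCube r p) (hq : SmoothOnCube r q)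
    (ha : ∀ ξ ∈ cube m r, Ω a a ξ * p ξ + Ω a b ξ * q ξ = -φ a ξ)
    (hb : ∀ ξ ∈ cube m r, Ω b a ξ * p ξ + Ω b b ξ * q ξ = -φ b ξ)
    (hdet : ∀ ξ ∈ cube m r, Ω a a ξ * Ω b b ξ - Ω a b ξ * Ω b a ξ ≠ 0)
    (hW : ∀ ξ ∈ cube m r, ∀ i, 1 + (κ a i ξ * p ξ + κ b i ξ * q ξ) ≠ 0) :
    IsTransformCoeff r κ φ Ω {a, b} (pairCoeff a b p q) where
  smooth c := (hp.singleCoeff c).add (hq.singleCoeff c)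
  supp ξ hξ c hc := by
    simp only [Finset.mem_insert, Finset.mem_singleton, not_or] at hc
    simp [pairCoeff, singleCoeff, hc.1, hc.2]
  row ξ hξ c hc := by
    have e : ∀ c, ∑ d, Ω c d ξ * pairCoeff a b p q d ξ = Ω c a ξ * p ξ + Ω c b ξ * q ξ := by
      intro c
      simp [pairCoeff, singleCoeff, mul_add, Finset.sum_add_distrib]
    rw [e]
    simp only [Finset.mem_insert, Finset.mem_singleton] at hc
    rcases hc with rfl | rfl
    exacts [ha ξ hξ, hb ξ hξ]
  nondeg ξ hξ v hv hΩ := by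
    have e : ∀ c, ∑ d, Ω c d ξ * v d = Ω c a ξ * v a + Ω c b ξ * v b := by
      intro c
      rw [← Finset.sum_pair (f := fun d => Ω c d ξ * v d) hab]
      refine (Finset.sum_subset (Finset.subset_univ _) fun d _ hd => ?_).symm
      rw [hv d hd, mul_zero]
    have h1 := hΩ a (by simp)
    have h2 := hΩ b (by simp)
    rw [e] at h1 h2
    have h3 : v a = 0 := (mul_eq_zero.1 (show (Ω a a ξ * Ω b b ξ - Ω a b ξ * Ω b a ξ) * v a = 0 by
      linear_combination Ω b b ξ * h1 - Ω a b ξ * h2)).resolve_left (hdet ξ hξ)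
    have h4 : v b = 0 := (mul_eq_zero.1 (show (Ω a a ξ * Ω b b ξ - Ω a b ξ * Ω b a ξ) * v b = 0 by
      linear_combination Ω a a ξ * h2 - Ω b a ξ * h1)).resolve_left (hdet ξ hξ)
    ext c
    by_cases hca : c = a
    · rw [hca, h3]; rfl
    by_cases hcb : c = b
    · rw [hcb, h4]; rfl
    exact hv c (by simp [hca, hcb])
  weight_ne_zero ξ hξ i := by
    rw [weight_pairCoeff]
    exact hW ξ hξ i

theorem GeneratingSystem.eqOn_single (hG : GeneratingSystem r x X z κ φ u Ω) (a : ι) :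
    Set.EqOn (combination x z (singleCoeff a (u a))) (X a) (cube m r) := fun ξ hξ => by
  rw [combination_singleCoeff, hG.eq_add ξ hξ]

/-- The set `{a, b}` enlarges both `{a}` and `{b}` by one index, so the same net is a Jonas
transformation of `X a` and of `X b`. The coefficient at the added index must not vanish. -/
theorem GeneratingSystem.isCoplanarCommonTransform_pair (hr : 0 < r)
    (hG : GeneratingSystem r x X z κ φ u Ω) (hab : a ≠ b)
    (hσ : IsTransformCoeff r κ φ Ω {a, b} (pairCoeff a b p q))
    (hp0 : ∀ ξ ∈ cube m r, p ξ ≠ 0) (hq0 : ∀ ξ ∈ cube m r, q ξ ≠ 0) :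
    IsCoplanarCommonTransform r x (X a) (X b) (combination x z (pairCoeff a b p q)) := by
  refine ⟨?_, ?_, fun ξ hξ => ?_⟩
  · have hσ' := hσ
    rw [Finset.pair_comm] at hσ'
    refine IsJonasPair.congr (hG.eqOn_single a) (fun _ _ => rfl)
      ((hG.isTransformCoeff_single a).isJonasPair hr hG.toPotentialSystem hσ'
        (by simpa using hab.symm) fun ξ hξ => ?_)
    simpa [pairCoeff, singleCoeff, hab.symm] using hq0 ξ hξ
  · refine IsJonasPair.congr (hG.eqOn_single b) (fun _ _ => rfl)
      ((hG.isTransformCoeff_single b).isJonasPair hr hG.toPotentialSystem hσ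
        (by simpa using hab) fun ξ hξ => ?_)
    simpa [pairCoeff, singleCoeff, hab] using hp0 ξ hξ
  · have h1 := hG.u_ne_zero ξ hξ a
    have h2 := hG.u_ne_zero ξ hξ b
    refine coplanar_of_eq (s := p ξ / u a ξ) (t := q ξ / u b ξ) ?_
    rw [combination_pairCoeff, hG.eq_add ξ hξ a, hG.eq_add ξ hξ b, add_sub_cancel_left,
      add_sub_cancel_left, smul_smul, smul_smul, div_mul_cancel₀ _ h1, div_mul_cancel₀ _ h2,
      add_assoc]

end Coefficients

/-! ### Uniqueness of a coplanar common transform with given value at the origin. -/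

section Uniqueness

variable {m N : ℕ} {r : ℝ} {ι : Type*}
variable {x : Net m N} {X z : ι → Net m N} {κ : ι → Fin m → (Fin m → ℝ) → ℝ}
  {φ u : ι → (Fin m → ℝ) → ℝ} {Ω : ι → ι → (Fin m → ℝ) → ℝ} {a b : ι}
  {p q : (Fin m → ℝ) → ℝ}

theorem GeneratingSystem.exists_pair_coeff (hm : 0 < m)
    (hG : GeneratingSystem r x X z κ φ u Ω)
    (hind : ∀ ξ ∈ cube m r, ∀ i, LinearIndependent ℝ ![pderiv r i x ξ, z a ξ, z b ξ])
    {y : Net m N} (hy : SmoothOnCube r y)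
    (hc : ∀ ξ ∈ cube m r, Coplanar ℝ {x ξ, X a ξ, X b ξ, y ξ}) :
    ∃ p q : (Fin m → ℝ) → ℝ, SmoothOnCube r p ∧ SmoothOnCube r q ∧
      ∀ ξ ∈ cube m r, y ξ = x ξ + (p ξ • z a ξ + q ξ • z b ξ) := by
  have hz : ∀ ξ ∈ cube m r, LinearIndependent ℝ ![z a ξ, z b ξ] := by
    intro ξ hξ
    rw [LinearIndependent.pair_iff]
    intro s t hst
    exact (coeff_eq_zero_of_triple (hind ξ hξ ⟨0, hm⟩) (p := 0) (q := s) (s := t)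
      (by rw [zero_smul, zero_add, hst])).2
  have hex : ∀ ξ, ∃ c : Fin 2 → ℝ, ξ ∈ cube m r →
      y ξ - x ξ = c 0 • z a ξ + c 1 • z b ξ := by
    intro ξ
    by_cases hξ : ξ ∈ cube m r
    · have hd : LinearIndependent ℝ ![X a ξ - x ξ, X b ξ - x ξ] := by
        rw [LinearIndependent.pair_iff, hG.eq_add ξ hξ, hG.eq_add ξ hξ, add_sub_cancel_left,
          add_sub_cancel_left]
        intro s t hst
        rw [smul_smul, smul_smul] at hst
        obtain ⟨h1, h2⟩ := coeff_eq_zero_of_pair (hz ξ hξ) hst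
        exact ⟨(mul_eq_zero.1 h1).resolve_right (hG.u_ne_zero ξ hξ a),
          (mul_eq_zero.1 h2).resolve_right (hG.u_ne_zero ξ hξ b)⟩
      obtain ⟨s, t, hst⟩ := exists_eq_of_coplanar (hc ξ hξ) hd
      refine ⟨![s * u a ξ, t * u b ξ], fun _ => ?_⟩
      rw [hst, hG.eq_add ξ hξ, hG.eq_add ξ hξ]
      simp only [Matrix.cons_val_zero, Matrix.cons_val_one]
      module
    · exact ⟨0, fun h => absurd h hξ⟩
  choose c hc using hex
  have hs := fun k => contDiffOn_coeff (S := cube m r) (v := ![z a, z b])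
      (w := fun ξ => y ξ - x ξ) (c := fun k ξ => c ξ k)
      (fun k => by
        fin_cases k
        exacts [(hG.datum a).smooth_z, (hG.datum b).smooth_z])
      (hy.sub hG.conj.1)
      (fun ξ hξ => by
        have e : (fun k => (![z a, z b] : Fin 2 → Net m N) k ξ) = ![z a ξ, z b ξ] := by
          ext k; fin_cases k <;> rfl
        rw [e]
        exact hz ξ hξ)
      (fun ξ hξ => by simpa [Fin.sum_univ_two] using hc ξ hξ) k
  exact ⟨fun ξ => c ξ 0, fun ξ => c ξ 1, hs 0, hs 1, fun ξ hξ => by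
    rw [← hc ξ hξ, add_sub_cancel]⟩

/-- The linear system is propagated, on a convex set where both coefficients do not vanish. -/
theorem GeneratingSystem.defect_eq_zero (hr : 0 < r)
    (hG : GeneratingSystem r x X z κ φ u Ω)
    (hind : ∀ ξ ∈ cube m r, ∀ i, LinearIndependent ℝ ![pderiv r i x ξ, z a ξ, z b ξ])
    {y : Net m N} (hp : SmoothOnCube r p) (hq : SmoothOnCube r q)
    (hy : ∀ ξ ∈ cube m r, y ξ = x ξ + (p ξ • z a ξ + q ξ • z b ξ))
    (hJ : IsJonasPair r (X a) y) {S : Set (Fin m → ℝ)} (hS : Convex ℝ S) (hSr : S ⊆ cube m r)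
    (hqS : ∀ ξ ∈ S, q ξ ≠ 0) {ξ₀ : Fin m → ℝ} (h₀ : ξ₀ ∈ S)
    (hz : Ω a a ξ₀ * p ξ₀ + Ω a b ξ₀ * q ξ₀ + φ a ξ₀ = 0) {ξ : Fin m → ℝ} (hξ : ξ ∈ S) :
    Ω a a ξ * p ξ + Ω a b ξ * q ξ + φ a ξ = 0 :=
  eq_zero_of_wronskian (f := fun η => Ω a a η * p η + Ω a b η * q η + φ a η) (g := q)
    ((((hG.smooth_Ω a a).mul hp).add ((hG.smooth_Ω a b).mul hq)).add (hG.datum a).smooth_φ) hq hS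
    hSr hqS (fun _ hη i => hG.wronskian_defect hr hind hp hq hy hJ (hSr hη) i) h₀ hz hξ

theorem linearIndependent_swap {V : Type*} [AddCommGroup V] [Module ℝ V] {v w₁ w₂ : V}
    (h : LinearIndependent ℝ ![v, w₁, w₂]) : LinearIndependent ℝ ![v, w₂, w₁] :=
  linearIndependent_triple fun p q s e => by
    obtain ⟨h1, h2, h3⟩ := coeff_eq_zero_of_triple h (p := p) (q := s) (s := q)
      (by rw [← e]; abel)
    exact ⟨h1, h3, h2⟩

/-- Nothing is known in advance about zeros of `p'` and `q'`, so the linear system cannot be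
propagated in one step. The set where both defects vanish is closed, and there `p' = p` and `q' = q`
are nonzero; hence the defects vanish nearby as well. The set is open, contains `0`, and the cube is
connected. -/
theorem GeneratingSystem.pair_unique (hr : 0 < r) (hG : GeneratingSystem r x X z κ φ u Ω)
    (hind : ∀ ξ ∈ cube m r, ∀ i, LinearIndependent ℝ ![pderiv r i x ξ, z a ξ, z b ξ])
    (ha : ∀ ξ ∈ cube m r, Ω a a ξ * p ξ + Ω a b ξ * q ξ = -φ a ξ)
    (hb : ∀ ξ ∈ cube m r, Ω b a ξ * p ξ + Ω b b ξ * q ξ = -φ b ξ)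
    (hdet : ∀ ξ ∈ cube m r, Ω a a ξ * Ω b b ξ - Ω a b ξ * Ω b a ξ ≠ 0)
    (hp0 : ∀ ξ ∈ cube m r, p ξ ≠ 0) (hq0 : ∀ ξ ∈ cube m r, q ξ ≠ 0)
    {y : Net m N} {p' q' : (Fin m → ℝ) → ℝ} (hp' : SmoothOnCube r p') (hq' : SmoothOnCube r q')
    (hy : ∀ ξ ∈ cube m r, y ξ = x ξ + (p' ξ • z a ξ + q' ξ • z b ξ))
    (hJa : IsJonasPair r (X a) y) (hJb : IsJonasPair r (X b) y)
    (h0p : p' 0 = p 0) (h0q : q' 0 = q 0) {ξ : Fin m → ℝ} (hξ : ξ ∈ cube m r) :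
    p' ξ = p ξ ∧ q' ξ = q ξ := by
  have hy' : ∀ ξ ∈ cube m r, y ξ = x ξ + (q' ξ • z b ξ + p' ξ • z a ξ) := fun ξ hξ => by
    rw [hy ξ hξ, add_comm (p' ξ • z a ξ)]
  have heq : ∀ ξ ∈ cube m r, Ω a a ξ * p' ξ + Ω a b ξ * q' ξ + φ a ξ = 0 →
      Ω b b ξ * q' ξ + Ω b a ξ * p' ξ + φ b ξ = 0 → p' ξ = p ξ ∧ q' ξ = q ξ := by
    intro ξ hξ h1 h2
    refine ⟨mul_left_cancel₀ (hdet ξ hξ) ?_, mul_left_cancel₀ (hdet ξ hξ) ?_⟩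
    · linear_combination Ω b b ξ * (h1 - ha ξ hξ) - Ω a b ξ * (h2 - hb ξ hξ)
    · linear_combination Ω a a ξ * (h2 - hb ξ hξ) - Ω b a ξ * (h1 - ha ξ hξ)
  let Z : Set (cube m r) := {ξ | Ω a a ξ * p' ξ + Ω a b ξ * q' ξ + φ a ξ = 0 ∧
    Ω b b ξ * q' ξ + Ω b a ξ * p' ξ + φ b ξ = 0}
  have hc : ∀ {f : (Fin m → ℝ) → ℝ}, SmoothOnCube r f →
      Continuous fun ξ : cube m r => f ξ := fun hf => hf.continuousOn.domRestrict
  have hΩ := fun c d => hc (hG.smooth_Ω c d)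
  have hφ := fun c => hc (hG.datum c).smooth_φ
  have hcp := hc hp'
  have hcq := hc hq'
  have hclosed : IsClosed Z := by
    refine (isClosed_eq ?_ continuous_const).inter (isClosed_eq ?_ continuous_const)
    · exact (((hΩ a a).mul hcp).add ((hΩ a b).mul hcq)).add (hφ a)
    · exact (((hΩ b b).mul hcq).add ((hΩ b a).mul hcp)).add (hφ b)
  have hopen : IsOpen Z := by
    rw [isOpen_iff_mem_nhds]
    rintro ⟨ξ₀, hξ₀⟩ ⟨h1, h2⟩
    obtain ⟨e1, e2⟩ := heq ξ₀ hξ₀ h1 h2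
    have hev : ∀ᶠ ξ : cube m r in 𝓝 ⟨ξ₀, hξ₀⟩, p' ξ ≠ 0 ∧ q' ξ ≠ 0 :=
      (hcp.continuousAt.eventually_ne (by rw [e1]; exact hp0 ξ₀ hξ₀)).and
        (hcq.continuousAt.eventually_ne (by rw [e2]; exact hq0 ξ₀ hξ₀))
    -- The cube intersected with a ball is convex, as `GeneratingSystem.defect_eq_zero` requires.
    obtain ⟨ε, hε, hball⟩ := Metric.eventually_nhds_iff_ball.1 hev
    refine Metric.mem_nhds_iff.2 ⟨ε, hε, fun ξ hξb => ?_⟩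
    have hS : Convex ℝ (cube m r ∩ Metric.ball ξ₀ ε) := convex_cube.inter (convex_ball _ _)
    have hmem : ∀ η ∈ cube m r ∩ Metric.ball ξ₀ ε, p' η ≠ 0 ∧ q' η ≠ 0 :=
      fun η hη => hball ⟨η, hη.1⟩ hη.2
    have h₀ : ξ₀ ∈ cube m r ∩ Metric.ball ξ₀ ε := ⟨hξ₀, Metric.mem_ball_self hε⟩
    exact ⟨hG.defect_eq_zero hr hind hp' hq' hy hJa hS Set.inter_subset_left
        (fun η hη => (hmem η hη).2) h₀ h1 ⟨ξ.2, hξb⟩,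
      hG.defect_eq_zero hr (fun η hη i => linearIndependent_swap (hind η hη i)) hq' hp' hy' hJb hS
        Set.inter_subset_left (fun η hη => (hmem η hη).1) h₀ h2 ⟨ξ.2, hξb⟩⟩
  have := Subtype.preconnectedSpace (convex_cube (m := m) (r := r)).isPreconnected
  have h0 := zero_mem_cube (m := m) hr.le
  have huniv := IsClopen.eq_univ ⟨hclosed, hopen⟩
    ⟨⟨0, h0⟩, by
      constructor
      · change Ω a a 0 * p' 0 + Ω a b 0 * q' 0 + φ a 0 = 0
        rw [h0p, h0q, ha 0 h0, neg_add_cancel]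
      · change Ω b b 0 * q' 0 + Ω b a 0 * p' 0 + φ b 0 = 0
        rw [h0p, h0q, add_comm (Ω b b 0 * q 0), hb 0 h0, neg_add_cancel]⟩
  have hZ : (⟨ξ, hξ⟩ : cube m r) ∈ Z := huniv ▸ Set.mem_univ _
  exact heq ξ hξ hZ.1 hZ.2

end Uniqueness

/-! ### Open conditions at the origin hold on a smaller cube. -/

section Shrinking

variable {m N : ℕ} {r : ℝ}

theorem exists_cube_subset (hr : 0 < r) {S : Set (Fin m → ℝ)} (hS : S ∈ 𝓝[cube m r] 0) :
    ∃ ρ, 0 < ρ ∧ ρ ≤ r ∧ cube m ρ ⊆ S := by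
  obtain ⟨ε, hε, hb⟩ := Metric.mem_nhdsWithin_iff.1 hS
  refine ⟨min r (ε / 2), lt_min hr (half_pos hε), min_le_left _ _, fun ξ hξ => hb ⟨?_, ?_⟩⟩
  · rw [mem_ball_zero_iff]
    refine lt_of_le_of_lt ?_ (half_lt_self hε)
    rw [pi_norm_le_iff_of_nonneg (half_pos hε).le]
    intro i
    rw [Real.norm_eq_abs, abs_of_nonneg (hξ.1 i)]
    exact (hξ.2 i).trans (min_le_right _ _)
  · exact cube_mono (min_le_left _ _) hξ

theorem exists_cube_of_eventually (hr : 0 < r) {P : (Fin m → ℝ) → Prop}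
    (h : ∀ᶠ ξ in 𝓝[cube m r] 0, P ξ) : ∃ ρ, 0 < ρ ∧ ρ ≤ r ∧ ∀ ξ ∈ cube m ρ, P ξ :=
  exists_cube_subset hr h

theorem SmoothOnCube.eventually_ne (hr : 0 ≤ r) {f : (Fin m → ℝ) → ℝ} (hf : SmoothOnCube r f)
    (h : f 0 ≠ 0) : ∀ᶠ ξ in 𝓝[cube m r] 0, f ξ ≠ 0 :=
  (hf.continuousOn 0 (zero_mem_cube hr)).eventually_ne h

theorem SmoothOnCube.eventually_linearIndependent_pair (hr : 0 ≤ r) {v w : Net m N}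
    (hv : SmoothOnCube r v) (hw : SmoothOnCube r w) (h : LinearIndependent ℝ ![v 0, w 0]) :
    ∀ᶠ ξ in 𝓝[cube m r] 0, LinearIndependent ℝ ![v ξ, w ξ] := by
  have hc : ContinuousWithinAt (fun ξ => ![v ξ, w ξ]) (cube m r) 0 := by
    refine continuousWithinAt_pi.2 fun k => ?_
    fin_cases k
    exacts [hv.continuousOn 0 (zero_mem_cube hr), hw.continuousOn 0 (zero_mem_cube hr)]
  exact hc.eventually (isOpen_setOfPred_linearIndependent.mem_nhds h)

theorem SmoothOnCube.eventually_linearIndependent_triple (hr : 0 ≤ r) {v w w' : Net m N}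
    (hv : SmoothOnCube r v) (hw : SmoothOnCube r w) (hw' : SmoothOnCube r w')
    (h : LinearIndependent ℝ ![v 0, w 0, w' 0]) :
    ∀ᶠ ξ in 𝓝[cube m r] 0, LinearIndependent ℝ ![v ξ, w ξ, w' ξ] := by
  have hc : ContinuousWithinAt (fun ξ => ![v ξ, w ξ, w' ξ]) (cube m r) 0 := by
    refine continuousWithinAt_pi.2 fun k => ?_
    fin_cases k
    exacts [hv.continuousOn 0 (zero_mem_cube hr), hw.continuousOn 0 (zero_mem_cube hr),
      hw'.continuousOn 0 (zero_mem_cube hr)]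
  exact hc.eventually (isOpen_setOfPred_linearIndependent.mem_nhds h)

theorem GenericPair.symm {x x₁ x₂ : Net m N} (h : GenericPair r x x₁ x₂) :
    GenericPair r x x₂ x₁ :=
  ⟨fun i => linearIndependent_swap (h.1 i), fun i j hij => (h.2.1 i j hij).symm,
    fun i => (h.2.2 i).symm⟩

/-- Generic families of transforms have generating systems near the origin. -/
theorem exists_generatingSystem_of_genericPair {ι : Type*} [Finite ι] [Nontrivial ι]
    (hr : 0 < r) {x : Net m N} {X : ι → Net m N} (hJ : ∀ a, IsJonasPair r x (X a))
    (hg : ∀ a b, a ≠ b → GenericPair r x (X a) (X b)) :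
    ∃ ρ, 0 < ρ ∧ ρ ≤ r ∧ ∃ z κ φ u Ω, GeneratingSystem ρ x X z κ φ u Ω ∧
      ∀ ξ ∈ cube m ρ, ∀ a b, a ≠ b → ∀ i,
        LinearIndependent ℝ ![pderiv ρ i x ξ, z a ξ, z b ξ] := by
  classical
  obtain ⟨a₀⟩ : Nonempty ι := inferInstance
  have hx : IsConjugateNet r x := (hJ a₀).1
  have hDx := fun i => SmoothOnCube.pderiv hr hx.1 i
  have hDX := fun a i => SmoothOnCube.pderiv hr (hJ a).2.1.1 i
  have hd : ∀ a, SmoothOnCube r (fun ξ => X a ξ - x ξ) :=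
    fun a => SmoothOnCube.sub (hJ a).2.1.1 hx.1
  have e1 : ∀ᶠ ξ in 𝓝[cube m r] 0, ∀ a b i, a ≠ b →
      LinearIndependent ℝ ![pderiv r i x ξ, X a ξ - x ξ, X b ξ - x ξ] := by
    simp only [Filter.eventually_all]
    exact fun a b i hab => (hDx i).eventually_linearIndependent_triple hr.le (hd a) (hd b)
      ((hg a b hab).1 i)
  have e2 : ∀ᶠ ξ in 𝓝[cube m r] 0, ∀ a i j, i ≠ j →
      LinearIndependent ℝ ![pderiv r i x ξ, pderiv r j x ξ, X a ξ - x ξ] := by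
    simp only [Filter.eventually_all]
    intro a i j hij
    obtain ⟨b, hb⟩ := exists_ne a
    exact (hDx i).eventually_linearIndependent_triple hr.le (hDx j) (hd a)
      ((hg a b hb.symm).2.1 i j hij).1
  have e3 : ∀ᶠ ξ in 𝓝[cube m r] 0, ∀ a i,
      LinearIndependent ℝ ![pderiv r i (X a) ξ, X a ξ - x ξ] := by
    simp only [Filter.eventually_all]
    intro a i
    obtain ⟨b, hb⟩ := exists_ne a
    exact (hDX a i).eventually_linearIndependent_pair hr.le (hd a) ((hg a b hb.symm).2.2 i).1
  obtain ⟨ρ, hρ, hρr, hall⟩ := exists_cube_of_eventually hr (e1.and (e2.and e3))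
  have hpx : ∀ ξ ∈ cube m ρ, ∀ i, pderiv ρ i x ξ = pderiv r i x ξ :=
    fun ξ hξ i => pderiv_of_le hρ hρr hx.1 hξ i
  obtain ⟨z, κ, φ, u, Ω, hG⟩ := exists_generatingSystem hρ (X := X)
    (fun a => (hJ a).mono hr hρ hρr) (hx.mono hr hρ hρr)
    (fun ξ hξ a i => by
      obtain ⟨b, hb⟩ := exists_ne a
      rw [hpx ξ hξ, LinearIndependent.pair_iff]
      intro s t hst
      obtain ⟨h1, h2, -⟩ := coeff_eq_zero_of_triple ((hall ξ hξ).1 a b i hb.symm) (p := s)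
        (q := t) (s := 0) (by rw [hst, zero_smul, zero_add])
      exact ⟨h1, h2⟩)
    (fun ξ hξ a i => by
      rw [pderiv_of_le hρ hρr (hJ a).2.1.1 hξ]
      exact (hall ξ hξ).2.2 a i)
    (fun ξ hξ a i j hij => by
      rw [hpx ξ hξ, hpx ξ hξ]
      exact (hall ξ hξ).2.1 a i j hij)
  refine ⟨ρ, hρ, hρr, z, κ, φ, u, Ω, hG, fun ξ hξ a b hab i => ?_⟩
  refine linearIndependent_triple fun s t v e => ?_
  have ha := hG.u_ne_zero ξ hξ a
  have hb := hG.u_ne_zero ξ hξ b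
  have hli := (hall ξ hξ).1 a b i hab
  rw [hG.eq_add ξ hξ, hG.eq_add ξ hξ, add_sub_cancel_left, add_sub_cancel_left] at hli
  obtain ⟨h1, h2, h3⟩ := coeff_eq_zero_of_triple hli (p := s) (q := t / u a ξ) (s := v / u b ξ)
    (by rw [smul_smul, smul_smul, div_mul_cancel₀ _ ha, div_mul_cancel₀ _ hb, ← hpx ξ hξ, e])
  exact ⟨h1, (div_eq_zero_iff.1 h2).resolve_right ha, (div_eq_zero_iff.1 h3).resolve_right hb⟩

end Shrinking

/-! ### The admissible pairs: an open dense complement of finitely many affine conditions. -/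

section Admissible

variable {m N : ℕ} {r : ℝ} {ι : Type*} {x : Net m N} {X z : ι → Net m N}
  {κ : ι → Fin m → (Fin m → ℝ) → ℝ} {φ u : ι → (Fin m → ℝ) → ℝ}
  {Ω : ι → ι → (Fin m → ℝ) → ℝ} {a b : ι}

theorem admissible_of_le {ρ : ℝ} (hρ : 0 < ρ) (h : ρ ≤ r) {x x₁ x₂ : Net m N}
    (hx : SmoothOnCube r x) (h₁ : SmoothOnCube r x₁) (h₂ : SmoothOnCube r x₂) :
    admissible r x x₁ x₂ = admissible ρ x x₁ x₂ := by
  have h0 := zero_mem_cube (m := m) hρ.le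
  unfold admissible
  simp only [pd_eq_pderiv, pderiv_of_le hρ h hx h0, pderiv_of_le hρ h h₁ h0,
    pderiv_of_le hρ h h₂ h0]

/-- Modulo `z a` and `z b` the affine combination of the three tangents is a multiple of `∂_i x`.
The factor is affine in `q`, and transversality means that it is nonzero. -/
theorem GeneratingSystem.mem_admissible_iff (hr : 0 < r)
    (hG : GeneratingSystem r x X z κ φ u Ω)
    (hind : ∀ i, LinearIndependent ℝ ![pderiv r i x 0, z a 0, z b 0]) (q : ℝ × ℝ) :
    q ∈ admissible r x (X a) (X b) ↔ q.1 ≠ 0 ∧ q.2 ≠ 0 ∧ q.1 + q.2 ≠ 1 ∧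
      ∀ i, 1 + κ a i 0 * u a 0 * q.1 + κ b i 0 * u b 0 * q.2 ≠ 0 := by
  have h0 := zero_mem_cube (m := m) hr.le
  have hua := hG.u_ne_zero 0 h0 a
  have hub := hG.u_ne_zero 0 h0 b
  unfold admissible
  simp only [pd_eq_pderiv, Set.mem_ofPred_eq]
  refine and_congr_right' (and_congr_right' (and_congr_right' (forall_congr' fun i => ?_)))
  rw [hG.pderiv_X hr h0, hG.pderiv_X hr h0, hG.eq_add 0 h0, hG.eq_add 0 h0, add_sub_cancel_left,
    add_sub_cancel_left]
  set W := 1 + κ a i 0 * u a 0 * q.1 + κ b i 0 * u b 0 * q.2 with hW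
  have hv : (1 - q.1 - q.2) • pderiv r i x 0 +
      q.1 • ((1 + κ a i 0 * u a 0) • pderiv r i x 0 + pderiv r i (u a) 0 • z a 0) +
      q.2 • ((1 + κ b i 0 * u b 0) • pderiv r i x 0 + pderiv r i (u b) 0 • z b 0) =
      W • pderiv r i x 0 + (q.1 * pderiv r i (u a) 0) • z a 0 +
        (q.2 * pderiv r i (u b) 0) • z b 0 := by
    rw [hW]
    module
  rw [hv]
  constructor
  · intro hli hW0
    have := coeff_eq_zero_of_triple hli (p := 1) (q := -(q.1 * pderiv r i (u a) 0 / u a 0))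
      (s := -(q.2 * pderiv r i (u b) 0 / u b 0)) (by
        rw [hW0, smul_smul, smul_smul, neg_mul, neg_mul, div_mul_cancel₀ _ hua,
          div_mul_cancel₀ _ hub]
        module)
    exact one_ne_zero this.1
  · intro hW0
    refine linearIndependent_triple fun s t v e => ?_
    obtain ⟨h1, h2, h3⟩ := coeff_eq_zero_of_triple (hind i) (p := s * W)
      (q := s * (q.1 * pderiv r i (u a) 0) + t * u a 0)
      (s := s * (q.2 * pderiv r i (u b) 0) + v * u b 0) (by rw [← e]; module)
    have hs : s = 0 := (mul_eq_zero.1 h1).resolve_right hW0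
    rw [hs, zero_mul, zero_add] at h2 h3
    exact ⟨hs, (mul_eq_zero.1 h2).resolve_right hua, (mul_eq_zero.1 h3).resolve_right hub⟩

theorem dense_affine_ne_zero {α β γ : ℝ} (h : α ≠ 0 ∨ β ≠ 0 ∨ γ ≠ 0) :
    Dense {q : ℝ × ℝ | α + β * q.1 + γ * q.2 ≠ 0} := by
  obtain ⟨q', hq'⟩ : ∃ q : ℝ × ℝ, α + β * q.1 + γ * q.2 ≠ 0 := by
    by_contra! hc
    have h1 := hc (0, 0)
    have h2 := hc (1, 0)
    have h3 := hc (0, 1)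
    simp only [mul_zero, add_zero, mul_one] at h1 h2 h3
    rw [h1, zero_add] at h2 h3
    tauto
  intro q
  by_cases hq : α + β * q.1 + γ * q.2 = 0
  -- Approach the zero `q` along the segment towards a non-zero `q'`: the affine function is linear
  -- in `ε` there and vanishes only at `ε = 0`.
  · have ht : Filter.Tendsto (fun ε : ℝ => q + ε • (q' - q)) (𝓝[≠] 0) (𝓝 q) := by
      have hc : Continuous fun ε : ℝ => q + ε • (q' - q) := by fun_prop
      have := hc.tendsto 0
      simp only [zero_smul, add_zero] at this
      exact this.mono_left nhdsWithin_le_nhds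
    refine mem_closure_of_tendsto ht (eventually_mem_nhdsWithin.mono fun ε hε => ?_)
    have e : α + β * (q + ε • (q' - q)).1 + γ * (q + ε • (q' - q)).2 =
        ε * (α + β * q'.1 + γ * q'.2) := by
      simp only [Prod.fst_add, Prod.snd_add, Prod.smul_fst, Prod.smul_snd, Prod.fst_sub,
        Prod.snd_sub, smul_eq_mul]
      linear_combination (1 - ε) * hq
    rw [Set.mem_ofPred_eq, e]
    exact mul_ne_zero hε hq'
  · exact subset_closure hq

theorem isOpen_affine_ne_zero (α β γ : ℝ) : IsOpen {q : ℝ × ℝ | α + β * q.1 + γ * q.2 ≠ 0} :=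
  isOpen_ne_fun (by fun_prop) continuous_const

theorem GeneratingSystem.isOpen_admissible_and_dense (hr : 0 < r)
    (hG : GeneratingSystem r x X z κ φ u Ω)
    (hind : ∀ i, LinearIndependent ℝ ![pderiv r i x 0, z a 0, z b 0]) :
    IsOpen (admissible r x (X a) (X b)) ∧ Dense (admissible r x (X a) (X b)) := by
  have e : admissible r x (X a) (X b) = {q | 0 + 1 * q.1 + 0 * q.2 ≠ 0} ∩
      ({q | 0 + 0 * q.1 + 1 * q.2 ≠ 0} ∩ ({q | -1 + 1 * q.1 + 1 * q.2 ≠ 0} ∩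
      ⋂ i, {q | 1 + κ a i 0 * u a 0 * q.1 + κ b i 0 * u b 0 * q.2 ≠ 0})) := by
    ext q
    rw [hG.mem_admissible_iff hr hind]
    simp only [Set.mem_inter_iff, Set.mem_ofPred_eq, Set.mem_iInter, zero_add, one_mul, zero_mul,
      add_zero]
    refine and_congr_right' (and_congr_right' (and_congr_left' ?_))
    rw [not_iff_not]
    constructor <;> intro h <;> linarith
  have hI : IsOpen (⋂ i, {q : ℝ × ℝ | 1 + κ a i 0 * u a 0 * q.1 + κ b i 0 * u b 0 * q.2 ≠ 0}) :=
    isOpen_iInter_of_finite fun i => isOpen_affine_ne_zero _ _ _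
  have hD : Dense (⋂ i, {q : ℝ × ℝ | 1 + κ a i 0 * u a 0 * q.1 + κ b i 0 * u b 0 * q.2 ≠ 0}) :=
    dense_iInter_of_isOpen (fun i => isOpen_affine_ne_zero _ _ _)
      fun i => dense_affine_ne_zero (by simp)
  rw [e]
  refine ⟨(isOpen_affine_ne_zero _ _ _).inter ((isOpen_affine_ne_zero _ _ _).inter
    ((isOpen_affine_ne_zero _ _ _).inter hI)), ?_⟩
  refine (dense_affine_ne_zero (by simp)).inter_of_isOpen_left ?_ (isOpen_affine_ne_zero _ _ _)
  refine (dense_affine_ne_zero (by simp)).inter_of_isOpen_left ?_ (isOpen_affine_ne_zero _ _ _)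
  exact (dense_affine_ne_zero (by simp)).inter_of_isOpen_left hD (isOpen_affine_ne_zero _ _ _)

end Admissible

/-! ### The two-parameter family of common transforms. -/

section TwoTransforms

variable {m N : ℕ} {r : ℝ} {ι : Type*} [Fintype ι] [DecidableEq ι] {x : Net m N}
  {X z : ι → Net m N} {κ : ι → Fin m → (Fin m → ℝ) → ℝ} {φ u : ι → (Fin m → ℝ) → ℝ}
  {Ω : ι → ι → (Fin m → ℝ) → ℝ} {a b : ι}

/-- The pair `q` enters only through constants added to `Ω a b` and `Ω b a`, chosen so that the `2 ×
2` system has the prescribed solution `(q.1 * u a, q.2 * u b)` at the origin. Solving the system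
explicitly gives joint smoothness. -/
theorem GeneratingSystem.exists_family (hm : 0 < m) (hr : 0 < r)
    (hG : GeneratingSystem r x X z κ φ u Ω) (hab : a ≠ b)
    (hind : ∀ ξ ∈ cube m r, ∀ i, LinearIndependent ℝ ![pderiv r i x ξ, z a ξ, z b ξ])
    {q₀ : ℝ × ℝ} (hq₀ : q₀ ∈ admissible r x (X a) (X b)) :
    ∃ V : Set (ℝ × ℝ), IsOpen V ∧ q₀ ∈ V ∧ ∃ ρ : ℝ, 0 < ρ ∧ ρ ≤ r ∧
      ∃ y : ℝ × ℝ → Net m N,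
        ContDiffOn ℝ ∞ (fun w : (ℝ × ℝ) × (Fin m → ℝ) => y w.1 w.2) (V ×ˢ cube m ρ) ∧
        ∀ q ∈ V, y q 0 = planePoint x (X a) (X b) q ∧
          IsCoplanarCommonTransform ρ x (X a) (X b) (y q) ∧
          ∀ (ρ' : ℝ) (y' : Net m N), 0 < ρ' → ρ' ≤ ρ →
            IsCoplanarCommonTransform ρ' x (X a) (X b) y' →
            y' 0 = planePoint x (X a) (X b) q → Set.EqOn y' (y q) (cube m ρ') := by
  have h0 := zero_mem_cube (m := m) hr.le
  obtain ⟨hs₀, ht₀, hst₀, hW₀⟩ := (hG.mem_admissible_iff hr (hind 0 h0) q₀).1 hq₀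
  have hua := hG.u_ne_zero 0 h0 a
  have hub := hG.u_ne_zero 0 h0 b
  have hA0 := hG.diag_ne_zero 0 h0 a
  have hD0 := hG.diag_ne_zero 0 h0 b
  -- Obtained by inserting the prescribed solution into the two rows at `0` and solving for the
  -- off-diagonal entries.
  let k₁ : ℝ × ℝ → ℝ := fun q => Ω a a 0 * u a 0 * (1 - q.1) / (q.2 * u b 0) - Ω a b 0
  let k₂ : ℝ × ℝ → ℝ := fun q => Ω b b 0 * u b 0 * (1 - q.2) / (q.1 * u a 0) - Ω b a 0
  let B : (ℝ × ℝ) × (Fin m → ℝ) → ℝ := fun w => Ω a b w.2 + k₁ w.1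
  let C : (ℝ × ℝ) × (Fin m → ℝ) → ℝ := fun w => Ω b a w.2 + k₂ w.1
  let Δ : (ℝ × ℝ) × (Fin m → ℝ) → ℝ := fun w => Ω a a w.2 * Ω b b w.2 - B w * C w
  -- Cramer's rule for the right-hand side `-φ`, rewritten with `φ = -(Ω u)` on the diagonal.
  let P : (ℝ × ℝ) × (Fin m → ℝ) → ℝ :=
    fun w => Ω b b w.2 * (Ω a a w.2 * u a w.2 - B w * u b w.2) / Δ w
  let Q : (ℝ × ℝ) × (Fin m → ℝ) → ℝ :=
    fun w => Ω a a w.2 * (Ω b b w.2 * u b w.2 - C w * u a w.2) / Δ w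
  let U : Set (ℝ × ℝ) := {q | q.1 ≠ 0} ∩ {q | q.2 ≠ 0}
  have hU : IsOpen U := (isOpen_ne_fun continuous_fst continuous_const).inter
    (isOpen_ne_fun continuous_snd continuous_const)
  have hq₀U : q₀ ∈ U := ⟨hs₀, ht₀⟩
  let T : Set ((ℝ × ℝ) × (Fin m → ℝ)) := U ×ˢ cube m r
  have hlift : ∀ {F : Type} [NormedAddCommGroup F] [NormedSpace ℝ F] {f : (Fin m → ℝ) → F},
      SmoothOnCube r f → ContDiffOn ℝ ∞ (fun w : (ℝ × ℝ) × (Fin m → ℝ) => f w.2) T :=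
    fun hf => ContDiffOn.comp hf contDiffOn_snd fun w hw => hw.2
  have hq1 : ContDiffOn ℝ ∞ (fun w : (ℝ × ℝ) × (Fin m → ℝ) => w.1.1) T :=
    (contDiff_fst.comp contDiff_fst).contDiffOn
  have hq2 : ContDiffOn ℝ ∞ (fun w : (ℝ × ℝ) × (Fin m → ℝ) => w.1.2) T :=
    (contDiff_snd.comp contDiff_fst).contDiffOn
  have hB : ContDiffOn ℝ ∞ B T := by
    refine (hlift (hG.smooth_Ω a b)).add (ContDiffOn.sub (ContDiffOn.div
      (contDiffOn_const.mul (contDiffOn_const.sub hq1)) (hq2.mul contDiffOn_const) ?_)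
      contDiffOn_const)
    exact fun w hw => mul_ne_zero hw.1.2 hub
  have hC : ContDiffOn ℝ ∞ C T := by
    refine (hlift (hG.smooth_Ω b a)).add (ContDiffOn.sub (ContDiffOn.div
      (contDiffOn_const.mul (contDiffOn_const.sub hq2)) (hq1.mul contDiffOn_const) ?_)
      contDiffOn_const)
    exact fun w hw => mul_ne_zero hw.1.1 hua
  have hA := hlift (hG.smooth_Ω a a)
  have hD := hlift (hG.smooth_Ω b b)
  have hu1 := hlift (hG.smooth_u a)
  have hu2 := hlift (hG.smooth_u b)
  have hΔ : ContDiffOn ℝ ∞ Δ T := (hA.mul hD).sub (hB.mul hC)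
  have hPn := hD.mul ((hA.mul hu1).sub (hB.mul hu2))
  have hQn := hA.mul ((hD.mul hu2).sub (hC.mul hu1))
  have hBz : ∀ q : ℝ × ℝ, B (q, 0) = Ω a a 0 * u a 0 * (1 - q.1) / (q.2 * u b 0) :=
    fun q => by simp only [B, k₁]; ring
  have hCz : ∀ q : ℝ × ℝ, C (q, 0) = Ω b b 0 * u b 0 * (1 - q.2) / (q.1 * u a 0) :=
    fun q => by simp only [C, k₂]; ring
  have hval : ∀ q ∈ U, Δ (q, 0) ≠ 0 → P (q, 0) = q.1 * u a 0 ∧ Q (q, 0) = q.2 * u b 0 := by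
    rintro q ⟨hq1, hq2⟩ hΔ0
    have hq1 : q.1 ≠ 0 := hq1
    have hq2 : q.2 ≠ 0 := hq2
    have e1 : Ω a a 0 * (q.1 * u a 0) + B (q, 0) * (q.2 * u b 0) = Ω a a 0 * u a 0 := by
      rw [hBz]; field_simp; ring
    have e2 : C (q, 0) * (q.1 * u a 0) + Ω b b 0 * (q.2 * u b 0) = Ω b b 0 * u b 0 := by
      rw [hCz]; field_simp; ring
    constructor
    · refine (div_eq_iff hΔ0).2 ?_
      simp only [Δ]
      linear_combination B (q, 0) * e2 - Ω b b 0 * e1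
    · refine (div_eq_iff hΔ0).2 ?_
      simp only [Δ]
      linear_combination C (q, 0) * e1 - Ω a a 0 * e2
  -- The determinant at the origin has the factor `q₀.1 + q₀.2 - 1`: this is why the line `s + t =
  -- 1` is excluded.
  have hΔ₀ : Δ (q₀, 0) ≠ 0 := by
    have e : Δ (q₀, 0) = Ω a a 0 * Ω b b 0 * (q₀.1 + q₀.2 - 1) / (q₀.1 * q₀.2) := by
      simp only [Δ, hBz, hCz]
      field_simp
      ring
    rw [e]
    exact div_ne_zero (mul_ne_zero (mul_ne_zero hA0 hD0) (sub_ne_zero.2 hst₀))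
      (mul_ne_zero hs₀ ht₀)
  have hmem₀ : ((q₀, 0) : (ℝ × ℝ) × (Fin m → ℝ)) ∈ T := ⟨hq₀U, h0⟩
  have hPc : ContinuousWithinAt P T (q₀, 0) :=
    (hPn.continuousOn _ hmem₀).div (hΔ.continuousOn _ hmem₀) hΔ₀
  have hQc : ContinuousWithinAt Q T (q₀, 0) :=
    (hQn.continuousOn _ hmem₀).div (hΔ.continuousOn _ hmem₀) hΔ₀
  obtain ⟨hP₀, hQ₀⟩ := hval q₀ hq₀U hΔ₀
  have hev : ∀ᶠ w in 𝓝[T] (q₀, 0), (Δ w ≠ 0 ∧ P w ≠ 0 ∧ Q w ≠ 0) ∧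
      ∀ i, 1 + (κ a i w.2 * P w + κ b i w.2 * Q w) ≠ 0 := by
    refine ((hΔ.continuousOn _ hmem₀).eventually_ne hΔ₀).and ((hPc.eventually_ne ?_).and
      (hQc.eventually_ne ?_)) |>.and (Filter.eventually_all.2 fun i => ?_)
    · rw [hP₀]; exact mul_ne_zero hs₀ hua
    · rw [hQ₀]; exact mul_ne_zero ht₀ hub
    · have h1 := (hlift ((hG.datum a).smooth_κ i)).continuousOn _ hmem₀
      have h2 := (hlift ((hG.datum b).smooth_κ i)).continuousOn _ hmem₀
      refine (continuousWithinAt_const.add ((h1.mul hPc).add (h2.mul hQc))).eventually_ne ?_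
      change 1 + (κ a i 0 * P (q₀, 0) + κ b i 0 * Q (q₀, 0)) ≠ 0
      rw [hP₀, hQ₀]
      convert hW₀ i using 1
      ring
  -- A product neighbourhood of `(q₀, 0)` provides one cube size valid for all `q` in `V`.
  rw [nhdsWithin_prod_eq, hU.nhdsWithin_eq hq₀U] at hev
  obtain ⟨S₁, hS₁, S₂, hS₂, hS⟩ := Filter.mem_prod_iff.1 (Filter.inter_mem hev
    (Filter.prod_mem_prod (hU.mem_nhds hq₀U) self_mem_nhdsWithin))
  obtain ⟨V, hVS, hV, hqV⟩ := mem_nhds_iff.1 hS₁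
  obtain ⟨ρ, hρ, hρr, hρS⟩ := exists_cube_subset hr hS₂
  have hsub : V ×ˢ cube m ρ ⊆ S₁ ×ˢ S₂ := Set.prod_mono hVS hρS
  have hsubT : V ×ˢ cube m ρ ⊆ T := fun w hw => (hS (hsub hw)).2
  have hall : ∀ q ∈ V, ∀ ξ ∈ cube m ρ, (Δ (q, ξ) ≠ 0 ∧ P (q, ξ) ≠ 0 ∧ Q (q, ξ) ≠ 0) ∧
      ∀ i, 1 + (κ a i ξ * P (q, ξ) + κ b i ξ * Q (q, ξ)) ≠ 0 :=
    fun q hq ξ hξ => (hS (hsub (show (q, ξ) ∈ V ×ˢ cube m ρ from ⟨hq, hξ⟩))).1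
  have hΔV : ∀ w ∈ V ×ˢ cube m ρ, Δ w ≠ 0 := fun w hw => (hall w.1 hw.1 w.2 hw.2).1.1
  have hP : ContDiffOn ℝ ∞ P (V ×ˢ cube m ρ) :=
    (hPn.mono hsubT).div (hΔ.mono hsubT) hΔV
  have hQ : ContDiffOn ℝ ∞ Q (V ×ˢ cube m ρ) :=
    (hQn.mono hsubT).div (hΔ.mono hsubT) hΔV
  have h0ρ := zero_mem_cube (m := m) hρ.le
  refine ⟨V, hV, hqV, ρ, hρ, hρr, fun q => combination x z
    (pairCoeff a b (fun ξ => P (q, ξ)) fun ξ => Q (q, ξ)), ?_, fun q hq => ?_⟩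
  · simp only [combination_pairCoeff]
    exact ((hlift hG.conj.1).mono hsubT).add ((hP.smul ((hlift (hG.datum a).smooth_z).mono
      hsubT)).add (hQ.smul ((hlift (hG.datum b).smooth_z).mono hsubT)))
  have hqU : q ∈ U := (hsubT (show (q, (0 : Fin m → ℝ)) ∈ V ×ˢ cube m ρ from ⟨hq, h0ρ⟩)).1
  obtain ⟨hPq, hQq⟩ := hval q hqU (hall q hq 0 h0ρ).1.1
  have hpair : ∀ ξ : Fin m → ℝ, (q, ξ) ∈ V ×ˢ cube m ρ ↔ ξ ∈ cube m ρ := fun ξ => by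
    simp [hq]
  have hPs : SmoothOnCube ρ fun ξ => P (q, ξ) :=
    hP.comp (contDiffOn_const.prodMk contDiffOn_id) fun ξ hξ => (hpair ξ).2 hξ
  have hQs : SmoothOnCube ρ fun ξ => Q (q, ξ) :=
    hQ.comp (contDiffOn_const.prodMk contDiffOn_id) fun ξ hξ => (hpair ξ).2 hξ
  let K : ι → ι → ℝ := fun c d =>
    if c = a ∧ d = b then k₁ q else if c = b ∧ d = a then k₂ q else 0
  have hKab : K a b = k₁ q := by simp [K]
  have hKba : K b a = k₂ q := by simp [K, hab, hab.symm]
  have hKd : ∀ c, K c c = 0 := by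
    intro c
    have h1 : ¬(c = a ∧ c = b) := fun h => hab (h.1.symm.trans h.2)
    have h2 : ¬(c = b ∧ c = a) := fun h => hab (h.2.symm.trans h.1)
    simp [K, h1, h2]
  have hGρ := (hG.mono hr hρ hρr).shift hρ K hKd
  have hrowa : ∀ ξ ∈ cube m ρ, (Ω a a ξ + K a a) * P (q, ξ) + (Ω a b ξ + K a b) * Q (q, ξ)
      = -φ a ξ := by
    intro ξ hξ
    have hd := (hall q hq ξ hξ).1.1
    rw [hKab, hKd, add_zero, hG.φ_eq ξ (cube_mono hρr hξ), neg_neg]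
    change Ω a a ξ * (_ / Δ (q, ξ)) + B (q, ξ) * (_ / Δ (q, ξ)) = _
    rw [mul_div_assoc', mul_div_assoc', ← add_div, div_eq_iff hd]
    simp only [Δ]
    ring
  have hrowb : ∀ ξ ∈ cube m ρ, (Ω b a ξ + K b a) * P (q, ξ) + (Ω b b ξ + K b b) * Q (q, ξ)
      = -φ b ξ := by
    intro ξ hξ
    have hd := (hall q hq ξ hξ).1.1
    rw [hKba, hKd, add_zero, hG.φ_eq ξ (cube_mono hρr hξ), neg_neg]
    change C (q, ξ) * (_ / Δ (q, ξ)) + Ω b b ξ * (_ / Δ (q, ξ)) = _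
    rw [mul_div_assoc', mul_div_assoc', ← add_div, div_eq_iff hd]
    simp only [Δ]
    ring
  have hdet : ∀ ξ ∈ cube m ρ, (Ω a a ξ + K a a) * (Ω b b ξ + K b b) -
      (Ω a b ξ + K a b) * (Ω b a ξ + K b a) ≠ 0 := by
    intro ξ hξ
    rw [hKab, hKba, hKd, hKd, add_zero, add_zero]
    exact (hall q hq ξ hξ).1.1
  refine ⟨?_, hGρ.isCoplanarCommonTransform_pair hρ hab (isTransformCoeff_pair hab hPs hQs
    hrowa hrowb hdet fun ξ hξ => (hall q hq ξ hξ).2) (fun ξ hξ => (hall q hq ξ hξ).1.2.1)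
    (fun ξ hξ => (hall q hq ξ hξ).1.2.2), ?_⟩
  · beta_reduce
    rw [combination_pairCoeff, planePoint, hG.eq_add 0 h0, hG.eq_add 0 h0, hPq, hQq]
    module
  · intro ρ' y' hρ' hρ'ρ hy' hy'0
    have hG' := hGρ.mono hρ hρ' hρ'ρ
    have hind' : ∀ ξ ∈ cube m ρ', ∀ i,
        LinearIndependent ℝ ![pderiv ρ' i x ξ, z a ξ, z b ξ] := fun ξ hξ i => by
      rw [pderiv_of_le hρ' (hρ'ρ.trans hρr) hG.conj.1 hξ]
      exact hind ξ (cube_mono (hρ'ρ.trans hρr) hξ) i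
    obtain ⟨p', q', hp', hq', hpq⟩ := hG'.exists_pair_coeff hm hind' hy'.1.2.1.1 hy'.2.2
    have hsubc := cube_mono (m := m) hρ'ρ
    have h0' := zero_mem_cube (m := m) hρ'.le
    have hz0 := hpq 0 h0'
    rw [hy'0, planePoint, hG.eq_add 0 h0, hG.eq_add 0 h0] at hz0
    -- The common value at `0` forces equal coefficients there, which is the initial condition for
    -- `pair_unique`.
    obtain ⟨-, h1, h2⟩ := coeff_eq_zero_of_triple (hind 0 h0 ⟨0, hm⟩) (p := 0)
      (q := p' 0 - q.1 * u a 0) (s := q' 0 - q.2 * u b 0)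
      (by linear_combination (norm := module) -hz0)
    intro ξ hξ
    obtain ⟨e1, e2⟩ := hG'.pair_unique hρ' hind' (fun ξ hξ => hrowa ξ (hsubc hξ))
      (fun ξ hξ => hrowb ξ (hsubc hξ)) (fun ξ hξ => hdet ξ (hsubc hξ))
      (fun ξ hξ => (hall q hq ξ (hsubc hξ)).1.2.1) (fun ξ hξ => (hall q hq ξ (hsubc hξ)).1.2.2)
      hp' hq' hpq hy'.1 hy'.2.1 (by rw [hPq]; exact sub_eq_zero.1 h1)
      (by rw [hQq]; exact sub_eq_zero.1 h2) hξ
    beta_reduce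
    rw [hpq ξ hξ, combination_pairCoeff, e1, e2]

end TwoTransforms

theorem exists_permutability_family {m N : ℕ} (hm : 0 < m) {r : ℝ} (hr : 0 < r)
    {x x₁ x₂ : Net m N} (h₁ : IsJonasPair r x x₁) (h₂ : IsJonasPair r x x₂)
    (hg : GenericPair r x x₁ x₂) :
    IsOpen (admissible r x x₁ x₂) ∧ Dense (admissible r x x₁ x₂) ∧
    ∀ q₀ ∈ admissible r x x₁ x₂, ∃ V : Set (ℝ × ℝ), IsOpen V ∧ q₀ ∈ V ∧
      ∃ ρ : ℝ, 0 < ρ ∧ ρ ≤ r ∧ ∃ y : ℝ × ℝ → Net m N,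
        ContDiffOn ℝ ∞ (fun w : (ℝ × ℝ) × (Fin m → ℝ) => y w.1 w.2) (V ×ˢ cube m ρ) ∧
        ∀ q ∈ V, y q 0 = planePoint x x₁ x₂ q ∧ IsCoplanarCommonTransform ρ x x₁ x₂ (y q) ∧
          ∀ (ρ' : ℝ) (y' : Net m N), 0 < ρ' → ρ' ≤ ρ →
            IsCoplanarCommonTransform ρ' x x₁ x₂ y' →
            y' 0 = planePoint x x₁ x₂ q → Set.EqOn y' (y q) (cube m ρ') := by
  have hJ : ∀ a, IsJonasPair r x ((![x₁, x₂] : Fin 2 → Net m N) a) := by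
    intro a
    fin_cases a
    exacts [h₁, h₂]
  obtain ⟨ρ, hρ, hρr, z, κ, φ, u, Ω, hG, hind⟩ := exists_generatingSystem_of_genericPair hr hJ
    (fun a b hab => by
      fin_cases a <;> fin_cases b
      exacts [absurd rfl hab, hg, hg.symm, absurd rfl hab])
  have hind' := fun ξ hξ i => hind ξ hξ 0 1 (by decide) i
  rw [admissible_of_le hρ hρr h₁.1.1 h₁.2.1.1 h₂.2.1.1]
  obtain ⟨ho, hd⟩ := hG.isOpen_admissible_and_dense hρ
    (hind' 0 (zero_mem_cube hρ.le))
  refine ⟨ho, hd, fun q₀ hq₀ => ?_⟩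
  obtain ⟨V, hV, hqV, ρ', hρ', hρ'ρ, h⟩ := hG.exists_family hm hρ (by decide) hind' hq₀
  exact ⟨V, hV, hqV, ρ', hρ', hρ'ρ.trans hρr, h⟩

/-- Computing `∂_k y` through `x₁` and through `x₂` puts `y - x` in the span of `∂_k x`, `x₁ - x`,
`x₂ - x`. Doing this for `k = i` and `k = j` and using the four independent vectors removes the
tangent component. -/
theorem coplanar_of_common_transform {m N : ℕ} {r : ℝ} {x x₁ x₂ y : Net m N}
    (h₁ : IsJonasPair r x x₁) (h₂ : IsJonasPair r x x₂) (h₁y : IsJonasPair r x₁ y)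
    (h₂y : IsJonasPair r x₂ y) {ξ : Fin m → ℝ} (hξ : ξ ∈ cube m r) {i j : Fin m}
    (hind : LinearIndependent ℝ ![pd r i x ξ, pd r j x ξ, x₁ ξ - x ξ, x₂ ξ - x ξ])
    (hi : LinearIndependent ℝ ![pd r i x₁ ξ, pd r i x₂ ξ, x₁ ξ - x₂ ξ])
    (hj : LinearIndependent ℝ ![pd r j x₁ ξ, pd r j x₂ ξ, x₁ ξ - x₂ ξ])
    (hyi : pd r i y ξ ≠ 0) (hyj : pd r j y ξ ≠ 0) : Coplanar ℝ {x ξ, x₁ ξ, x₂ ξ, y ξ} := by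
  have key : ∀ k, LinearIndependent ℝ ![pd r k x₁ ξ, pd r k x₂ ξ, x₁ ξ - x₂ ξ] →
      pd r k y ξ ≠ 0 → ∃ α s t : ℝ,
        y ξ - x ξ = α • pd r k x ξ + s • (x₁ ξ - x ξ) + t • (x₂ ξ - x ξ) := by
    intro k hk hyk
    obtain ⟨b₁, e₁, hb₁⟩ := h₁.2.2 ξ hξ k
    obtain ⟨b₂, e₂, hb₂⟩ := h₂.2.2 ξ hξ k
    obtain ⟨c₁, μ₁, hc₁⟩ := h₁y.2.2 ξ hξ k
    obtain ⟨c₂, μ₂, hc₂⟩ := h₂y.2.2 ξ hξ k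
    -- If `μ₁ = μ₂`, independence of `∂_k x₁`, `∂_k x₂`, `x₁ - x₂` gives `c₁ = -1` and `μ₁ = 0`, so
    -- `∂_k y = 0`.
    have hne : μ₁ - μ₂ ≠ 0 := by
      intro hμ
      have hμ' : μ₂ = μ₁ := (sub_eq_zero.1 hμ).symm
      subst hμ'
      obtain ⟨h1, -, h3⟩ := coeff_eq_zero_of_triple hk (p := 1 + c₁) (q := -(1 + c₂))
        (s := -μ₂) (by linear_combination (norm := module) hc₂ - hc₁)
      apply hyk
      have h3 : μ₂ = 0 := neg_eq_zero.1 h3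
      rw [h3] at hc₁
      have h1 : c₁ = -1 := by linarith
      rw [h1] at hc₁
      linear_combination (norm := module) hc₁
    have hx₁ : pd r k x₁ ξ = (1 + b₁) • pd r k x ξ + e₁ • (x₁ ξ - x ξ) := by
      linear_combination (norm := module) hb₁
    have hx₂ : pd r k x₂ ξ = (1 + b₂) • pd r k x ξ + e₂ • (x₂ ξ - x ξ) := by
      linear_combination (norm := module) hb₂
    rw [hx₁] at hc₁
    rw [hx₂] at hc₂
    have hfin : (μ₁ - μ₂) • (y ξ - x ξ) =
        ((1 + c₂) * (1 + b₂) - (1 + c₁) * (1 + b₁)) • pd r k x ξ +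
        (μ₁ - (1 + c₁) * e₁) • (x₁ ξ - x ξ) + ((1 + c₂) * e₂ - μ₂) • (x₂ ξ - x ξ) := by
      linear_combination (norm := module) hc₂ - hc₁
    refine ⟨(μ₁ - μ₂)⁻¹ * ((1 + c₂) * (1 + b₂) - (1 + c₁) * (1 + b₁)),
      (μ₁ - μ₂)⁻¹ * (μ₁ - (1 + c₁) * e₁), (μ₁ - μ₂)⁻¹ * ((1 + c₂) * e₂ - μ₂), ?_⟩
    rw [mul_smul, mul_smul, mul_smul, ← smul_add, ← smul_add, ← hfin, inv_smul_smul₀ hne]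
  obtain ⟨α, s, t, hα⟩ := key i hi hyi
  obtain ⟨β, s', t', hβ⟩ := key j hj hyj
  obtain ⟨h1, -⟩ := coeff_eq_zero_of_quadruple hind (p := α) (q := -β) (s := s - s')
    (t := t - t') (by linear_combination (norm := module) hβ - hα)
  rw [h1, zero_smul, zero_add] at hα
  exact coplanar_of_eq (s := s) (t := t) (by rw [add_assoc, ← hα, add_sub_cancel])


/-! ### Potentials adapted to given pairwise common transforms. -/

section ThreeTransforms

variable {m N : ℕ} {r : ℝ} {ι : Type*} [Fintype ι] [DecidableEq ι]

/-- A generating system of transforms `X a` of `x`, together with the transforms `Y a b` which it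
defines by pairs of indices; `τ a b` is the coefficient of `z a` in `Y a b`. -/
structure PairwiseSystem (r : ℝ) (x : Net m N) (X : ι → Net m N) (Y : ι → ι → Net m N)
    (z : ι → Net m N) (κ : ι → Fin m → (Fin m → ℝ) → ℝ) (φ u : ι → (Fin m → ℝ) → ℝ)
    (Ω τ : ι → ι → (Fin m → ℝ) → ℝ) : Prop extends GeneratingSystem r x X z κ φ u Ω where
  τ_ne_zero : ∀ ξ ∈ cube m r, ∀ a b, a ≠ b → τ a b ξ ≠ 0
  row : ∀ ξ ∈ cube m r, ∀ a b, a ≠ b → Ω a a ξ * τ a b ξ + Ω a b ξ * τ b a ξ = -φ a ξ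
  Y_eq : ∀ ξ ∈ cube m r, ∀ a b, a ≠ b → Y a b ξ = x ξ + (τ a b ξ • z a ξ + τ b a ξ • z b ξ)
  coeff : ∀ a b, a ≠ b → IsTransformCoeff r κ φ Ω {a, b} (pairCoeff a b (τ a b) (τ b a))
  ind : ∀ ξ ∈ cube m r, LinearIndependent ℝ fun a => z a ξ

/-- The coefficients `τ` are read off from the given nets. Each ordered pair `(a, b)` has one row
equation and one free constant, that of `Ω a b`: the constant makes the equation true at `0`, and
the defect equation propagates it. -/
theorem exists_pairwiseSystem [Nontrivial ι] (hm : 0 < m) (hr : 0 < r) {x : Net m N}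
    {X : ι → Net m N} {Y : ι → ι → Net m N} (hJ : ∀ a, IsJonasPair r x (X a))
    (hsymm : ∀ a b, Y a b = Y b a)
    (hY : ∀ a b, a ≠ b → IsCoplanarCommonTransform r x (X a) (X b) (Y a b))
    (hg : ∀ a b, a ≠ b → GenericPair r x (X a) (X b))
    (hd : LinearIndependent ℝ fun a => X a 0 - x 0)
    (hgen : ∀ a b, a ≠ b → IsGenericFourthPoint r x (X a) (X b) (Y a b 0)) :
    ∃ ρ, 0 < ρ ∧ ρ ≤ r ∧ ∃ z κ φ u Ω τ, PairwiseSystem ρ x X Y z κ φ u Ω τ := by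
  obtain ⟨ρ, hρ, hρr, z, κ, φ, u, Ω₀, hG₀, hind⟩ :=
    exists_generatingSystem_of_genericPair hr hJ hg
  have h0 := zero_mem_cube (m := m) hρ.le
  have hu0 := hG₀.u_ne_zero 0 h0
  have hz0 : LinearIndependent ℝ fun a => z a 0 := by
    rw [Fintype.linearIndependent_iff] at hd ⊢
    intro c hc a
    have := hd (fun a => c a / u a 0) (by
      rw [← hc]
      refine Finset.sum_congr rfl fun a _ => ?_
      rw [hG₀.eq_add 0 h0, add_sub_cancel_left, smul_smul, div_mul_cancel₀ _ (hu0 a)]) a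
    exact (div_eq_zero_iff.1 this).resolve_right (hu0 a)
  have hex : ∀ a b, ∃ p q : (Fin m → ℝ) → ℝ, a ≠ b → SmoothOnCube ρ p ∧ SmoothOnCube ρ q ∧
      ∀ ξ ∈ cube m ρ, Y a b ξ = x ξ + (p ξ • z a ξ + q ξ • z b ξ) := by
    intro a b
    by_cases hab : a = b
    · exact ⟨0, 0, fun h => absurd hab h⟩
    · have hYρ := (hY a b hab).mono hr hρ hρr
      obtain ⟨p, q, h⟩ := hG₀.exists_pair_coeff hm (fun ξ hξ i => hind ξ hξ a b hab i)
        hYρ.1.2.1.1 hYρ.2.2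
      exact ⟨p, q, fun _ => h⟩
  choose τ τ' hτ using hex
  have hττ' : ∀ a b, a ≠ b → ∀ ξ ∈ cube m ρ, τ' a b ξ = τ b a ξ := by
    intro a b hab ξ hξ
    have h1 := (hτ a b hab).2.2 ξ hξ
    rw [hsymm, (hτ b a hab.symm).2.2 ξ hξ] at h1
    have := coeff_eq_zero_of_triple (hind ξ hξ a b hab ⟨0, hm⟩) (p := 0)
      (q := τ' b a ξ - τ a b ξ) (s := τ b a ξ - τ' a b ξ)
      (by linear_combination (norm := module) h1)
    exact (sub_eq_zero.1 this.2.2).symm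
  have hτs : ∀ a b, a ≠ b → SmoothOnCube ρ (τ a b) := fun a b hab => (hτ a b hab).1
  have hYeq : ∀ ξ ∈ cube m ρ, ∀ a b, a ≠ b →
      Y a b ξ = x ξ + (τ a b ξ • z a ξ + τ b a ξ • z b ξ) := by
    intro ξ hξ a b hab
    rw [(hτ a b hab).2.2 ξ hξ, hττ' a b hab ξ hξ]
  have hst : ∀ a b, a ≠ b → ∃ s t : ℝ, τ a b 0 = s * u a 0 ∧ τ b a 0 = t * u b 0 ∧ s ≠ 0 ∧
      t ≠ 0 ∧ s + t ≠ 1 ∧ ∀ i, 1 + (κ a i 0 * τ a b 0 + κ b i 0 * τ b a 0) ≠ 0 := by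
    intro a b hab
    obtain ⟨q, hq, hYq⟩ := hgen a b hab
    rw [admissible_of_le hρ hρr (hJ a).1.1 (hJ a).2.1.1 (hJ b).2.1.1,
      hG₀.mem_admissible_iff hρ (fun i => hind 0 h0 a b hab i)] at hq
    obtain ⟨hs, ht, hst, hW⟩ := hq
    rw [hYeq 0 h0 a b hab, planePoint, hG₀.eq_add 0 h0, hG₀.eq_add 0 h0] at hYq
    obtain ⟨-, h1, h2⟩ := coeff_eq_zero_of_triple (hind 0 h0 a b hab ⟨0, hm⟩) (p := 0)
      (q := τ a b 0 - q.1 * u a 0) (s := τ b a 0 - q.2 * u b 0)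
      (by linear_combination (norm := module) hYq)
    have h1 := sub_eq_zero.1 h1
    have h2 := sub_eq_zero.1 h2
    refine ⟨q.1, q.2, h1, h2, hs, ht, hst, fun i => ?_⟩
    rw [h1, h2]
    convert hW i using 1
    ring
  have hτ0 : ∀ a b, a ≠ b → τ a b 0 ≠ 0 := by
    intro a b hab
    obtain ⟨s, t, h1, -, hs, -⟩ := hst a b hab
    rw [h1]
    exact mul_ne_zero hs (hu0 a)
  -- The off-diagonal constant solves row `a` at the origin for `Ω a b 0`; division is allowed since
  -- `τ b a 0 ≠ 0`.
  let C : ι → ι → ℝ := fun a b =>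
    if a = b then 0 else (-φ a 0 - Ω₀ a a 0 * τ a b 0) / τ b a 0 - Ω₀ a b 0
  have hG₁ := hG₀.shift hρ C fun a => if_pos rfl
  set Ω : ι → ι → (Fin m → ℝ) → ℝ := fun a b ξ => Ω₀ a b ξ + C a b with hΩ
  have hF0 : ∀ a b, a ≠ b → Ω a a 0 * τ a b 0 + Ω a b 0 * τ b a 0 + φ a 0 = 0 := by
    intro a b hab
    have := hτ0 b a hab.symm
    simp only [hΩ, C, if_neg hab, if_true]
    field_simp
    ring
  have hdet0 : ∀ a b, a ≠ b → Ω a a 0 * Ω b b 0 - Ω a b 0 * Ω b a 0 ≠ 0 := by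
    intro a b hab hdet
    obtain ⟨s, t, h1, h2, hs, ht, hst, -⟩ := hst a b hab
    have ha := hG₁.φ_eq 0 h0 a
    have hb := hG₁.φ_eq 0 h0 b
    have e1 := hF0 a b hab
    have e2 := hF0 b a hab.symm
    -- A vanishing `2 × 2` determinant would put the fourth point on the line `s + t = 1`.
    have key : Ω a a 0 * Ω b b 0 * (u a 0 * u b 0) * (s + t - 1) = 0 := by
      rw [ha, h1, h2] at e1
      rw [hb, h1, h2] at e2
      linear_combination (s * t * u a 0 * u b 0) * hdet + (Ω b a 0 * s * u a 0) * e1 -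
        (Ω a a 0 * u a 0 * (s - 1)) * e2
    refine mul_ne_zero (mul_ne_zero (mul_ne_zero (hG₁.diag_ne_zero 0 h0 a)
      (hG₁.diag_ne_zero 0 h0 b)) (mul_ne_zero (hu0 a) (hu0 b))) (sub_ne_zero.2 hst) key
  have ev1 : ∀ᶠ ξ in 𝓝[cube m ρ] 0, ∀ a b, a ≠ b → τ a b ξ ≠ 0 := by
    simp only [Filter.eventually_all]
    exact fun a b hab => (hτs a b hab).eventually_ne hρ.le (hτ0 a b hab)
  have ev2 : ∀ᶠ ξ in 𝓝[cube m ρ] 0, ∀ a b, a ≠ b →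
      Ω a a ξ * Ω b b ξ - Ω a b ξ * Ω b a ξ ≠ 0 := by
    simp only [Filter.eventually_all]
    exact fun a b hab => SmoothOnCube.eventually_ne hρ.le
      (((hG₁.smooth_Ω a a).mul (hG₁.smooth_Ω b b)).sub
        ((hG₁.smooth_Ω a b).mul (hG₁.smooth_Ω b a))) (hdet0 a b hab)
  have ev3 : ∀ᶠ ξ in 𝓝[cube m ρ] 0, ∀ a b, a ≠ b → ∀ i,
      1 + (κ a i ξ * τ a b ξ + κ b i ξ * τ b a ξ) ≠ 0 := by
    simp only [Filter.eventually_all]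
    intro a b hab i
    obtain ⟨s, t, -, -, -, -, -, hW⟩ := hst a b hab
    exact SmoothOnCube.eventually_ne hρ.le ((SmoothOnCube.const 1).add
      ((((hG₁.datum a).smooth_κ i).mul (hτs a b hab)).add
      (((hG₁.datum b).smooth_κ i).mul (hτs b a hab.symm)))) (hW i)
  have ev4 : ∀ᶠ ξ in 𝓝[cube m ρ] 0, LinearIndependent ℝ fun a => z a ξ := by
    have hc : ContinuousWithinAt (fun ξ a => z a ξ) (cube m ρ) 0 :=
      continuousWithinAt_pi.2 fun a => (hG₁.datum a).smooth_z.continuousOn 0 h0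
    exact hc.eventually (isOpen_setOfPred_linearIndependent.mem_nhds hz0)
  obtain ⟨ρ', hρ', hρ'ρ, hall⟩ :=
    exists_cube_of_eventually hρ (ev1.and (ev2.and (ev3.and ev4)))
  have hG := hG₁.mono hρ hρ' hρ'ρ
  have hsub := cube_mono (m := m) hρ'ρ
  have h0' := zero_mem_cube (m := m) hρ'.le
  have hrow : ∀ ξ ∈ cube m ρ', ∀ a b, a ≠ b →
      Ω a a ξ * τ a b ξ + Ω a b ξ * τ b a ξ = -φ a ξ := by
    intro ξ hξ a b hab
    exact eq_neg_of_add_eq_zero_left (hG.defect_eq_zero hρ' (fun η hη i => by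
        rw [pderiv_of_le hρ' hρ'ρ hG₁.conj.1 hη]
        exact hind η (hsub hη) a b hab i)
      ((hτs a b hab).mono hρ'ρ) ((hτs b a hab.symm).mono hρ'ρ)
      (fun η hη => hYeq η (hsub hη) a b hab)
      ((hY a b hab).1.mono hr hρ' (hρ'ρ.trans hρr)) convex_cube subset_rfl
      (fun η hη => (hall η hη).1 b a hab.symm) h0' (hF0 a b hab) hξ)
  refine ⟨ρ', hρ', hρ'ρ.trans hρr, z, κ, φ, u, Ω, τ, hG, fun ξ hξ => (hall ξ hξ).1, hrow,
    fun ξ hξ => hYeq ξ (hsub hξ), fun a b hab => ?_, fun ξ hξ => (hall ξ hξ).2.2.2⟩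
  exact isTransformCoeff_pair hab ((hτs a b hab).mono hρ'ρ) ((hτs b a hab.symm).mono hρ'ρ)
    (fun ξ hξ => hrow ξ hξ a b hab)
    (fun ξ hξ => by rw [add_comm]; exact hrow ξ hξ b a hab.symm)
    (fun ξ hξ => (hall ξ hξ).2.1 a b hab) (fun ξ hξ => (hall ξ hξ).2.2.1 a b hab)

end ThreeTransforms

/-! ### The eighth net from the full `3 × 3` system. -/

section ThreeTransforms

variable {m N : ℕ} {r : ℝ}

/-- The coefficients of `zB` and `zC` determine the two factors; the coefficient of `zA` then agrees
because all vectors involved satisfy the same row equation and `wA ≠ 0`. -/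
theorem eq_combination_of_row_eq_zero {V : Type*} [AddCommGroup V] [Module ℝ V]
    {x zA zB zC : V} {wA wB wC u f p₁ q₁ p₂ q₂ vA vB vC : ℝ} (hw : wA ≠ 0) (hq₁ : q₁ ≠ 0)
    (hq₂ : q₂ ≠ 0) (hu : wA * u = -f) (h₁ : wA * p₁ + wB * q₁ = -f)
    (h₂ : wA * p₂ + wC * q₂ = -f) (hv : wA * vA + wB * vB + wC * vC = 0) :
    vA • zA + vB • zB + vC • zC =
      (vB / q₁) • ((x + (p₁ • zA + q₁ • zB)) - (x + u • zA)) +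
      (vC / q₂) • ((x + (p₂ • zA + q₂ • zC)) - (x + u • zA)) := by
  obtain ⟨β, hβ⟩ : ∃ β, β = vB / q₁ := ⟨_, rfl⟩
  obtain ⟨γ, hγ⟩ : ∃ γ, γ = vC / q₂ := ⟨_, rfl⟩
  rw [← hβ, ← hγ]
  have hB : vB = β * q₁ := by rw [hβ, div_mul_cancel₀ _ hq₁]
  have hC : vC = γ * q₂ := by rw [hγ, div_mul_cancel₀ _ hq₂]
  have hA : vA = β * (p₁ - u) + γ * (p₂ - u) := by
    refine mul_left_cancel₀ hw ?_
    rw [hB, hC] at hv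
    linear_combination hv - β * h₁ - γ * h₂ + (β + γ) * hu
  rw [hA, hB, hC]
  module

theorem sum_fin_three {M : Type*} [AddCommMonoid M] (f : Fin 3 → M) {a b c : Fin 3}
    (hab : a ≠ b) (hac : a ≠ c) (hbc : b ≠ c) : ∑ d, f d = f a + f b + f c := by
  have h : (Finset.univ : Finset (Fin 3)) = {a, b, c} := by
    revert a b c
    decide
  rw [h, Finset.sum_insert (by simp [hab, hac]), Finset.sum_pair hbc, add_assoc]

theorem IsTransformCoeff.mono {ι : Type*} [Fintype ι] {ρ : ℝ} (h : ρ ≤ r)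
    {κ : ι → Fin m → (Fin m → ℝ) → ℝ} {φ : ι → (Fin m → ℝ) → ℝ}
    {Ω : ι → ι → (Fin m → ℝ) → ℝ} {I : Finset ι} {σ : ι → (Fin m → ℝ) → ℝ}
    (hσ : IsTransformCoeff r κ φ Ω I σ) : IsTransformCoeff ρ κ φ Ω I σ where
  smooth a := (hσ.smooth a).mono h
  supp ξ hξ := hσ.supp ξ (cube_mono h hξ)
  row ξ hξ := hσ.row ξ (cube_mono h hξ)
  nondeg ξ hξ := hσ.nondeg ξ (cube_mono h hξ)
  weight_ne_zero ξ hξ := hσ.weight_ne_zero ξ (cube_mono h hξ)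

variable {x : Net m N} {X : Fin 3 → Net m N} {Y : Fin 3 → Fin 3 → Net m N} {z : Fin 3 → Net m N}
  {κ : Fin 3 → Fin m → (Fin m → ℝ) → ℝ} {φ u : Fin 3 → (Fin m → ℝ) → ℝ}
  {Ω τ : Fin 3 → Fin 3 → (Fin m → ℝ) → ℝ}

theorem PairwiseSystem.mono (hr : 0 < r) {ρ : ℝ} (hρ : 0 < ρ) (h : ρ ≤ r)
    (H : PairwiseSystem r x X Y z κ φ u Ω τ) : PairwiseSystem ρ x X Y z κ φ u Ω τ where
  toGeneratingSystem := H.toGeneratingSystem.mono hr hρ h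
  τ_ne_zero ξ hξ := H.τ_ne_zero ξ (cube_mono h hξ)
  row ξ hξ := H.row ξ (cube_mono h hξ)
  Y_eq ξ hξ := H.Y_eq ξ (cube_mono h hξ)
  coeff a b hab := (H.coeff a b hab).mono h
  ind ξ hξ := H.ind ξ (cube_mono h hξ)

theorem PairwiseSystem.eqOn_pair (H : PairwiseSystem r x X Y z κ φ u Ω τ) {a b : Fin 3}
    (hab : a ≠ b) :
    Set.EqOn (combination x z (pairCoeff a b (τ a b) (τ b a))) (Y a b) (cube m r) :=
  fun ξ hξ => by rw [combination_pairCoeff, H.Y_eq ξ hξ a b hab]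

/-- The kernel of the `a`-th row of `Ω` is the direction of the plane of `X a`, `Y a b`, `Y a c`. -/
theorem PairwiseSystem.sum_eq_of_row_eq_zero (H : PairwiseSystem r x X Y z κ φ u Ω τ)
    {a b c : Fin 3} (hab : a ≠ b) (hac : a ≠ c) (hbc : b ≠ c) {ξ : Fin m → ℝ}
    (hξ : ξ ∈ cube m r) {v : Fin 3 → ℝ} (hv : ∑ d, Ω a d ξ * v d = 0) :
    ∑ d, v d • z d ξ = (v b / τ b a ξ) • (Y a b ξ - X a ξ) +
      (v c / τ c a ξ) • (Y a c ξ - X a ξ) := by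
  rw [sum_fin_three _ hab hac hbc] at hv ⊢
  rw [H.Y_eq ξ hξ a b hab, H.Y_eq ξ hξ a c hac, H.eq_add ξ hξ a]
  exact eq_combination_of_row_eq_zero (H.diag_ne_zero ξ hξ a) (H.τ_ne_zero ξ hξ b a hab.symm)
    (H.τ_ne_zero ξ hξ c a hac.symm) (by rw [H.φ_eq ξ hξ a, neg_neg]) (H.row ξ hξ a b hab)
    (H.row ξ hξ a c hac) hv

/-- Subtracting the particular solution `u a` at index `a`, which represents `X a`, reduces to the
homogeneous row. -/
theorem PairwiseSystem.eq_of_row_eq (H : PairwiseSystem r x X Y z κ φ u Ω τ)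
    {a b c : Fin 3} (hab : a ≠ b) (hac : a ≠ c) (hbc : b ≠ c) {ξ : Fin m → ℝ}
    (hξ : ξ ∈ cube m r) {v : Fin 3 → ℝ} (hv : ∑ d, Ω a d ξ * v d = -φ a ξ) :
    x ξ + ∑ d, v d • z d ξ = X a ξ + (v b / τ b a ξ) • (Y a b ξ - X a ξ) +
      (v c / τ c a ξ) • (Y a c ξ - X a ξ) := by
  have h := H.sum_eq_of_row_eq_zero hab hac hbc hξ
    (v := fun d => v d - if d = a then u a ξ else 0) (by
      simp only [mul_sub, Finset.sum_sub_distrib, hv, mul_ite, mul_zero, Finset.sum_ite_eq',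
        Finset.mem_univ, if_true]
      rw [H.φ_eq ξ hξ a]
      ring)
  simp only [hab.symm, hac.symm, if_false, sub_zero] at h
  rw [add_assoc, ← h, H.eq_add ξ hξ a]
  simp only [sub_smul, Finset.sum_sub_distrib, ite_smul, zero_smul, Finset.sum_ite_eq',
    Finset.mem_univ, if_true]
  abel

/-- `X a`, `Y a b` and `Y a c` all have coefficient vectors solving row `a`, so every affine
combination of them does too. -/
theorem PairwiseSystem.exists_row_eq (H : PairwiseSystem r x X Y z κ φ u Ω τ)
    {a b c : Fin 3} (hab : a ≠ b) (hac : a ≠ c) (hbc : b ≠ c) {ξ : Fin m → ℝ}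
    (hξ : ξ ∈ cube m r) (s t : ℝ) : ∃ v : Fin 3 → ℝ,
      v a = u a ξ + s * (τ a b ξ - u a ξ) + t * (τ a c ξ - u a ξ) ∧ v b = s * τ b a ξ ∧
      v c = t * τ c a ξ ∧ ∑ d, Ω a d ξ * v d = -φ a ξ ∧
      X a ξ + s • (Y a b ξ - X a ξ) + t • (Y a c ξ - X a ξ) = x ξ + ∑ d, v d • z d ξ := by
  let v : Fin 3 → ℝ := fun d =>
    if d = a then u a ξ + s * (τ a b ξ - u a ξ) + t * (τ a c ξ - u a ξ)
    else if d = b then s * τ b a ξ else t * τ c a ξ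
  have ha : v a = u a ξ + s * (τ a b ξ - u a ξ) + t * (τ a c ξ - u a ξ) := if_pos rfl
  have hb : v b = s * τ b a ξ := by simp [v, hab.symm]
  have hc : v c = t * τ c a ξ := by simp [v, hac.symm, hbc.symm]
  refine ⟨v, ha, hb, hc, ?_, ?_⟩
  · rw [sum_fin_three _ hab hac hbc, ha, hb, hc]
    have h := H.φ_eq ξ hξ a
    linear_combination s * H.row ξ hξ a b hab + t * H.row ξ hξ a c hac + (1 - s - t) * h
  · rw [sum_fin_three _ hab hac hbc, ha, hb, hc, H.Y_eq ξ hξ a b hab, H.Y_eq ξ hξ a c hac,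
      H.eq_add ξ hξ a]
    module

theorem PairwiseSystem.eq_of_sum_eq (H : PairwiseSystem r x X Y z κ φ u Ω τ) {ξ : Fin m → ℝ}
    (hξ : ξ ∈ cube m r) {v w : Fin 3 → ℝ} (h : ∑ d, v d • z d ξ = ∑ d, w d • z d ξ) : v = w := by
  funext d
  refine sub_eq_zero.1 (Fintype.linearIndependent_iff.1 (H.ind ξ hξ) (fun d => v d - w d) ?_ d)
  simp only [sub_smul, Finset.sum_sub_distrib, h, sub_self]

theorem PairwiseSystem.linearIndependent_edges (H : PairwiseSystem r x X Y z κ φ u Ω τ)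
    {a b c : Fin 3} (hab : a ≠ b) (hac : a ≠ c) (hbc : b ≠ c) {ξ : Fin m → ℝ}
    (hξ : ξ ∈ cube m r) : LinearIndependent ℝ ![Y a b ξ - X a ξ, Y a c ξ - X a ξ] := by
  rw [LinearIndependent.pair_iff]
  intro s t hst
  obtain ⟨v, -, hb, hc, -, hv⟩ := H.exists_row_eq hab hac hbc hξ s t
  obtain ⟨w, -, hb', hc', -, hw⟩ := H.exists_row_eq hab hac hbc hξ 0 0
  rw [add_assoc, hst, add_zero] at hv
  rw [zero_smul, zero_smul, add_zero, add_zero, hv] at hw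
  have := H.eq_of_sum_eq hξ (add_left_cancel hw)
  rw [this, hb', zero_mul] at hb
  rw [this, hc', zero_mul] at hc
  exact ⟨(mul_eq_zero.1 hb.symm).resolve_right (H.τ_ne_zero ξ hξ b a hab.symm),
    (mul_eq_zero.1 hc.symm).resolve_right (H.τ_ne_zero ξ hξ c a hac.symm)⟩

/-- If the weight vanished, the affine combination of the tangents of `X a`, `Y a b`, `Y a c` would
lose its `∂_i x` component, and its `z`-coefficients would solve the homogeneous row `a`. It would
then lie in the direction of the plane, contradicting transversality. -/
theorem PairwiseSystem.weight_ne_zero_of_admissible (hr : 0 < r)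
    (H : PairwiseSystem r x X Y z κ φ u Ω τ) {a b c : Fin 3} (hab : a ≠ b) (hac : a ≠ c)
    (hbc : b ≠ c) {q : ℝ × ℝ} (hq : q ∈ admissible r (X a) (Y a b) (Y a c)) {v : Fin 3 → ℝ}
    (ha : v a = u a 0 + q.1 * (τ a b 0 - u a 0) + q.2 * (τ a c 0 - u a 0))
    (hb : v b = q.1 * τ b a 0) (hc : v c = q.2 * τ c a 0) (i : Fin m) :
    1 + ∑ d, κ d i 0 * v d ≠ 0 := by
  have h0 := zero_mem_cube (m := m) hr.le
  have hS := H.toPotentialSystem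
  have h₁ := H.isTransformCoeff_single a
  have h₂ := H.coeff a b hab
  have h₃ := H.coeff a c hac
  have hli := hq.2.2.2 i
  simp only [pd_eq_pderiv] at hli
  rw [← pderiv_congr (H.eqOn_single a) h0, ← pderiv_congr (H.eqOn_pair hab) h0,
    ← pderiv_congr (H.eqOn_pair hac) h0, hS.pderiv_combination hr h₁.smooth h0,
    hS.pderiv_combination hr h₂.smooth h0, hS.pderiv_combination hr h₃.smooth h0] at hli
  have r₁ := h₁.row_pderiv hr hS h0 i (a := a) (by simp)
  have r₂ := h₂.row_pderiv hr hS h0 i (a := a) (by simp)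
  have r₃ := h₃.row_pderiv hr hS h0 i (a := a) (by simp)
  rw [weight_singleCoeff] at hli r₁
  rw [weight_pairCoeff] at hli r₂
  rw [weight_pairCoeff] at hli r₃
  set σ₁ := singleCoeff a (u a)
  set σ₂ := pairCoeff a b (τ a b) (τ b a)
  set σ₃ := pairCoeff a c (τ a c) (τ c a)
  intro hW
  have hW' : (1 - q.1 - q.2) * (1 + κ a i 0 * u a 0) +
      q.1 * (1 + (κ a i 0 * τ a b 0 + κ b i 0 * τ b a 0)) +
      q.2 * (1 + (κ a i 0 * τ a c 0 + κ c i 0 * τ c a 0)) = 0 := by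
    rw [← hW, sum_fin_three _ hab hac hbc, ha, hb, hc]
    ring
  have hsum := H.sum_eq_of_row_eq_zero hab hac hbc h0
    (v := fun d => (1 - q.1 - q.2) * pderiv r i (σ₁ d) 0 + q.1 * pderiv r i (σ₂ d) 0 +
      q.2 * pderiv r i (σ₃ d) 0) (by
        have e : ∀ d, Ω a d 0 * ((1 - q.1 - q.2) * pderiv r i (σ₁ d) 0 +
            q.1 * pderiv r i (σ₂ d) 0 + q.2 * pderiv r i (σ₃ d) 0) =
            (1 - q.1 - q.2) * (Ω a d 0 * pderiv r i (σ₁ d) 0) +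
            q.1 * (Ω a d 0 * pderiv r i (σ₂ d) 0) + q.2 * (Ω a d 0 * pderiv r i (σ₃ d) 0) :=
          fun d => by ring
        simp only [e, Finset.sum_add_distrib, ← Finset.mul_sum]
        rw [r₁, r₂, r₃]
        linear_combination -pderiv r i (φ a) 0 * hW')
  simp only [add_smul, mul_smul, Finset.sum_add_distrib, ← Finset.smul_sum] at hsum
  have hx : ((1 - q.1 - q.2) * (1 + κ a i 0 * u a 0) +
      q.1 * (1 + (κ a i 0 * τ a b 0 + κ b i 0 * τ b a 0)) +
      q.2 * (1 + (κ a i 0 * τ a c 0 + κ c i 0 * τ c a 0))) • pderiv r i x 0 = 0 := by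
    rw [hW', zero_smul]
  set β := ((1 - q.1 - q.2) * pderiv r i (σ₁ b) 0 + q.1 * pderiv r i (σ₂ b) 0 +
    q.2 * pderiv r i (σ₃ b) 0) / τ b a 0
  set γ := ((1 - q.1 - q.2) * pderiv r i (σ₁ c) 0 + q.1 * pderiv r i (σ₂ c) 0 +
    q.2 * pderiv r i (σ₃ c) 0) / τ c a 0
  exact one_ne_zero (coeff_eq_zero_of_triple hli (p := 1) (q := -β) (s := -γ) (by linear_combination (norm := module) hx + hsum)).1

/-- The eighth net, near the origin. -/
theorem PairwiseSystem.exists_transform (hr : 0 < r)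
    (H : PairwiseSystem r x X Y z κ φ u Ω τ) {p : EuclideanSpace ℝ (Fin N)}
    (hp : ∀ p', (∀ a b c, a ≠ b → a ≠ c → b ≠ c →
      p' ∈ affineSpan ℝ {X a 0, Y a b 0, Y a c 0}) → p' = p)
    (hpg : ∀ a b c, a ≠ b → a ≠ c → b ≠ c → IsGenericFourthPoint r (X a) (Y a b) (Y a c) p) :
    ∃ ρ, 0 < ρ ∧ ρ ≤ r ∧ ∃ y : Net m N,
      (∀ a b c, a ≠ b → a ≠ c → b ≠ c →
        IsCoplanarCommonTransform ρ (X a) (Y a b) (Y a c) y) ∧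
      ∀ (ρ' : ℝ) (y' : Net m N), 0 < ρ' → ρ' ≤ ρ →
        (∀ a b c, a ≠ b → a ≠ c → b ≠ c →
          IsCoplanarCommonTransform ρ' (X a) (Y a b) (Y a c) y') →
        Set.EqOn y' y (cube m ρ') := by
  have h0 := zero_mem_cube (m := m) hr.le
  have h01 : (0 : Fin 3) ≠ 1 := by decide
  have h02 : (0 : Fin 3) ≠ 2 := by decide
  have h12 : (1 : Fin 3) ≠ 2 := by decide
  obtain ⟨q, hq, hpq⟩ := hpg 0 1 2 h01 h02 h12
  obtain ⟨w, hw0, hw1, hw2, -, hpw⟩ := H.exists_row_eq h01 h02 h12 h0 q.1 q.2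
  rw [← planePoint, ← hpq] at hpw
  -- The point `p` has only one coordinate vector `w`, so its position in each of the three planes
  -- gives a row equation for the same `w`.
  have hww : ∀ a b c, a ≠ b → a ≠ c → b ≠ c →
      ∑ d, Ω a d 0 * w d = -φ a 0 ∧ w b ≠ 0 := by
    intro a b c hab hac hbc
    obtain ⟨q', hq', hpq'⟩ := hpg a b c hab hac hbc
    obtain ⟨w', -, hb, -, hrow, hpw'⟩ := H.exists_row_eq hab hac hbc h0 q'.1 q'.2
    rw [← planePoint, ← hpq', hpw] at hpw'
    rw [H.eq_of_sum_eq h0 (add_left_cancel hpw')]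
    exact ⟨hrow, hb ▸ mul_ne_zero hq'.1 (H.τ_ne_zero 0 h0 b a hab.symm)⟩
  have hoth : ∀ a : Fin 3, ∃ b c, a ≠ b ∧ a ≠ c ∧ b ≠ c := by decide
  have hwrow : ∀ a, ∑ d, Ω a d 0 * w d = -φ a 0 := by
    intro a
    obtain ⟨b, c, hab, hac, hbc⟩ := hoth a
    exact (hww a b c hab hac hbc).1
  have hwne : ∀ a, w a ≠ 0 := by
    intro a
    obtain ⟨b, c, hab, hac, hbc⟩ := hoth a
    exact (hww b a c hab.symm hbc hac).2
  let M : (Fin m → ℝ) → Matrix (Fin 3) (Fin 3) ℝ := fun ξ => Matrix.of fun a b => Ω a b ξ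
  have hM : ∀ a b, SmoothOnCube r fun ξ => M ξ a b := H.smooth_Ω
  -- A kernel vector would translate `p` inside all three planes at once, producing a second common
  -- point.
  have hdet₀ : (M 0).det ≠ 0 := by
    intro hdet
    obtain ⟨v, hv0, hv⟩ := Matrix.exists_mulVec_eq_zero_iff.2 hdet
    have hp' := hp (x 0 + ∑ d, (w d + v d) • z d 0) fun a b c hab hac hbc => by
      have hva : ∑ d, Ω a d 0 * v d = 0 := congrFun hv a
      rw [H.eq_of_row_eq hab hac hbc h0 (v := fun d => w d + v d) (by
        simp only [mul_add, Finset.sum_add_distrib]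
        rw [hwrow, hva, add_zero])]
      exact mem_affineSpan_triple _ _ _ _ _
    rw [hpw] at hp'
    refine hv0 (funext fun d => ?_)
    have := congrFun (H.eq_of_sum_eq h0 (add_left_cancel hp')) d
    simpa using this
  obtain ⟨ρ₁, hρ₁, hρ₁r, hdet⟩ := exists_cube_of_eventually hr
    (SmoothOnCube.eventually_ne hr.le (contDiffOn_det hM) hdet₀)
  have hsub₁ := cube_mono (m := m) hρ₁r
  let σ : Fin 3 → (Fin m → ℝ) → ℝ := fun d ξ => ((M ξ)⁻¹.mulVec fun a => -φ a ξ) d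
  have hσM : ∀ ξ ∈ cube m ρ₁, (M ξ).mulVec (fun d => σ d ξ) = fun a => -φ a ξ := by
    intro ξ hξ
    change (M ξ).mulVec ((M ξ)⁻¹.mulVec fun a => -φ a ξ) = _
    rw [Matrix.mulVec_mulVec, Matrix.mul_nonsing_inv _ (isUnit_iff_ne_zero.2 (hdet ξ hξ)),
      Matrix.one_mulVec]
  have hσs : ∀ d, SmoothOnCube ρ₁ (σ d) := fun d =>
    contDiffOn_of_mulVec_eq (c := fun ξ d => σ d ξ) (fun a b => (hM a b).mono hρ₁r)
      (fun a => ((H.datum a).smooth_φ.mono hρ₁r).neg) hdet hσM d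
  have huniq : ∀ ξ ∈ cube m ρ₁, ∀ v : Fin 3 → ℝ, (∀ a, ∑ d, Ω a d ξ * v d = -φ a ξ) →
      v = fun d => σ d ξ := by
    intro ξ hξ v hv
    refine sub_eq_zero.1 (Matrix.eq_zero_of_mulVec_eq_zero (hdet ξ hξ) ?_)
    rw [Matrix.mulVec_sub, hσM ξ hξ, sub_eq_zero]
    exact funext hv
  have h0₁ := zero_mem_cube (m := m) hρ₁.le
  have hσ0 : ∀ d, σ d 0 = w d := fun d => (congrFun (huniq 0 h0₁ w hwrow) d).symm
  have H₁ := H.mono hr hρ₁ hρ₁r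
  obtain ⟨ρ, hρ, hρρ₁, hall⟩ := exists_cube_of_eventually hρ₁
    (P := fun ξ => (∀ d, σ d ξ ≠ 0) ∧ ∀ i, weight κ σ i ξ ≠ 0) (by
      refine (Filter.eventually_all.2 fun d => ?_).and (Filter.eventually_all.2 fun i => ?_)
      · exact (hσs d).eventually_ne hρ₁.le (by rw [hσ0]; exact hwne d)
      · refine (H₁.smooth_weight hσs i).eventually_ne hρ₁.le ?_
        simp only [weight, hσ0]
        exact H.weight_ne_zero_of_admissible hr h01 h02 h12 hq hw0 hw1 hw2 i)
  have hsub := cube_mono (m := m) hρρ₁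
  have H₂ := H₁.mono hρ₁ hρ hρρ₁
  have hrow : ∀ ξ ∈ cube m ρ₁, ∀ a, ∑ d, Ω a d ξ * σ d ξ = -φ a ξ :=
    fun ξ hξ a => congrFun (hσM ξ hξ) a
  have hT : IsTransformCoeff ρ κ φ Ω Finset.univ σ :=
    { smooth := fun a => (hσs a).mono hρρ₁
      supp := fun ξ _ a ha => absurd (Finset.mem_univ a) ha
      row := fun ξ hξ a _ => hrow ξ (hsub hξ) a
      nondeg := fun ξ hξ v _ hv =>
        Matrix.eq_zero_of_mulVec_eq_zero (hdet ξ (hsub hξ))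
          (funext fun a => hv a (Finset.mem_univ a))
      weight_ne_zero := fun ξ hξ => (hall ξ hξ).2 }
  have hins : ∀ a b c : Fin 3, a ≠ b → a ≠ c → b ≠ c →
      insert c ({a, b} : Finset (Fin 3)) = Finset.univ ∧ c ∉ ({a, b} : Finset (Fin 3)) := by
    decide
  have hJ : ∀ a b c, a ≠ b → a ≠ c → b ≠ c →
      IsJonasPair ρ (Y a b) (combination x z σ) := by
    intro a b c hab hac hbc
    obtain ⟨h1, h2⟩ := hins a b c hab hac hbc
    exact ((H₂.coeff a b hab).isJonasPair hρ H₂.toPotentialSystem (h1.symm ▸ hT) h2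
      fun ξ hξ => (hall ξ hξ).1 c).congr (H₂.eqOn_pair hab) fun _ _ => rfl
  refine ⟨ρ, hρ, hρρ₁.trans hρ₁r, combination x z σ, fun a b c hab hac hbc =>
    ⟨hJ a b c hab hac hbc, hJ a c b hac hab hbc.symm, fun ξ hξ =>
      coplanar_of_eq (H₂.eq_of_row_eq hab hac hbc hξ (hrow ξ (hsub hξ) a))⟩, ?_⟩
  intro ρ' y' hρ' hρ'ρ hy' ξ hξ
  have hξ₁ := hsub (cube_mono hρ'ρ hξ)
  have hξr := hsub₁ hξ₁
  -- Uniqueness is pointwise and uses coplanarity alone: each plane through `y' ξ` gives one row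
  -- equation for its coordinates, and the three rows have a single solution.
  have hex : ∀ a b c, a ≠ b → a ≠ c → b ≠ c → ∃ v : Fin 3 → ℝ,
      ∑ d, Ω a d ξ * v d = -φ a ξ ∧ y' ξ = x ξ + ∑ d, v d • z d ξ := by
    intro a b c hab hac hbc
    obtain ⟨s, t, hst⟩ := exists_eq_of_coplanar ((hy' a b c hab hac hbc).2.2 ξ hξ)
      (H.linearIndependent_edges hab hac hbc hξr)
    obtain ⟨v, -, -, -, hv, hv'⟩ := H.exists_row_eq hab hac hbc hξr s t
    exact ⟨v, hv, hst.trans hv'⟩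
  obtain ⟨v, -, hv⟩ := hex 0 1 2 h01 h02 h12
  have hvrow : ∀ a, ∑ d, Ω a d ξ * v d = -φ a ξ := by
    intro a
    obtain ⟨b, c, hab, hac, hbc⟩ := hoth a
    obtain ⟨v', hrow', hv'⟩ := hex a b c hab hac hbc
    rw [hv] at hv'
    rw [H.eq_of_sum_eq hξr (add_left_cancel hv')]
    exact hrow'
  rw [hv, huniq ξ hξ₁ v hvrow]
  rfl

theorem IsCoplanarCommonTransform.symm {x x₁ x₂ y : Net m N}
    (h : IsCoplanarCommonTransform r x x₁ x₂ y) : IsCoplanarCommonTransform r x x₂ x₁ y :=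
  ⟨h.2.1, h.1, fun ξ hξ => by rw [Set.insert_comm (x₂ ξ)]; exact h.2.2 ξ hξ⟩

theorem IsGenericFourthPoint.symm {x x₁ x₂ : Net m N} {p : EuclideanSpace ℝ (Fin N)}
    (h : IsGenericFourthPoint r x x₁ x₂ p) : IsGenericFourthPoint r x x₂ x₁ p := by
  obtain ⟨q, ⟨h1, h2, h3, h4⟩, hp⟩ := h
  refine ⟨q.swap, ⟨h2, h1, by rwa [Prod.fst_swap, Prod.snd_swap, add_comm], fun i => ?_⟩, ?_⟩
  · have e : (1 - q.swap.1 - q.swap.2) • pd r i x 0 + q.swap.1 • pd r i x₂ 0 +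
        q.swap.2 • pd r i x₁ 0 = (1 - q.1 - q.2) • pd r i x 0 + q.1 • pd r i x₁ 0 +
        q.2 • pd r i x₂ 0 := by
      simp only [Prod.fst_swap, Prod.snd_swap]
      module
    rw [e]
    exact linearIndependent_swap (h4 i)
  · rw [hp]
    simp only [planePoint, Prod.fst_swap, Prod.snd_swap]
    abel

/-- Ordered triples of distinct indices reduce to three of them. -/
theorem forall_distinct_fin_three {P : Fin 3 → Fin 3 → Fin 3 → Prop}
    (hP : ∀ a b c, P a b c → P a c b) (h₀ : P 0 1 2) (h₁ : P 1 0 2) (h₂ : P 2 0 1)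
    (a b c : Fin 3) (hab : a ≠ b) (hac : a ≠ c) (hbc : b ≠ c) : P a b c := by
  have : (a = 0 ∧ b = 1 ∧ c = 2) ∨ (a = 0 ∧ b = 2 ∧ c = 1) ∨ (a = 1 ∧ b = 0 ∧ c = 2) ∨
      (a = 1 ∧ b = 2 ∧ c = 0) ∨ (a = 2 ∧ b = 0 ∧ c = 1) ∨ (a = 2 ∧ b = 1 ∧ c = 0) := by
    revert a b c
    decide
  rcases this with ⟨rfl, rfl, rfl⟩ | ⟨rfl, rfl, rfl⟩ | ⟨rfl, rfl, rfl⟩ | ⟨rfl, rfl, rfl⟩ |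
    ⟨rfl, rfl, rfl⟩ | ⟨rfl, rfl, rfl⟩
  exacts [h₀, hP _ _ _ h₀, h₁, hP _ _ _ h₁, h₂, hP _ _ _ h₂]

theorem forall_distinct_pair_fin_three {P : Fin 3 → Fin 3 → Prop}
    (hP : ∀ a b, P a b → P b a) (h₀ : P 0 1) (h₁ : P 0 2) (h₂ : P 1 2)
    (a b : Fin 3) (hab : a ≠ b) : P a b := by
  fin_cases a <;> fin_cases b
  exacts [absurd rfl hab, h₀, h₁, hP _ _ h₀, absurd rfl hab, h₂, hP _ _ h₁, hP _ _ h₂,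
    absurd rfl hab]

theorem exists_unique_eighth_net (hm : 0 < m) (hr : 0 < r)
    {x x₁ x₂ x₃ x₁₂ x₁₃ x₂₃ : Net m N}
    (h₁ : IsJonasPair r x x₁) (h₂ : IsJonasPair r x x₂) (h₃ : IsJonasPair r x x₃)
    (h₁₂ : IsCoplanarCommonTransform r x x₁ x₂ x₁₂)
    (h₁₃ : IsCoplanarCommonTransform r x x₁ x₃ x₁₃)
    (h₂₃ : IsCoplanarCommonTransform r x x₂ x₃ x₂₃)
    (hg₁₂ : GenericPair r x x₁ x₂) (hg₁₃ : GenericPair r x x₁ x₃)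
    (hg₂₃ : GenericPair r x x₂ x₃)
    (hind : LinearIndependent ℝ ![x₁ 0 - x 0, x₂ 0 - x 0, x₃ 0 - x 0])
    (hp₁₂ : IsGenericFourthPoint r x x₁ x₂ (x₁₂ 0))
    (hp₁₃ : IsGenericFourthPoint r x x₁ x₃ (x₁₃ 0))
    (hp₂₃ : IsGenericFourthPoint r x x₂ x₃ (x₂₃ 0)) {p : EuclideanSpace ℝ (Fin N)}
    (hp : (affineSpan ℝ {x₁ 0, x₁₂ 0, x₁₃ 0} : Set (EuclideanSpace ℝ (Fin N))) ∩
      affineSpan ℝ {x₂ 0, x₁₂ 0, x₂₃ 0} ∩ affineSpan ℝ {x₃ 0, x₁₃ 0, x₂₃ 0} = {p})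
    (hq₁ : IsGenericFourthPoint r x₁ x₁₂ x₁₃ p) (hq₂ : IsGenericFourthPoint r x₂ x₁₂ x₂₃ p)
    (hq₃ : IsGenericFourthPoint r x₃ x₁₃ x₂₃ p) :
    ∃ ρ : ℝ, 0 < ρ ∧ ρ ≤ r ∧ ∃ y : Net m N,
      (IsCoplanarCommonTransform ρ x₁ x₁₂ x₁₃ y ∧ IsCoplanarCommonTransform ρ x₂ x₁₂ x₂₃ y ∧
        IsCoplanarCommonTransform ρ x₃ x₁₃ x₂₃ y) ∧
      ∀ (ρ' : ℝ) (y' : Net m N), 0 < ρ' → ρ' ≤ ρ →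
        IsCoplanarCommonTransform ρ' x₁ x₁₂ x₁₃ y' →
        IsCoplanarCommonTransform ρ' x₂ x₁₂ x₂₃ y' →
        IsCoplanarCommonTransform ρ' x₃ x₁₃ x₂₃ y' → Set.EqOn y' y (cube m ρ') := by
  let X : Fin 3 → Net m N := ![x₁, x₂, x₃]
  -- The diagonal entries `x` are placeholders; only distinct indices are ever used.
  let Y : Fin 3 → Fin 3 → Net m N := ![![x, x₁₂, x₁₃], ![x₁₂, x, x₂₃], ![x₁₃, x₂₃, x]]
  have hsymm : ∀ a b, Y a b = Y b a := by
    intro a b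
    fin_cases a <;> fin_cases b <;> rfl
  have hJ : ∀ a, IsJonasPair r x (X a) := by
    intro a
    fin_cases a
    exacts [h₁, h₂, h₃]
  obtain ⟨ρ, hρ, hρr, z, κ, φ, u, Ω, τ, H⟩ := exists_pairwiseSystem hm hr hJ hsymm
    (forall_distinct_pair_fin_three
      (fun a b (h : IsCoplanarCommonTransform r x (X a) (X b) (Y a b)) => hsymm a b ▸ h.symm)
      h₁₂ h₁₃ h₂₃)
    (forall_distinct_pair_fin_three (fun a b (h : GenericPair r x (X a) (X b)) => h.symm)
      hg₁₂ hg₁₃ hg₂₃)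
    (by
      have e : (fun a => X a 0 - x 0) = ![x₁ 0 - x 0, x₂ 0 - x 0, x₃ 0 - x 0] := by
        ext a
        fin_cases a <;> rfl
      rw [e]
      exact hind)
    (forall_distinct_pair_fin_three
      (fun a b (h : IsGenericFourthPoint r x (X a) (X b) (Y a b 0)) => hsymm a b ▸ h.symm)
      hp₁₂ hp₁₃ hp₂₃)
  have hle : ∀ {x x₁ x₂ : Net m N}, SmoothOnCube r x → SmoothOnCube r x₁ → SmoothOnCube r x₂ →
      IsGenericFourthPoint r x x₁ x₂ p → IsGenericFourthPoint ρ x x₁ x₂ p := by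
    rintro x x₁ x₂ hx hx₁ hx₂ ⟨q, hq, hpq⟩
    exact ⟨q, admissible_of_le hρ hρr hx hx₁ hx₂ ▸ hq, hpq⟩
  obtain ⟨ρ', hρ', hρ'ρ, y, hy, hu⟩ := H.exists_transform hρ (p := p)
    (fun p' hp' => by
      have : p' ∈ ({p} : Set (EuclideanSpace ℝ (Fin N))) := by
        rw [← hp]
        exact ⟨⟨hp' 0 1 2 (by decide) (by decide) (by decide),
          hp' 1 0 2 (by decide) (by decide) (by decide)⟩,
          hp' 2 0 1 (by decide) (by decide) (by decide)⟩
      exact this)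
    (forall_distinct_fin_three (fun _ _ _ h => h.symm)
      (hle h₁.2.1.1 h₁₂.1.2.1.1 h₁₃.1.2.1.1 hq₁) (hle h₂.2.1.1 h₁₂.1.2.1.1 h₂₃.1.2.1.1 hq₂)
      (hle h₃.2.1.1 h₁₃.1.2.1.1 h₂₃.1.2.1.1 hq₃))
  refine ⟨ρ', hρ', hρ'ρ.trans hρr, y, ⟨hy 0 1 2 (by decide) (by decide) (by decide),
    hy 1 0 2 (by decide) (by decide) (by decide), hy 2 0 1 (by decide) (by decide) (by decide)⟩,
    fun ρ'' y' hρ'' hle'' k₁ k₂ k₃ => hu ρ'' y' hρ'' hle''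
      (forall_distinct_fin_three (fun _ _ _ h => h.symm) k₁ k₂ k₃)⟩

end ThreeTransforms
end Jonas

/-! ### Assembly of the three statements. -/

theorem mainTheorem11 (m N : ℕ) (hm : 0 < m) (r : ℝ) (hr : 0 < r) :
    -- two transforms: the two-parameter family of common transforms
    (∀ x x₁ x₂ : Jonas.Net m N,
      Jonas.IsJonasPair r x x₁ → Jonas.IsJonasPair r x x₂ →
      Jonas.GenericPair r x x₁ x₂ →
      IsOpen (Jonas.admissible r x x₁ x₂) ∧ Dense (Jonas.admissible r x x₁ x₂) ∧
      ∀ q₀ ∈ Jonas.admissible r x x₁ x₂,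
        ∃ V : Set (ℝ × ℝ), IsOpen V ∧ q₀ ∈ V ∧ ∃ ρ : ℝ, 0 < ρ ∧ ρ ≤ r ∧
        ∃ y : ℝ × ℝ → Jonas.Net m N,
          ContDiffOn ℝ ∞ (fun z : (ℝ × ℝ) × (Fin m → ℝ) => y z.1 z.2)
            (V ×ˢ Jonas.cube m ρ) ∧
          ∀ q ∈ V,
            y q 0 = Jonas.planePoint x x₁ x₂ q ∧
            Jonas.IsCoplanarCommonTransform ρ x x₁ x₂ (y q) ∧
            ∀ (ρ' : ℝ) (y' : Jonas.Net m N), 0 < ρ' → ρ' ≤ ρ →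
              Jonas.IsCoplanarCommonTransform ρ' x x₁ x₂ y' →
              y' 0 = Jonas.planePoint x x₁ x₂ q →
              Set.EqOn y' (y q) (Jonas.cube m ρ')) ∧
    -- coplanarity for an arbitrary common transform, at points in general position
    (∀ x x₁ x₂ y : Jonas.Net m N,
      Jonas.IsJonasPair r x x₁ → Jonas.IsJonasPair r x x₂ →
      Jonas.IsJonasPair r x₁ y → Jonas.IsJonasPair r x₂ y →
      ∀ ξ ∈ Jonas.cube m r, ∀ i j : Fin m,
        LinearIndependent ℝ
          ![Jonas.pd r i x ξ, Jonas.pd r j x ξ, x₁ ξ - x ξ, x₂ ξ - x ξ] →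
        LinearIndependent ℝ ![Jonas.pd r i x₁ ξ, Jonas.pd r i x₂ ξ, x₁ ξ - x₂ ξ] →
        LinearIndependent ℝ ![Jonas.pd r j x₁ ξ, Jonas.pd r j x₂ ξ, x₁ ξ - x₂ ξ] →
        Jonas.pd r i y ξ ≠ 0 → Jonas.pd r j y ξ ≠ 0 →
        Coplanar ℝ {x ξ, x₁ ξ, x₂ ξ, y ξ}) ∧
    -- three transforms: the unique common transform of the three pairwise common transforms
    (∀ x x₁ x₂ x₃ x₁₂ x₁₃ x₂₃ : Jonas.Net m N,
      Jonas.IsJonasPair r x x₁ → Jonas.IsJonasPair r x x₂ → Jonas.IsJonasPair r x x₃ →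
      Jonas.IsCoplanarCommonTransform r x x₁ x₂ x₁₂ →
      Jonas.IsCoplanarCommonTransform r x x₁ x₃ x₁₃ →
      Jonas.IsCoplanarCommonTransform r x x₂ x₃ x₂₃ →
      Jonas.GenericPair r x x₁ x₂ → Jonas.GenericPair r x x₁ x₃ → Jonas.GenericPair r x x₂ x₃ →
      LinearIndependent ℝ ![x₁ 0 - x 0, x₂ 0 - x 0, x₃ 0 - x 0] →
      Jonas.IsGenericFourthPoint r x x₁ x₂ (x₁₂ 0) →
      Jonas.IsGenericFourthPoint r x x₁ x₃ (x₁₃ 0) →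
      Jonas.IsGenericFourthPoint r x x₂ x₃ (x₂₃ 0) →
      ∀ p : EuclideanSpace ℝ (Fin N),
      (affineSpan ℝ {x₁ 0, x₁₂ 0, x₁₃ 0} : Set (EuclideanSpace ℝ (Fin N))) ∩
        affineSpan ℝ {x₂ 0, x₁₂ 0, x₂₃ 0} ∩ affineSpan ℝ {x₃ 0, x₁₃ 0, x₂₃ 0} = {p} →
      Jonas.IsGenericFourthPoint r x₁ x₁₂ x₁₃ p →
      Jonas.IsGenericFourthPoint r x₂ x₁₂ x₂₃ p →
      Jonas.IsGenericFourthPoint r x₃ x₁₃ x₂₃ p →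
      ∃ ρ : ℝ, 0 < ρ ∧ ρ ≤ r ∧ ∃ y : Jonas.Net m N,
        (Jonas.IsCoplanarCommonTransform ρ x₁ x₁₂ x₁₃ y ∧
          Jonas.IsCoplanarCommonTransform ρ x₂ x₁₂ x₂₃ y ∧
          Jonas.IsCoplanarCommonTransform ρ x₃ x₁₃ x₂₃ y) ∧
        ∀ (ρ' : ℝ) (y' : Jonas.Net m N), 0 < ρ' → ρ' ≤ ρ →
          Jonas.IsCoplanarCommonTransform ρ' x₁ x₁₂ x₁₃ y' →
          Jonas.IsCoplanarCommonTransform ρ' x₂ x₁₂ x₂₃ y' →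
          Jonas.IsCoplanarCommonTransform ρ' x₃ x₁₃ x₂₃ y' →
          Set.EqOn y' y (Jonas.cube m ρ')) :=
  ⟨fun _ _ _ h₁ h₂ hg => Jonas.exists_permutability_family hm hr h₁ h₂ hg,
    fun _ _ _ _ h₁ h₂ h₁y h₂y _ hξ _ _ hind hi hj hyi hyj =>
      Jonas.coplanar_of_common_transform h₁ h₂ h₁y h₂y hξ hind hi hj hyi hyj,
    fun _ _ _ _ _ _ _ h₁ h₂ h₃ h₁₂ h₁₃ h₂₃ g₁₂ g₁₃ g₂₃ hind p₁₂ p₁₃ p₂₃ _ hp q₁ q₂ q₃ =>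
      Jonas.exists_unique_eighth_net hm hr h₁ h₂ h₃ h₁₂ h₁₃ h₂₃ g₁₂ g₁₃ g₂₃ hind p₁₂ p₁₃ p₂₃ hp
        q₁ q₂ q₃⟩
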